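/- Let $Y$ be a connected Riemann surface, let $\Omega_0=\mathbb C$ with coordinate $\hbar$, $\mathcal Y=Y\times\Omega_0$, $\mathbf S=\{|\hbar|=1\}$ and $\sigma(\hbar)=-1/\bar\hbar$. For functions or sheaves, twistor conjugation is the usual conjugation in the $Y$-direction combined with conjugation and pull-back by $\sigma$ in the $\hbar$-direction (so that the twistor conjugate of the function $\hbar$ is $-1/\hbar$). A *smooth object* $\mathcal T=(\mathcal H',\mathcal H',C)$ of $\mathcal R\text{-Triples}(Y)$ consists of a locally free $\mathcal O_{\mathcal Y}$-module $\mathcal H'$ of finite rank with an action of the operators $\hbar\xi$ ($\xi$ a local holomorphic vector field on $Y$), $\mathcal O_{\mathcal Y}$-linear in $\xi$ and satisfying the Leibniz rule $(\hbar\xi)(fm)=f\,(\hbar\xi)m+\hbar\xi(f)\,m$, and of a pairing $C$ between $\mathcal H'_{|\mathbf S}$ and its twistor conjugate with values in functions on $Y\times\mathbf S$ which are $C^\infty$ along $Y$ and continuous in $\hbar\in\mathbf S$, linear over $\mathcal O_{\mathcal Y}$, its conjugate, the operators $\hbar\xi$ and their conjugates. It is *integrable* if $\mathcal H'$ can be equipped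 with an action of $\hbar^2\partial_\hbar$ satisfying the Leibniz rule, $[\hbar^2\partial_\hbar,\hbar\xi]=\hbar\cdot\hbar\xi$ and $$\hbar\partial_\hbar C(m,\overline{n})=C(\hbar\partial_\hbar m,\overline n)-C(m,\overline{\hbar\partial_\hbar n}).$$ Such an action is called an integrable structure on $\mathcal T$. Let $(V,\nabla)$ be a holomorphic vector bundle with holomorphic (hence flat) connection on $Y$, $F_\bullet V$ a finite increasing filtration by holomorphic subbundles with $\nabla F_pV\subset \Omega^1_Y\otimes F_{p+1}V$, and $k:V\otimes\overline V\to C^\infty_Y$ a $\nabla$-flat sesquilinear pairing. The associated Rees triple $(R_FV,R_FV,R_Fk)$ is given by $R_FV=\bigoplus_p \hbar^pF_pV$, with the action $(\hbar\xi)(\hbar^pv)=\hbar^{p+1}\nabla_\xi v$, and $R_Fk(\hbar^pv,\overline{\hbar^qw})=\hbar^p\bar\hbar^q k(v,\overline w)$, where $\bar\hbar$ is the twistor conjugate of $\hbar$. Its analytization is obtained by tensoring $R_FV$ with $\mathcal O_{\mathcal Y}$ over $\mathcal O_Y[\hbar]$. **Proposition.** Let $\mathcal T=(\mathcal H',\mathcal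 H',C)$ be a smooth object of $\mathcal R\text{-Triples}(Y)$. There are $(V,\nabla,F_\bullet V,k)$ as above and an isomorphism between $\mathcal H'$ and the analytization of $R_FV$, compatible with the operators $\hbar\xi$ and identifying $C$ with $R_Fk$, if and only if 1. $\mathcal T$ is integrable, that is, it has an integrable structure; and this structure can be chosen such that 2. $\mathcal H'$ is stable under $\hbar\partial_\hbar$ (and not only under $\hbar^2\partial_\hbar$), and 3. the monodromy around $\hbar=0$ of the flat connection on $\mathcal H'_{|\hbar\neq0}$ is the identity. More precisely, a given integrable structure on $\mathcal T$ satisfies (2) and (3) if and only if $(V,\nabla,F_\bullet V,k)$ and the isomorphism can be chosen so that it is also compatible with the given action of $\hbar^2\partial_\hbar$ and the natural one $\hbar^2\partial_\hbar(\hbar^pv)=p\,\hbar^{p+1}v$ on $R_FV$. -/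

import Mathlib

open Bundle Complex
open scoped Manifold ContDiff Topology ComplexConjugate

universe u v

noncomputable section

/-! ### Holomorphic vector bundles (locally free sheaves of finite rank) -/

/-- A holomorphic vector bundle of rank `r` on a complex manifold `B`, that is, a locally free
sheaf of modules of rank `r` over the sheaf of holomorphic functions. -/
structure HolBundle {EB H : Type*} [NormedAddCommGroup EB] [NormedSpace ℂ EB]
    [TopologicalSpace H] (J : ModelWithCorners ℂ EB H) (B : Type v) [TopologicalSpace B]
    [ChartedSpace H B] (r : ℕ) where
  /-- the fibre at a point -/
  fib : B → Type u
  [fibTop : ∀ b, TopologicalSpace (fib b)]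
  [fibGroup : ∀ b, AddCommGroup (fib b)]
  [fibModule : ∀ b, Module ℂ (fib b)]
  [totalTop : TopologicalSpace (TotalSpace (Fin r → ℂ) fib)]
  [fiberBundle : FiberBundle (Fin r → ℂ) fib]
  [vectorBundle : VectorBundle ℂ (Fin r → ℂ) fib]
  [holomorphic : ContMDiffVectorBundle ω (Fin r → ℂ) fib J]

attribute [instance] HolBundle.fibTop HolBundle.fibGroup HolBundle.fibModule HolBundle.totalTop
  HolBundle.fiberBundle HolBundle.vectorBundle HolBundle.holomorphic

/-- The (possibly junk outside `W`) section `m` is holomorphic on `W`. Local sections on an open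
set `W` are represented by globally defined functions, of which only the values on `W` matter. -/
def HolBundle.Hol {EB H : Type*} [NormedAddCommGroup EB] [NormedSpace ℂ EB]
    [TopologicalSpace H] {J : ModelWithCorners ℂ EB H} {B : Type v} [TopologicalSpace B]
    [ChartedSpace H B] {r : ℕ} (E : HolBundle.{u} J B r) (W : Set B) (m : ∀ b, E.fib b) : Prop :=
  ContMDiffOn J (J.prod 𝓘(ℂ, Fin r → ℂ)) ω
    (fun b => TotalSpace.mk' (Fin r → ℂ) b (m b)) W

/-- The model of the complex surface `Y × Ω₀`, where `Ω₀ = ℂ` has coordinate `ħ`. -/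
abbrev modelYΩ := (𝓘(ℂ, ℂ)).prod 𝓘(ℂ, ℂ)

section

variable (Y : Type v) [TopologicalSpace Y] [ChartedSpace ℂ Y] [IsManifold 𝓘(ℂ, ℂ) ω Y]

/-- `ξ` is a holomorphic vector field on `U ⊆ Y`. -/
def HolField (U : Set Y) (ξ : ∀ y : Y, TangentSpace 𝓘(ℂ, ℂ) y) : Prop :=
  ContMDiffOn 𝓘(ℂ, ℂ) (𝓘(ℂ, ℂ)).tangent ω (fun y => (⟨y, ξ y⟩ : TangentBundle 𝓘(ℂ, ℂ) Y)) U

variable {Y}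

/-- The derivative `ξ(f)` of a holomorphic function `f` on an open subset of `Y` along a
holomorphic tangent vector `ξ`. -/
def dY (f : Y → ℂ) (y : Y) (ξ : TangentSpace 𝓘(ℂ, ℂ) y) : ℂ :=
  mfderiv 𝓘(ℂ, ℂ) 𝓘(ℂ, ℂ) f y ξ

/-- The real derivative of a complex valued function on the real surface underlying `Y`. -/
def dReal (c : Y → ℂ) (y : Y) (ξ : TangentSpace 𝓘(ℂ, ℂ) y) : ℂ :=
  mfderiv 𝓘(ℝ, ℂ) 𝓘(ℝ, ℂ) c y ξ

/-- The `(1,0)`-derivative `ξ(c)`: in a coordinate `y`, if `ξ = ∂_y` this is `∂c/∂y`. -/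
def del (c : Y → ℂ) (y : Y) (ξ : TangentSpace 𝓘(ℂ, ℂ) y) : ℂ :=
  (dReal c y ξ - I * dReal c y (I • ξ)) / 2

/-- The `(0,1)`-derivative `ξ̄(c)`: in a coordinate `y`, if `ξ = ∂_y` this is `∂c/∂ȳ`. -/
def delBar (c : Y → ℂ) (y : Y) (ξ : TangentSpace 𝓘(ℂ, ℂ) y) : ℂ :=
  (dReal c y ξ + I * dReal c y (I • ξ)) / 2

end

/-- The antipodal involution `σ(ħ) = -1/ħ̄` of the twistor conjugation. -/
def antipode (z : ℂ) : ℂ := -1 / conj z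

theorem antipode_circle_ne_zero (z : Circle) : antipode (z : ℂ) ≠ 0 := by
  simp [antipode]

/-! ### Smooth objects `(H', H', C)` of the category of R-triples -/

/-- A smooth object `(H', H', C)` of R-Triples(Y). Here `H'` is a locally free sheaf of finite
rank on `Y × Ω₀`, with an action of the differential operators generated by the `ħ ξ`, for `ξ` a
holomorphic vector field on `Y`; and `C` is a sesquilinear pairing in the twistor sense, linear
over these operators and their conjugates. -/
structure SmoothTriple (Y : Type v) [TopologicalSpace Y] [ChartedSpace ℂ Y]
    [IsManifold 𝓘(ℂ, ℂ) ω Y] where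
  rank : ℕ
  /-- the locally free sheaf `H'` -/
  E : HolBundle.{u} modelYΩ (Y × ℂ) rank
  /-- `D m p ξ` is the value at `p = (y, ħ)` of the action of the operator `ħ ξ` on `m` -/
  D : (∀ p, E.fib p) → ∀ p : Y × ℂ, TangentSpace 𝓘(ℂ, ℂ) p.1 →ₗ[ℂ] E.fib p
  D_local : ∀ W : Set (Y × ℂ), IsOpen W → ∀ m n, E.Hol W m → E.Hol W n → (∀ p ∈ W, m p = n p) →
    ∀ p ∈ W, D m p = D n p
  D_add : ∀ W : Set (Y × ℂ), IsOpen W → ∀ m n, E.Hol W m → E.Hol W n →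
    ∀ p ∈ W, D (fun q => m q + n q) p = D m p + D n p
  D_leibniz : ∀ W : Set (Y × ℂ), IsOpen W → ∀ (f : Y × ℂ → ℂ) m,
    ContMDiffOn modelYΩ 𝓘(ℂ, ℂ) ω f W → E.Hol W m → ∀ p ∈ W, ∀ ξ,
    D (fun q => f q • m q) p ξ = f p • D m p ξ + (p.2 * dY (fun y => f (y, p.2)) p.1 ξ) • m p
  D_hol : ∀ (W : Set (Y × ℂ)) (U : Set Y), IsOpen W → IsOpen U → (∀ p ∈ W, p.1 ∈ U) →
    ∀ m ξ, E.Hol W m → HolField Y U ξ → E.Hol W (fun p => D m p (ξ p.1))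
  /-- The sesquilinear pairing over `𝕊 = {|ħ| = 1}`: at `(y, ħ)` it pairs `H'` at `(y, ħ)` with
  the twistor conjugate of `H'`, whose fibre at `(y, ħ)` is conjugate to that of `H'` at
  `(y, σ(ħ))`. -/
  C : ∀ (y : Y) (z : Circle),
    E.fib (y, (z : ℂ)) →ₗ[ℂ] E.fib (y, antipode z) →ₛₗ[starRingEnd ℂ] ℂ
  /-- `C` takes values in functions depending continuously on `ħ ∈ 𝕊` ... -/
  C_continuous : ∀ W W' : Set (Y × ℂ), IsOpen W → IsOpen W' → ∀ m n, E.Hol W m → E.Hol W' n →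
    ContinuousOn (fun q : Y × Circle => C q.1 q.2 (m (q.1, (q.2 : ℂ))) (n (q.1, antipode q.2)))
      {q | (q.1, (q.2 : ℂ)) ∈ W ∧ (q.1, antipode q.2) ∈ W'}
  /-- ... and `C^∞` with respect to `Y`. -/
  C_smooth : ∀ W W' : Set (Y × ℂ), IsOpen W → IsOpen W' → ∀ m n, E.Hol W m → E.Hol W' n →
    ∀ z : Circle, ContMDiffOn 𝓘(ℝ, ℂ) 𝓘(ℝ, ℂ) ∞
      (fun y => C y z (m (y, (z : ℂ))) (n (y, antipode z)))
      {y | (y, (z : ℂ)) ∈ W ∧ (y, antipode z) ∈ W'}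
  /-- `C((ħξ)m, n̄) = (ħξ) C(m, n̄)` -/
  C_D_left : ∀ W W' : Set (Y × ℂ), IsOpen W → IsOpen W' → ∀ m n, E.Hol W m → E.Hol W' n →
    ∀ (y : Y) (z : Circle), (y, (z : ℂ)) ∈ W → (y, antipode z) ∈ W' → ∀ ξ,
    C y z (D m (y, (z : ℂ)) ξ) (n (y, antipode z)) =
      z * del (fun y' => C y' z (m (y', (z : ℂ))) (n (y', antipode z))) y ξ
  /-- `C(m, conj((ħξ)n))` is the action of the twistor conjugate of the operator `ħξ` on
  `C(m, n̄)`; the conjugate of the function `ħ` is `conj (σ ħ) = -1/ħ`. -/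
  C_D_right : ∀ W W' : Set (Y × ℂ), IsOpen W → IsOpen W' → ∀ m n, E.Hol W m → E.Hol W' n →
    ∀ (y : Y) (z : Circle), (y, (z : ℂ)) ∈ W → (y, antipode z) ∈ W' → ∀ ξ,
    C y z (m (y, (z : ℂ))) (D n (y, antipode z) ξ) =
      conj (antipode z) * delBar (fun y' => C y' z (m (y', (z : ℂ))) (n (y', antipode z))) y ξ

variable {Y : Type v} [TopologicalSpace Y] [ChartedSpace ℂ Y] [IsManifold 𝓘(ℂ, ℂ) ω Y]

/-- An integrable structure on `(H', H', C)`: an action `δ` of `ħ²∂_ħ` on `H'`, with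
`[ħ²∂_ħ, ħξ] = ħ · ħξ`, such that
`ħ∂_ħ C(m, n̄) = C(ħ∂_ħ m, n̄) - C(m, conj (ħ∂_ħ n))`. -/
structure IntegrableStructure (T : SmoothTriple.{u} Y) where
  δ : (∀ p, T.E.fib p) → ∀ p, T.E.fib p
  δ_local : ∀ W : Set (Y × ℂ), IsOpen W → ∀ m n, T.E.Hol W m → T.E.Hol W n →
    (∀ p ∈ W, m p = n p) → ∀ p ∈ W, δ m p = δ n p
  δ_add : ∀ W : Set (Y × ℂ), IsOpen W → ∀ m n, T.E.Hol W m → T.E.Hol W n →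
    ∀ p ∈ W, δ (fun q => m q + n q) p = δ m p + δ n p
  δ_leibniz : ∀ W : Set (Y × ℂ), IsOpen W → ∀ (f : Y × ℂ → ℂ) m,
    ContMDiffOn modelYΩ 𝓘(ℂ, ℂ) ω f W → T.E.Hol W m → ∀ p ∈ W,
    δ (fun q => f q • m q) p = f p • δ m p + (p.2 ^ 2 * deriv (fun z => f (p.1, z)) p.2) • m p
  δ_hol : ∀ W : Set (Y × ℂ), IsOpen W → ∀ m, T.E.Hol W m → T.E.Hol W (δ m)
  δ_D : ∀ (W : Set (Y × ℂ)) (U : Set Y), IsOpen W → IsOpen U → (∀ p ∈ W, p.1 ∈ U) →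
    ∀ m ξ, T.E.Hol W m → HolField Y U ξ → ∀ p ∈ W,
    δ (fun q => T.D m q (ξ q.1)) p = T.D (δ m) p (ξ p.1) + p.2 • T.D m p (ξ p.1)
  /-- On functions on `𝕊`, `ħ∂_ħ` is `-i ∂/∂t` with `ħ = e^{it}`; on sections of `H'` over
  `ħ ≠ 0` it is `ħ⁻¹ δ`. -/
  δ_C : ∀ W W' : Set (Y × ℂ), IsOpen W → IsOpen W' → ∀ m n, T.E.Hol W m → T.E.Hol W' n →
    ∀ (y : Y) (z : Circle), (y, (z : ℂ)) ∈ W → (y, antipode z) ∈ W' →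
    HasDerivAt
      (fun t : ℝ => T.C y (z * Circle.exp t) (m (y, ((z * Circle.exp t : Circle) : ℂ)))
        (n (y, antipode ((z * Circle.exp t : Circle) : ℂ))))
      (I * (T.C y z ((z : ℂ)⁻¹ • δ m (y, (z : ℂ))) (n (y, antipode z)) -
        T.C y z (m (y, (z : ℂ))) ((antipode z)⁻¹ • δ n (y, antipode z)))) 0

/-- `H'` is relatively logarithmic: it is stable under `ħ∂_ħ`. -/
def IntegrableStructure.IsLogarithmic {T : SmoothTriple.{u} Y} (S : IntegrableStructure T) :
    Prop :=
  ∀ W : Set (Y × ℂ), IsOpen W → ∀ m, T.E.Hol W m →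
    ∃ n, T.E.Hol W n ∧ ∀ p ∈ W, S.δ m p = p.2 • n p

/-- `s` is a parallel section, for the connection on `H'` over `ħ ≠ 0`, along the loop
`t ↦ (y, e^{it} a)` around `ħ = 0` (seen as a path defined on `ℝ`). -/
def IntegrableStructure.IsParallel {T : SmoothTriple.{u} Y} (S : IntegrableStructure T)
    (y : Y) (a : ℂ) (s : ∀ t : ℝ, T.E.fib (y, exp (t * I) * a)) : Prop :=
  ∀ t : ℝ, ∃ (W : Set (Y × ℂ)) (m : ∀ p, T.E.fib p), IsOpen W ∧ (y, exp (t * I) * a) ∈ W ∧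
    T.E.Hol W m ∧ (∀ p ∈ W, S.δ m p = 0) ∧
    ∀ᶠ t' : ℝ in 𝓝 t, s t' = m (y, exp (t' * I) * a)

/-- The monodromy around `ħ = 0` is the identity: parallel sections along the loops
`t ↦ (y, e^{it} a)`, `0 ≤ t ≤ 2π`, return to their initial value. -/
def IntegrableStructure.TrivialMonodromy {T : SmoothTriple.{u} Y} (S : IntegrableStructure T) :
    Prop :=
  ∀ (y : Y) (a : ℂ), a ≠ 0 → ∀ s : (∀ t : ℝ, T.E.fib (y, exp (t * I) * a)),
    S.IsParallel y a s →
    TotalSpace.mk' (Fin T.rank → ℂ) (y, exp ((2 * Real.pi : ℝ) * I) * a) (s (2 * Real.pi)) =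
      TotalSpace.mk' (Fin T.rank → ℂ) (y, exp ((0 : ℝ) * I) * a) (s 0)

/-! ### Filtered flat bundles with a sesquilinear pairing and their Rees triples -/

/-- The data `(V, ∇, F_•V, k)` on a Riemann surface: a holomorphic bundle with a holomorphic
connection (flat, since `Y` has dimension one), a finite increasing filtration by holomorphic
subbundles satisfying Griffiths transversality, and a flat sesquilinear pairing
`k : V ⊗ conj V → C^∞_Y`. -/
structure FilteredFlatBundle (Y : Type v) [TopologicalSpace Y] [ChartedSpace ℂ Y]
    [IsManifold 𝓘(ℂ, ℂ) ω Y] where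
  rank : ℕ
  V : HolBundle.{u} 𝓘(ℂ, ℂ) Y rank
  /-- `conn v y ξ` is the value of `∇_ξ v` at `y` -/
  conn : (∀ y, V.fib y) → ∀ y : Y, TangentSpace 𝓘(ℂ, ℂ) y →ₗ[ℂ] V.fib y
  conn_local : ∀ U : Set Y, IsOpen U → ∀ v w, V.Hol U v → V.Hol U w → (∀ y ∈ U, v y = w y) →
    ∀ y ∈ U, conn v y = conn w y
  conn_add : ∀ U : Set Y, IsOpen U → ∀ v w, V.Hol U v → V.Hol U w →
    ∀ y ∈ U, conn (fun x => v x + w x) y = conn v y + conn w y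
  conn_leibniz : ∀ U : Set Y, IsOpen U → ∀ (f : Y → ℂ) v,
    ContMDiffOn 𝓘(ℂ, ℂ) 𝓘(ℂ, ℂ) ω f U → V.Hol U v → ∀ y ∈ U, ∀ ξ,
    conn (fun x => f x • v x) y ξ = f y • conn v y ξ + dY f y ξ • v y
  conn_hol : ∀ U : Set Y, IsOpen U → ∀ v ξ, V.Hol U v → HolField Y U ξ →
    V.Hol U (fun y => conn v y (ξ y))
  /-- the filtration `F_•V` -/
  F : ℤ → ∀ y, Submodule ℂ (V.fib y)
  F_mono : ∀ i j, i ≤ j → ∀ y, F i y ≤ F j y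
  F_finite : ∃ a b, ∀ y, F a y = ⊥ ∧ F b y = ⊤
  /-- each `F_iV` is a holomorphic subbundle: it is locally spanned by a part of a holomorphic
  frame of `V` -/
  F_subbundle : ∀ (i : ℤ) (y₀ : Y), ∃ (U : Set Y) (e : Fin rank → ∀ y, V.fib y)
    (K : Set (Fin rank)), IsOpen U ∧ y₀ ∈ U ∧ (∀ l, V.Hol U (e l)) ∧
    ∀ y ∈ U, LinearIndependent ℂ (fun l => e l y) ∧
      Submodule.span ℂ (Set.range fun l => e l y) = ⊤ ∧
      F i y = Submodule.span ℂ ((fun l => e l y) '' K)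
  /-- Griffiths transversality `∇ F_i ⊆ F_{i+1} ⊗ Ω¹` -/
  griffiths : ∀ (i : ℤ) (U : Set Y), IsOpen U → ∀ v, V.Hol U v → (∀ y ∈ U, v y ∈ F i y) →
    ∀ y ∈ U, ∀ ξ, conn v y ξ ∈ F (i + 1) y
  k : ∀ y, V.fib y →ₗ[ℂ] V.fib y →ₛₗ[starRingEnd ℂ] ℂ
  k_smooth : ∀ U : Set Y, IsOpen U → ∀ v w, V.Hol U v → V.Hol U w →
    ContMDiffOn 𝓘(ℝ, ℂ) 𝓘(ℝ, ℂ) ∞ (fun y => k y (v y) (w y)) U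
  k_flat_left : ∀ U : Set Y, IsOpen U → ∀ v w, V.Hol U v → V.Hol U w → ∀ y ∈ U, ∀ ξ,
    k y (conn v y ξ) (w y) = del (fun x => k x (v x) (w x)) y ξ
  k_flat_right : ∀ U : Set Y, IsOpen U → ∀ v w, V.Hol U v → V.Hol U w → ∀ y ∈ U, ∀ ξ,
    k y (v y) (conn w y ξ) = delBar (fun x => k x (v x) (w x)) y ξ

/-- Sections on `W` of the analytization `O_{Y × Ω₀} ⊗_{O_Y[ħ]} R_F V` of the Rees module
`R_F V = ⊕_d ħ^d F_d V ⊆ ℂ[ħ, ħ⁻¹] ⊗ V`. As `F_•V` is a finite filtration by subbundles, `R_F V` is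
locally free over `O_Y[ħ]`, and its analytization is the `O`-submodule of `O[ħ⁻¹] ⊗ V` generated
by `R_F V`: its sections on `W` are the sections `s` of (the pull-back of) `V` on
`W ∩ {ħ ≠ 0}` which, near each point of `W` (including those where `ħ = 0`), are finite sums
`∑ f_i ħ^{d_i} v_i` with `f_i` holomorphic on `Y × Ω₀` and `v_i` a local section of `F_{d_i}V`.
The values of `s` outside of `W` or at `ħ = 0` do not matter. -/
def FilteredFlatBundle.IsReesSection (𝒱 : FilteredFlatBundle.{u} Y) (W : Set (Y × ℂ))
    (s : ∀ p : Y × ℂ, 𝒱.V.fib p.1) : Prop :=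
  ∀ p ∈ W, ∃ (N : Set (Y × ℂ)) (n : ℕ) (f : Fin n → Y × ℂ → ℂ) (d : Fin n → ℤ)
    (v : Fin n → ∀ y, 𝒱.V.fib y), IsOpen N ∧ p ∈ N ∧ N ⊆ W ∧
    (∀ i, ContMDiffOn modelYΩ 𝓘(ℂ, ℂ) ω (f i) N) ∧
    (∀ i, 𝒱.V.Hol (Prod.fst '' N) (v i)) ∧
    (∀ i, ∀ y ∈ Prod.fst '' N, v i y ∈ 𝒱.F (d i) y) ∧
    ∀ q ∈ N, q.2 ≠ 0 → s q = ∑ i, (f i q * q.2 ^ d i) • v i q.1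

/-- An isomorphism between the analytization of `(R_F V, R_F V, R_F k)` and `(H', H', C)`: an
isomorphism of locally free sheaves from the analytization of `R_F V` to `H'`, compatible with the
actions of the operators `ħξ` and with the pairings. It is given over `ħ ≠ 0` by isomorphisms
of the fibres. -/
structure AnalytizationIso (𝒱 : FilteredFlatBundle.{u} Y) (T : SmoothTriple.{u} Y) where
  Φ : ∀ p : Y × ℂ, p.2 ≠ 0 → (𝒱.V.fib p.1 ≃ₗ[ℂ] T.E.fib p)
  /-- sections of the analytization of `R_F V` correspond to sections of `H'` -/
  sections : ∀ W : Set (Y × ℂ), IsOpen W → ∀ s : (∀ p : Y × ℂ, 𝒱.V.fib p.1),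
    𝒱.IsReesSection W s ↔
      ∃ m, T.E.Hol W m ∧ ∀ p ∈ W, ∀ hp : p.2 ≠ 0, m p = Φ p hp (s p)
  /-- `(ħξ)(ħ^d v) = ħ · ħ^d ∇_ξ v` -/
  map_D : ∀ (d : ℤ) (U : Set Y), IsOpen U → ∀ v, 𝒱.V.Hol U v → (∀ y ∈ U, v y ∈ 𝒱.F d y) →
    ∀ m, T.E.Hol (Prod.fst ⁻¹' U) m →
    (∀ p, p.1 ∈ U → ∀ hp : p.2 ≠ 0, m p = Φ p hp (p.2 ^ d • v p.1)) →
    ∀ p, p.1 ∈ U → ∀ (hp : p.2 ≠ 0) (ξ : TangentSpace 𝓘(ℂ, ℂ) p.1),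
      T.D m p ξ = Φ p hp (p.2 • p.2 ^ d • 𝒱.conn v p.1 ξ)
  /-- `C` corresponds to `R_F k`, defined by `R_F k(ħ^i v, conj (ħ^j w)) = ħ^i ħ̄^j k(v, w̄)`,
  where `ħ̄` is the twistor conjugate of `ħ` -/
  map_C : ∀ (y : Y) (z : Circle) (i j : ℤ), ∀ v ∈ 𝒱.F i y, ∀ w ∈ 𝒱.F j y,
    T.C y z (Φ (y, (z : ℂ)) z.coe_ne_zero ((z : ℂ) ^ i • v))
        (Φ (y, antipode z) (antipode_circle_ne_zero z) ((antipode z) ^ j • w)) =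
      (z : ℂ) ^ i * conj (antipode z) ^ j * 𝒱.k y v w

/-- The isomorphism is compatible with the natural action
`ħ²∂_ħ (ħ^d v) = d ħ^{d+1} v` on the Rees module and the given one on `H'`. -/
def AnalytizationIso.IsCompatible {𝒱 : FilteredFlatBundle.{u} Y} {T : SmoothTriple.{u} Y}
    (φ : AnalytizationIso 𝒱 T) (S : IntegrableStructure T) : Prop :=
  ∀ (d : ℤ) (U : Set Y), IsOpen U → ∀ v, 𝒱.V.Hol U v → (∀ y ∈ U, v y ∈ 𝒱.F d y) →
    ∀ m, T.E.Hol (Prod.fst ⁻¹' U) m →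
    (∀ p, p.1 ∈ U → ∀ hp : p.2 ≠ 0, m p = φ.Φ p hp (p.2 ^ d • v p.1)) →
    ∀ p, p.1 ∈ U → ∀ hp : p.2 ≠ 0, S.δ m p = φ.Φ p hp (((d : ℂ) * p.2 ^ (d + 1)) • v p.1)

end

set_option linter.unusedSectionVars false

/-! Over ħ ≠ 0 an integrable structure is a connection in the ħ-direction. When its monodromy is
trivial, parallel transport identifies H' over ħ ≠ 0 with the pull-back of V, the restriction of H'
to ħ = 1 (`TrivialMonodromy.transport`, `isHorizontal_ext`). The commutation rule makes ħ⁻¹(ħξ)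
preserve horizontal sections, so ħξ becomes ħ∇_ξ for a connection ∇ on V (`isHorizontal_D_ext`,
`D_ext`). The derivative formula for C makes it constant along 𝕊 on horizontal sections, which gives
k (`C_flow`). The behaviour at ħ = 0 is recorded by F_d = {v : ħ^d v extends across ħ = 0} (`filt`).

The heart of the matter is that H' is locally generated by sections ħ^d u with u in V. Stability
under ħ∂_ħ makes ħ = 0 a regular singularity, so frames of H' and horizontal frames have
coefficients of moderate growth in terms of each other (`exists_extension_of_regularSingular`). Up
to a remainder visibly in H', a section of a frame is thus a finite Laurent sum Σ ħ^n x_n with x_n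
in V. Since ħ∂_ħ preserves H' and multiplies the n-th term by n, every term lies in H' separately
(`extends_of_sum`). Generators that are independent at ħ = 0 give a frame ħ^{d_j} u_j of H' over U ×
ℂ with (u_j) a frame of V (`exists_adaptedFrame`), and F_d is spanned by the u_j with d_j ≤ d
(`filt_eq_span`). Hence F_• is a filtration by subbundles whose Rees module is H'
(`isReesSection_iff`). Transversality holds because ħξ preserves H', and finiteness because Y is
connected.

Conversely, on a Rees module ħ²∂_ħ differentiates V-valued functions of ħ. In a local expansion Σ
f_i ħ^{d_i} v_i the axioms and the divisibility by ħ become formulas in the coefficients (`natδ_eq`,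
`natStructure`), and horizontal sections are locally constant in V, so there is no monodromy. The
last two properties are proved for every compatible structure, which yields the refined equivalence.

The analytic input is the solution of linear equations in ħ, holomorphic in y as well
(`exists_fundamental_solution`), and the removal of singularities with parameters
(`exists_extension`). Both rest on Cauchy's formula, read as a bounded bilinear pairing of analytic
maps into Banach spaces. Parallel transport is globalized by lifting paths to the étale space of
horizontal germs, a covering of ℂ ∖ {0} (`isCoveringMap_base`). -/

noncomputable section

/-! ### Holomorphic functions of two variables -/

section TwoVariables

open Metric Set

variable {E : Type*} [NormedAddCommGroup E] [NormedSpace ℂ E]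

/-- A point of the circle `sphere c R`, parametrized by the angle. -/
def circlePt (c : ℂ) {R : ℝ} (hR : 0 ≤ R) (θ : ℝ) : sphere c R :=
  ⟨circleMap c R θ, circleMap_mem_sphere c hR θ⟩

theorem continuous_circlePt (c : ℂ) {R : ℝ} (hR : 0 ≤ R) : Continuous (circlePt c hR) :=
  (continuous_circleMap c R).subtype_mk _

/-- The bilinear pairing `(k, h) ↦ (2πi)⁻¹ ∮ k h` on continuous functions on a circle. -/
def circlePairing (E : Type*) [NormedAddCommGroup E] [NormedSpace ℂ E] (c : ℂ) {R : ℝ}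
    (hR : 0 ≤ R) : C(sphere c R, ℂ) →L[ℂ] C(sphere c R, E) →L[ℂ] E :=
  LinearMap.mkContinuous₂
    (LinearMap.mk₂ ℂ
      (fun k h => (2 * Real.pi * I : ℂ)⁻¹ • ∫ θ in (0 : ℝ)..2 * Real.pi,
        deriv (circleMap c R) θ • k (circlePt c hR θ) • h (circlePt c hR θ))
      (by
        intro k k' h
        have := continuous_circlePt c hR
        rw [← smul_add, ← intervalIntegral.integral_add]
        · congr 2; ext θ; simp [add_smul]
        · apply Continuous.intervalIntegrable; simp only [deriv_circleMap]; fun_prop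
        · apply Continuous.intervalIntegrable; simp only [deriv_circleMap]; fun_prop)
      (by
        intro a k h
        rw [smul_comm a, ← intervalIntegral.integral_smul a]
        refine congrArg _ (intervalIntegral.integral_congr fun θ _ => ?_)
        simp [mul_smul, smul_comm a])
      (by
        intro k h h'
        have := continuous_circlePt c hR
        rw [← smul_add, ← intervalIntegral.integral_add]
        · congr 2; ext θ; simp [smul_add]
        · apply Continuous.intervalIntegrable; simp only [deriv_circleMap]; fun_prop
        · apply Continuous.intervalIntegrable; simp only [deriv_circleMap]; fun_prop)
      (by
        intro a k h
        rw [smul_comm a, ← intervalIntegral.integral_smul a]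
        refine congrArg _ (intervalIntegral.integral_congr fun θ _ => ?_)
        simp [smul_comm a]))
    (‖(2 * Real.pi * I : ℂ)⁻¹‖ * (R * |2 * Real.pi - 0|))
    (by
      intro k h
      simp only [LinearMap.mk₂_apply, norm_smul]
      refine (mul_le_mul_of_nonneg_left (c := R * (‖k‖ * ‖h‖) * |2 * Real.pi - 0|) ?_
        (norm_nonneg _)).trans (le_of_eq (by ring))
      refine intervalIntegral.norm_integral_le_of_norm_le_const (C := R * (‖k‖ * ‖h‖)) ?_
      intro θ _
      rw [norm_smul, norm_smul]
      have h1 := k.norm_coe_le_norm (circlePt c hR θ)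
      have h2 := h.norm_coe_le_norm (circlePt c hR θ)
      have h3 : ‖deriv (circleMap c R) θ‖ = R := by simp [deriv_circleMap, abs_of_nonneg hR]
      rw [h3]
      gcongr)

theorem circlePairing_apply (c : ℂ) {R : ℝ} (hR : 0 ≤ R) (k : C(sphere c R, ℂ))
    (h : C(sphere c R, E)) : circlePairing E c hR k h =
      (2 * Real.pi * I : ℂ)⁻¹ • ∫ θ in (0 : ℝ)..2 * Real.pi,
        deriv (circleMap c R) θ • k (circlePt c hR θ) • h (circlePt c hR θ) := rfl

/-- The Cauchy kernel `u ↦ (u - w)⁻¹` on a circle. -/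
def cauchyKernel (c : ℂ) (R : ℝ) (w : ℂ) : C(sphere c R, ℂ) :=
  Ring.inverse ((⟨fun u => (u : ℂ), continuous_subtype_val⟩ : C(sphere c R, ℂ)) -
    algebraMap ℂ C(sphere c R, ℂ) w)

theorem isUnit_cauchyKernel_aux {c : ℂ} {R : ℝ} {w : ℂ} (hw : w ∈ ball c R) :
    IsUnit ((⟨fun u => (u : ℂ), continuous_subtype_val⟩ : C(sphere c R, ℂ)) -
    algebraMap ℂ C(sphere c R, ℂ) w) := by
  rw [ContinuousMap.isUnit_iff_forall_ne_zero]
  rintro ⟨u, hu⟩ h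
  have h' : u - w = 0 := by simpa using h
  rw [mem_sphere] at hu
  rw [mem_ball] at hw
  rw [sub_eq_zero.1 h'] at hu
  exact hw.ne hu

theorem cauchyKernel_apply {c : ℂ} {R : ℝ} {w : ℂ} (hw : w ∈ ball c R) (u : sphere c R) :
    cauchyKernel c R w u = ((u : ℂ) - w)⁻¹ := by
  have h := Ring.inverse_mul_cancel _ (isUnit_cauchyKernel_aux hw)
  have h2 := congrArg (fun f : C(sphere c R, ℂ) => f u) h
  have h3 : cauchyKernel c R w u * ((u : ℂ) - w) = 1 := by
    simpa [cauchyKernel] using h2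
  exact eq_inv_of_mul_eq_one_left h3

/-- Inversion in a Banach algebra is analytic at units. This is why the kernel is built with
`Ring.inverse` in `C(sphere c R, ℂ)` and not pointwise. -/
theorem analyticOnNhd_cauchyKernel (c : ℂ) (R : ℝ) :
    AnalyticOnNhd ℂ (cauchyKernel c R) (ball c R) := by
  intro w hw
  obtain ⟨a, ha⟩ := isUnit_cauchyKernel_aux hw
  have h1 : AnalyticAt ℂ (Ring.inverse : C(sphere c R, ℂ) → C(sphere c R, ℂ))
      ((⟨fun u => (u : ℂ), continuous_subtype_val⟩ : C(sphere c R, ℂ)) -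
        algebraMap ℂ C(sphere c R, ℂ) w) := by
    rw [← ha]; exact analyticAt_inverse a
  have h2 : AnalyticAt ℂ (fun w : ℂ => algebraMap ℂ C(sphere c R, ℂ) w) w :=
    (algebraMapCLM ℂ C(sphere c R, ℂ)).analyticAt w
  exact h1.comp_of_eq (analyticAt_const.sub h2) rfl

variable [CompleteSpace E]

theorem circlePairing_cauchyKernel {c : ℂ} {R : ℝ} (hR : 0 < R) {w : ℂ} (hw : w ∈ ball c R)
    {f : ℂ → E} (hf : DiffContOnCl ℂ f (ball c R)) {h : C(sphere c R, E)}
    (hh : ∀ u : sphere c R, h u = f u) :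
    circlePairing E c hR.le (cauchyKernel c R w) h = f w := by
  rw [circlePairing_apply, ← hf.two_pi_i_inv_smul_circleIntegral_sub_inv_smul hw, circleIntegral]
  congr 2
  ext θ
  rw [cauchyKernel_apply hw, hh]
  rfl

/-- A continuous family of functions on a compact space depending pointwise holomorphically on a
parameter is a holomorphic map to the Banach space of continuous functions. -/
theorem analyticAt_continuousMap {S : Type*} [TopologicalSpace S] [CompactSpace S]
    {U : Set ℂ} (hU : IsOpen U) {f : ℂ → S → E}
    (hc : ContinuousOn (fun q : ℂ × S => f q.1 q.2) (U ×ˢ univ))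
    (hd : ∀ s, DifferentiableOn ℂ (fun z => f z s) U) {z₀ : ℂ} (hz₀ : z₀ ∈ U) :
    ∃ g : ℂ → C(S, E), AnalyticAt ℂ g z₀ ∧ ∀ᶠ z in 𝓝 z₀, ∀ s, g z s = f z s := by
  obtain ⟨r, hr, hrU⟩ := nhds_basis_closedBall.mem_iff.1 (hU.mem_nhds hz₀)
  classical
  let F : C(closedBall z₀ r × S, E) := ⟨fun q => f q.1 q.2, by
    have : ContinuousOn (fun q : ℂ × S => f q.1 q.2) (closedBall z₀ r ×ˢ univ) :=
      hc.mono (prod_mono hrU subset_rfl)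
    exact this.comp_continuous (f := fun q : closedBall z₀ r × S => ((q.1 : ℂ), q.2))
      (by fun_prop) (fun q => ⟨q.1.2, mem_univ _⟩)⟩
  let g : ℂ → C(S, E) := fun z => if h : z ∈ closedBall z₀ r then F.curry ⟨z, h⟩ else 0
  have hg : ∀ z ∈ closedBall z₀ r, ∀ s, g z s = f z s := by
    intro z hz s
    simp only [g, dif_pos hz]
    rfl
  have hgc : ContinuousOn g (closedBall z₀ r) := by
    rw [continuousOn_iff_continuous_domRestrict]
    refine F.curry.continuous.congr fun z => ?_
    simp only [domRestrict_apply, g, dif_pos z.2]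
  have hgs : ContinuousOn g (sphere z₀ r) := hgc.mono sphere_subset_closedBall
  let R : NNReal := ⟨r, hr.le⟩
  -- The witness is the Cauchy integral of `g`, which has a power series with values in `C(S, E)` as
  -- soon as `g` is continuous on the circle. Evaluation at `s` passes through the integral, and
  -- Cauchy's formula for each fixed `s` identifies the value.
  have hps := hasFPowerSeriesOn_cauchy_integral (f := g) (c := z₀) (R := R)
    (hgs.circleIntegrable hr.le) hr
  refine ⟨_, hps.analyticAt, ?_⟩
  filter_upwards [ball_mem_nhds z₀ hr] with z hz s
  have hd' : DiffContOnCl ℂ (fun z => f z s) (ball z₀ r) := by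
    apply DifferentiableOn.diffContOnCl
    rw [closure_ball _ hr.ne']
    exact (hd s).mono hrU
  rw [← hd'.two_pi_i_inv_smul_circleIntegral_sub_inv_smul hz]
  have hci : CircleIntegrable (fun u => (u - z)⁻¹ • g u) z₀ r := by
    apply ContinuousOn.circleIntegrable hr.le
    refine ContinuousOn.smul (ContinuousOn.inv₀ (f := fun u : ℂ => u - z) (by fun_prop) ?_) hgs
    intro u hu h
    rw [mem_sphere] at hu
    rw [sub_eq_zero.1 h] at hu
    exact (mem_ball.1 hz).ne hu
  have hev := (ContinuousMap.evalCLM ℂ s : C(S, E) →L[ℂ] E).intervalIntegral_comp_comm hci.out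
  simp only [circleIntegral]
  rw [ContinuousMap.smul_apply]
  congr 1
  refine hev.symm.trans ?_
  refine intervalIntegral.integral_congr fun θ _ => ?_
  simp only [map_smul, ContinuousMap.evalCLM_apply]
  rw [hg _ (sphere_subset_closedBall (circleMap_mem_sphere z₀ hr.le θ))]

/-- A function which is holomorphic in `w`, and on a circle in the `w`-plane continuous, and
holomorphic in `z`, is given inside of the circle by the Cauchy formula. -/
theorem exists_cauchy_representation {U : Set ℂ} (hU : IsOpen U) {w₀ : ℂ} {ρ : ℝ} (hρ : 0 < ρ)
    {f : ℂ → ℂ → E}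
    (hc : ContinuousOn (fun q : ℂ × ℂ => f q.1 q.2) (U ×ˢ sphere w₀ ρ))
    (hd : ∀ w ∈ sphere w₀ ρ, DifferentiableOn ℂ (fun z => f z w) U)
    (hf : ∀ z ∈ U, DiffContOnCl ℂ (f z) (ball w₀ ρ)) {z₀ : ℂ} (hz₀ : z₀ ∈ U) :
    ∃ g : ℂ → C(sphere w₀ ρ, E), AnalyticAt ℂ g z₀ ∧ ∀ᶠ z in 𝓝 z₀, ∀ w ∈ ball w₀ ρ,
      f z w = circlePairing E w₀ hρ.le (cauchyKernel w₀ ρ w) (g z) := by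
  obtain ⟨g, hg, hgf⟩ := analyticAt_continuousMap (S := sphere w₀ ρ) hU
    (f := fun z s => f z s)
    (hc.comp (f := fun q : ℂ × sphere w₀ ρ => (q.1, (q.2 : ℂ))) (by fun_prop)
      (fun q hq => ⟨hq.1, q.2.2⟩)) (fun s => hd s s.2) hz₀
  refine ⟨g, hg, ?_⟩
  filter_upwards [hgf, hU.mem_nhds hz₀] with z hz hzU w hw
  exact (circlePairing_cauchyKernel hρ hw (hf z hzU) hz).symm

/-- The Cauchy integral is a bounded bilinear map applied to the kernel, analytic in `w`, and to the
boundary values, analytic in `z`. No differentiation under the integral sign is needed. Holomorphy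
in `z` is only asked for on the circle, which later allows crossing ħ = 0. -/
theorem analyticAt_of_holomorphic_on_circle {U : Set ℂ} (hU : IsOpen U) {w₀ : ℂ} {ρ : ℝ}
    (hρ : 0 < ρ) {f : ℂ → ℂ → E}
    (hc : ContinuousOn (fun q : ℂ × ℂ => f q.1 q.2) (U ×ˢ sphere w₀ ρ))
    (hd : ∀ w ∈ sphere w₀ ρ, DifferentiableOn ℂ (fun z => f z w) U)
    (hf : ∀ z ∈ U, DiffContOnCl ℂ (f z) (ball w₀ ρ)) {q : ℂ × ℂ} (hq : q ∈ U ×ˢ ball w₀ ρ) :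
    AnalyticAt ℂ (fun q : ℂ × ℂ => f q.1 q.2) q := by
  obtain ⟨g, hg, hgf⟩ := exists_cauchy_representation hU hρ hc hd hf hq.1
  have hk : AnalyticAt ℂ (fun q : ℂ × ℂ => cauchyKernel w₀ ρ q.2) q :=
    (analyticOnNhd_cauchyKernel w₀ ρ q.2 hq.2).comp analyticAt_snd
  have hg' : AnalyticAt ℂ (fun q : ℂ × ℂ => g q.1) q := hg.comp analyticAt_fst
  have hB : AnalyticAt ℂ (fun q : ℂ × ℂ => circlePairing E w₀ hρ.le
      (cauchyKernel w₀ ρ q.2) (g q.1)) q :=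
    ((circlePairing E w₀ hρ.le).analyticAt_bilinear _).comp (hk.prod hg')
  refine hB.congr ?_
  have h1 : ∀ᶠ q' : ℂ × ℂ in 𝓝 q, q'.2 ∈ ball w₀ ρ :=
    continuousAt_snd.eventually (isOpen_ball.mem_nhds hq.2)
  filter_upwards [continuousAt_fst.eventually hgf, h1] with q' h h'
  exact (h _ h').symm

/-- **Osgood's lemma**: continuous separately holomorphic functions are analytic. -/
theorem analyticAt_of_separately_holomorphic {U V : Set ℂ} (hU : IsOpen U) (hV : IsOpen V)
    {f : ℂ → ℂ → E} (hc : ContinuousOn (fun q : ℂ × ℂ => f q.1 q.2) (U ×ˢ V))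
    (hd : ∀ w ∈ V, DifferentiableOn ℂ (fun z => f z w) U)
    (hf : ∀ z ∈ U, DifferentiableOn ℂ (f z) V) {q : ℂ × ℂ} (hq : q ∈ U ×ˢ V) :
    AnalyticAt ℂ (fun q : ℂ × ℂ => f q.1 q.2) q := by
  obtain ⟨ρ, hρ, hρV⟩ := nhds_basis_closedBall.mem_iff.1 (hV.mem_nhds hq.2)
  have hs : sphere q.2 ρ ⊆ V := sphere_subset_closedBall.trans hρV
  refine analyticAt_of_holomorphic_on_circle hU hρ (hc.mono (prod_mono subset_rfl hs))
    (fun w hw => hd w (hs hw)) (fun z hz => ?_) ⟨hq.1, mem_ball_self hρ⟩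
  apply DifferentiableOn.diffContOnCl
  rw [closure_ball _ hρ.ne']
  exact (hf z hz).mono hρV

end TwoVariables
end

/-! ### Primitives and linear differential equations with holomorphic parameters. -/

noncomputable section

section TwoVariables

open Metric Set

variable {E : Type*} [NormedAddCommGroup E] [NormedSpace ℂ E] [CompleteSpace E]

theorem eqOn_ball_of_hasDerivAt_eq {c : ℂ} {R : ℝ} {f g f' : ℂ → E}
    (hf : ∀ w ∈ ball c R, HasDerivAt f (f' w) w) (hg : ∀ w ∈ ball c R, HasDerivAt g (f' w) w)
    (h0 : f c = g c) : ∀ w ∈ ball c R, f w = g w := by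
  intro w hw
  have hc : c ∈ ball c R := mem_ball_self ((dist_nonneg).trans_lt (mem_ball.1 hw))
  have hd : DifferentiableOn ℂ (fun w => f w - g w) (ball c R) := fun w hw =>
    ((hf w hw).sub (hg w hw)).differentiableAt.differentiableWithinAt
  have := isOpen_ball.is_const_of_deriv_eq_zero (isPreconnected_ball (x := c) (r := R)) hd
    (fun w hw => (((hf w hw).sub (hg w hw)).deriv :).trans (sub_self _)) hw hc
  rw [h0, sub_self] at this
  exact sub_eq_zero.1 this

/-- Primitives depend holomorphically on parameters. -/
theorem analyticAt_primitive {U : Set ℂ} (hU : IsOpen U) {w₀ : ℂ} {ρ : ℝ} {G H : ℂ → ℂ → E}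
    (hG : AnalyticOnNhd ℂ (fun q : ℂ × ℂ => G q.1 q.2) (U ×ˢ ball w₀ ρ))
    (hH : ∀ z ∈ U, ∀ w ∈ ball w₀ ρ, HasDerivAt (H z) (G z w) w) (h0 : ∀ z ∈ U, H z w₀ = 0) :
    AnalyticOnNhd ℂ (fun q : ℂ × ℂ => H q.1 q.2) (U ×ˢ ball w₀ ρ) := by
  intro q hq
  obtain ⟨ρ', hρ', hρ'ρ⟩ := exists_between (mem_ball.1 hq.2)
  have hρ'0 : 0 < ρ' := dist_nonneg.trans_lt hρ'
  have hsub : closedBall w₀ ρ' ⊆ ball w₀ ρ := closedBall_subset_ball hρ'ρ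
  have hz : ∀ z ∈ U, ∀ w ∈ ball w₀ ρ, DifferentiableAt ℂ (G z) w := fun z hz w hw =>
    ((hG (z, w) ⟨hz, hw⟩).differentiableAt.comp w (f := fun w => (z, w)) (by fun_prop) :)
  have hw : ∀ w ∈ ball w₀ ρ, ∀ z ∈ U, DifferentiableAt ℂ (fun z => G z w) z := fun w hw z hz =>
    ((hG (z, w) ⟨hz, hw⟩).differentiableAt.comp z (f := fun z => (z, w)) (by fun_prop) :)
  obtain ⟨g, hg, hgG⟩ := exists_cauchy_representation hU hρ'0
    (hG.continuousOn.mono (prod_mono subset_rfl (sphere_subset_closedBall.trans hsub)))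
    (fun w hw' z hz' => (hw w (hsub (sphere_subset_closedBall hw')) z hz').differentiableWithinAt)
    (fun z hz' => by
      apply DifferentiableOn.diffContOnCl
      rw [closure_ball _ hρ'0.ne']
      exact fun w hw' => (hz z hz' w (hsub hw')).differentiableWithinAt) hq.1
  -- Integrating in `w` only affects the kernel: pairing a primitive `κ` of it with the boundary
  -- values gives a jointly analytic primitive of `G`. It must be `H`, since both vanish at `w₀`.
  obtain ⟨κ, hκ0, hκ⟩ := (DifferentiableOn.isExactOn_ball
    (analyticOnNhd_cauchyKernel w₀ ρ').differentiableOn).with_val_at w₀ 0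
  have hκa : AnalyticAt ℂ κ q.2 := by
    have : DifferentiableOn ℂ κ (ball w₀ ρ') := fun w hw =>
      (hκ w hw).differentiableAt.differentiableWithinAt
    exact this.analyticAt (isOpen_ball.mem_nhds hρ')
  have hB : AnalyticAt ℂ (fun q : ℂ × ℂ => circlePairing E w₀ hρ'0.le (κ q.2) (g q.1)) q :=
    ((circlePairing E w₀ hρ'0.le).analyticAt_bilinear _).comp
      ((hκa.comp analyticAt_snd).prod (hg.comp analyticAt_fst))
  refine hB.congr ?_
  have h1 : ∀ᶠ q' : ℂ × ℂ in 𝓝 q, q'.2 ∈ ball w₀ ρ' :=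
    continuousAt_snd.eventually (isOpen_ball.mem_nhds hρ')
  have h2 : ∀ᶠ q' : ℂ × ℂ in 𝓝 q, q'.1 ∈ U :=
    continuousAt_fst.eventually (hU.mem_nhds hq.1)
  filter_upwards [continuousAt_fst.eventually hgG, h1, h2] with q' h h1' h2'
  refine eqOn_ball_of_hasDerivAt_eq (f := fun w => circlePairing E w₀ hρ'0.le (κ w) (g q'.1))
    (f' := G q'.1) (fun w hw' => ?_)
    (fun w hw' => hH _ h2' w (hsub (ball_subset_closedBall hw'))) ?_ _ h1'
  · rw [h w hw']
    exact (((circlePairing E w₀ hρ'0.le).flip (g q'.1)).hasFDerivAt.comp_hasDerivAt w (hκ w hw') :)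
  · simp [hκ0, h0 _ h2']

/-- The primitive in the second variable vanishing at `w₀`. -/
theorem exists_primitive {U : Set ℂ} (hU : IsOpen U) {w₀ : ℂ} {ρ : ℝ} {G : ℂ → ℂ → E}
    (hG : AnalyticOnNhd ℂ (fun q : ℂ × ℂ => G q.1 q.2) (U ×ˢ ball w₀ ρ)) :
    ∃ H : ℂ → ℂ → E, AnalyticOnNhd ℂ (fun q : ℂ × ℂ => H q.1 q.2) (U ×ˢ ball w₀ ρ) ∧
      (∀ z ∈ U, ∀ w ∈ ball w₀ ρ, HasDerivAt (H z) (G z w) w) ∧ ∀ z ∈ U, H z w₀ = 0 := by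
  have : ∀ z, ∃ h : ℂ → E, z ∈ U → h w₀ = 0 ∧ ∀ w ∈ ball w₀ ρ, HasDerivAt h (G z w) w := by
    intro z
    by_cases hz : z ∈ U
    · have hd : DifferentiableOn ℂ (G z) (ball w₀ ρ) := fun w hw =>
        ((hG (z, w) ⟨hz, hw⟩).differentiableAt.comp w (f := fun w => (z, w))
          (by fun_prop) :).differentiableWithinAt
      obtain ⟨h, h1, h2⟩ := hd.isExactOn_ball.with_val_at w₀ 0
      exact ⟨h, fun _ => ⟨h1, h2⟩⟩
    · exact ⟨0, fun h => (hz h).elim⟩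
  choose H hH using this
  exact ⟨H, analyticAt_primitive hU hG (fun z hz => (hH z hz).2) (fun z hz => (hH z hz).1),
    fun z hz => (hH z hz).2, fun z hz => (hH z hz).1⟩

/-- Local solutions of a linear differential equation depending holomorphically on a
parameter. -/
theorem exists_fundamental_solution_of_bound {𝓐 : Type*} [NormedRing 𝓐] [NormedAlgebra ℂ 𝓐]
    [CompleteSpace 𝓐] (h1𝓐 : ‖(1 : 𝓐)‖ ≤ 1) {U : Set ℂ} (hU : IsOpen U) {w₀ : ℂ} {ρ M : ℝ}
    (hρ : 0 < ρ) (hM : M * ρ ≤ 1 / 4) {A : ℂ → ℂ → 𝓐}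
    (hA : AnalyticOnNhd ℂ (fun q : ℂ × ℂ => A q.1 q.2) (U ×ˢ ball w₀ ρ))
    (hAM : ∀ z ∈ U, ∀ w ∈ ball w₀ ρ, ‖A z w‖ ≤ M) :
    ∃ X : ℂ → ℂ → 𝓐, AnalyticOnNhd ℂ (fun q : ℂ × ℂ => X q.1 q.2) (U ×ˢ ball w₀ ρ) ∧
      (∀ z ∈ U, ∀ w ∈ ball w₀ ρ, HasDerivAt (X z) (A z w * X z w) w) ∧
      ∀ z ∈ U, ∀ w ∈ ball w₀ ρ, IsUnit (X z w) := by
  let P := {X : ℂ → ℂ → 𝓐 // AnalyticOnNhd ℂ (fun q : ℂ × ℂ => X q.1 q.2) (U ×ˢ ball w₀ ρ)}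
  have step : ∀ X : P, ∃ Y : P, (∀ z ∈ U, ∀ w ∈ ball w₀ ρ,
      HasDerivAt (Y.1 z) (A z w * X.1 z w) w) ∧ ∀ z ∈ U, Y.1 z w₀ = 0 := by
    intro X
    obtain ⟨H, h1, h2, h3⟩ := exists_primitive hU (G := fun z w => A z w * X.1 z w) (hA.mul X.2)
    exact ⟨⟨H, h1⟩, h2, h3⟩
  choose Φ hΦ hΦ0 using step
  -- Picard iteration: the next term is the primitive of `A` times the current one, vanishing at
  -- `w₀`. The solution is the sum of all terms.
  let X : ℕ → P := fun n => Φ^[n] ⟨fun _ _ => 1, analyticOnNhd_const⟩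
  have hX0 : ∀ z w, (X 0).1 z w = 1 := fun z w => rfl
  have hXs : ∀ n, X (n + 1) = Φ (X n) := fun n => Function.iterate_succ_apply' _ _ _
  have hd : ∀ n, ∀ z ∈ U, ∀ w ∈ ball w₀ ρ,
      HasDerivAt ((X (n + 1)).1 z) (A z w * (X n).1 z w) w := by
    intro n z hz w hw
    rw [hXs]; exact hΦ _ z hz w hw
  have hw₀ : w₀ ∈ ball w₀ ρ := mem_ball_self hρ
  have hb : ∀ n, ∀ z ∈ U, ∀ w ∈ ball w₀ ρ, ‖(X n).1 z w‖ ≤ (1 / 4 : ℝ) ^ n := by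
    intro n
    induction n with
    | zero => intro z hz w hw; rw [hX0]; simpa using h1𝓐
    | succ n ih =>
      intro z hz w hw
      have h1 := (convex_ball w₀ ρ).norm_image_sub_le_of_norm_hasDerivWithin_le
        (f := (X (n + 1)).1 z) (f' := fun w => A z w * (X n).1 z w) (C := M * (1 / 4) ^ n)
        (fun w hw => (hd n z hz w hw).hasDerivWithinAt)
        (fun w hw => (norm_mul_le _ _).trans (mul_le_mul (hAM z hz w hw) (ih z hz w hw)
          (norm_nonneg _) ((norm_nonneg _).trans (hAM z hz w hw)))) hw₀ hw
      have h2 : (X (n + 1)).1 z w₀ = 0 := by rw [hXs]; exact hΦ0 _ z hz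
      rw [h2, sub_zero] at h1
      have hM0 : 0 ≤ M := (norm_nonneg _).trans (hAM z hz w hw)
      have h3 : ‖w - w₀‖ ≤ ρ := (mem_ball_iff_norm.1 hw).le
      calc ‖(X (n + 1)).1 z w‖ ≤ M * (1 / 4) ^ n * ‖w - w₀‖ := h1
        _ ≤ M * (1 / 4) ^ n * ρ := by gcongr
        _ = (M * ρ) * (1 / 4) ^ n := by ring
        _ ≤ 1 / 4 * (1 / 4) ^ n := by gcongr
        _ = (1 / 4) ^ (n + 1) := by ring
  have hsum : Summable fun n : ℕ => (1 / 4 : ℝ) ^ n :=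
    summable_geometric_of_lt_one (by norm_num) (by norm_num)
  have hdw : ∀ n, ∀ z ∈ U, DifferentiableOn ℂ ((X n).1 z) (ball w₀ ρ) := fun n z hz w hw =>
    (((X n).2 (z, w) ⟨hz, hw⟩).differentiableAt.comp w (f := fun w => (z, w))
      (by fun_prop) :).differentiableWithinAt
  have hdz : ∀ n, ∀ w ∈ ball w₀ ρ, DifferentiableOn ℂ (fun z => (X n).1 z w) U := fun n w hw z hz =>
    (((X n).2 (z, w) ⟨hz, hw⟩).differentiableAt.comp z (f := fun z => (z, w))
      (by fun_prop) :).differentiableWithinAt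
  have hTw : ∀ z ∈ U, DifferentiableOn ℂ (fun w => ∑' n, (X n).1 z w) (ball w₀ ρ) := fun z hz =>
    differentiableOn_tsum_of_summable_norm hsum (fun n => hdw n z hz) isOpen_ball
      (fun n w hw => hb n z hz w hw)
  refine ⟨fun z w => ∑' n, (X n).1 z w, ?_, ?_, ?_⟩
  · intro q hq
    refine analyticAt_of_separately_holomorphic hU isOpen_ball ?_ ?_ hTw hq
    · exact continuousOn_tsum (fun n => (X n).2.continuousOn) hsum
        (fun n q hq => hb n q.1 hq.1 q.2 hq.2)
    · exact fun w hw => differentiableOn_tsum_of_summable_norm hsum (fun n => hdz n w hw) hU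
        (fun n z hz => hb n z hz w hw)
  · intro z hz w hw
    have h1 := hasSum_deriv_of_summable_norm hsum (fun n => hdw n z hz) isOpen_ball
      (fun n w hw => hb n z hz w hw) hw
    have h2 : HasSum (fun n => A z w * (X n).1 z w) (A z w * ∑' n, (X n).1 z w) :=
      (Summable.of_norm_bounded hsum fun n => hb n z hz w hw).hasSum.mul_left _
    have h3 : HasSum (fun n => deriv ((X (n + 1)).1 z) w) (A z w * ∑' n, (X n).1 z w) := by
      simpa only [(hd _ z hz w hw).deriv] using h2
    have h4 : deriv ((X 0).1 z) w = 0 := by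
      have : (X 0).1 z = fun _ => 1 := funext fun w => hX0 z w
      rw [this, deriv_const]
    have h5 := (hasSum_nat_add_iff' 1).2 h1
    rw [Finset.sum_range_one, h4, sub_zero] at h5
    rw [h3.unique h5]
    exact ((hTw z hz).differentiableAt (isOpen_ball.mem_nhds hw)).hasDerivAt
  · intro z hz w hw
    have hs : Summable fun n => (X n).1 z w :=
      Summable.of_norm_bounded hsum fun n => hb n z hz w hw
    have h1 : ∑' n, (X n).1 z w = 1 + ∑' n, (X (n + 1)).1 z w := by
      rw [hs.tsum_eq_zero_add, hX0]
    -- The bound `M * ρ ≤ 1 / 4` makes the terms after the first add up to at most 1/3 in norm, so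
    -- the solution is 1 plus an element of norm less than 1. Invertibility thus holds on the whole
    -- ball.
    have hsum' : HasSum (fun n : ℕ => (1 / 4 : ℝ) ^ (n + 1)) (1 / 3) := by
      have := (hasSum_geometric_of_lt_one (r := (1 / 4 : ℝ)) (by norm_num) (by norm_num)).mul_left
        (1 / 4)
      have h3 : (1 / 4 : ℝ) * (1 - 1 / 4)⁻¹ = 1 / 3 := by norm_num
      rw [h3] at this
      exact this.congr_fun fun n => pow_succ' _ _
    have h2 : ‖∑' n, (X (n + 1)).1 z w‖ ≤ 1 / 3 :=
      tsum_of_norm_bounded hsum' fun n => hb (n + 1) z hz w hw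
    have h3 : ‖-∑' n, (X (n + 1)).1 z w‖ < 1 := by rw [norm_neg]; linarith
    have h4 := (Units.oneSub _ h3).isUnit
    rw [Units.val_oneSub, sub_neg_eq_add] at h4
    change IsUnit (∑' n, (X n).1 z w)
    rwa [h1]

/-- Local boundedness of `A` and a short enough disc in `w` give the smallness required for the
iteration. The hypothesis is `‖1‖ ≤ 1` and not `‖1‖ = 1` because rank zero is allowed, where the
endomorphism algebra vanishes. -/
theorem exists_fundamental_solution {𝓐 : Type*} [NormedRing 𝓐] [NormedAlgebra ℂ 𝓐]
    [CompleteSpace 𝓐] (h1𝓐 : ‖(1 : 𝓐)‖ ≤ 1) {A : ℂ → ℂ → 𝓐} {z₀ w₀ : ℂ} {N : Set (ℂ × ℂ)}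
    (hN : N ∈ 𝓝 (z₀, w₀)) (hA : AnalyticOnNhd ℂ (fun q : ℂ × ℂ => A q.1 q.2) N) :
    ∃ (U : Set ℂ) (ρ : ℝ) (X : ℂ → ℂ → 𝓐), IsOpen U ∧ z₀ ∈ U ∧ 0 < ρ ∧
      U ×ˢ ball w₀ ρ ⊆ N ∧
      AnalyticOnNhd ℂ (fun q : ℂ × ℂ => X q.1 q.2) (U ×ˢ ball w₀ ρ) ∧
      (∀ z ∈ U, ∀ w ∈ ball w₀ ρ, HasDerivAt (X z) (A z w * X z w) w) ∧
      ∀ z ∈ U, ∀ w ∈ ball w₀ ρ, IsUnit (X z w) := by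
  have hc : ContinuousAt (fun q : ℂ × ℂ => A q.1 q.2) (z₀, w₀) :=
    (hA _ (mem_of_mem_nhds hN)).continuousAt
  have hb : ∀ᶠ q : ℂ × ℂ in 𝓝 (z₀, w₀), ‖A q.1 q.2‖ < ‖A z₀ w₀‖ + 1 :=
    hc.norm.eventually (gt_mem_nhds (by simp))
  obtain ⟨r, hr, hrN⟩ := nhds_basis_ball.mem_iff.1 (Filter.inter_mem hN hb)
  set M := ‖A z₀ w₀‖ + 1 with hM
  have hM0 : 0 < M := by positivity
  let ρ := min r (1 / (4 * M))
  have hρ : 0 < ρ := lt_min hr (by positivity)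
  have hsub : ball z₀ r ×ˢ ball w₀ ρ ⊆ N ∩ {q : ℂ × ℂ | ‖A q.1 q.2‖ < M} := by
    refine Subset.trans ?_ hrN
    rw [← ball_prod_same]
    exact prod_mono subset_rfl (ball_subset_ball (min_le_left _ _))
  obtain ⟨X, h1, h2, h3⟩ := exists_fundamental_solution_of_bound h1𝓐 (U := ball z₀ r) isOpen_ball
    (w₀ := w₀) (M := M) hρ (by
      calc M * ρ ≤ M * (1 / (4 * M)) := by gcongr; exact min_le_right _ _
        _ = 1 / 4 := by field_simp) (A := A) (fun q hq => hA q (hsub hq).1)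
    (fun z hz w hw => (hsub (show (z, w) ∈ _ from ⟨hz, hw⟩)).2.le)
  exact ⟨ball z₀ r, ρ, X, isOpen_ball, mem_ball_self hr, hρ, fun q hq => (hsub hq).1, h1, h2, h3⟩

end TwoVariables
end

noncomputable section

/-! ### Holomorphic functions on `Y × ℂ` -/

section HolomorphicFunctions

open Metric Set

variable {Y : Type v} [TopologicalSpace Y] [ChartedSpace ℂ Y]
  {F : Type*} [NormedAddCommGroup F] [NormedSpace ℂ F]

/-- The expression of a function on `Y × ℂ` in the chart of `Y` at `y₀`. -/
def inChart (y₀ : Y) (f : Y × ℂ → F) (q : ℂ × ℂ) : F := f ((chartAt ℂ y₀).symm q.1, q.2)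

theorem contMDiffAt_prod_iff_analyticAt [CompleteSpace F] {g : ℂ × ℂ → F} {q : ℂ × ℂ} :
    ContMDiffAt modelYΩ 𝓘(ℂ, F) ω g q ↔ AnalyticAt ℂ g q := by
  have : ContMDiffAt 𝓘(ℂ, ℂ × ℂ) 𝓘(ℂ, F) ω g q ↔ AnalyticAt ℂ g q := by
    rw [contMDiffAt_iff_contDiffAt, ← contDiffWithinAt_univ,
      contDiffWithinAt_omega_iff_analyticWithinAt, analyticWithinAt_univ]
  rwa [modelWithCornersSelf_prod, ← chartedSpaceSelf_prod] at this

variable [IsManifold 𝓘(ℂ, ℂ) ω Y]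

theorem contMDiffAt_chartAt {y₀ y : Y} (hy : y ∈ (chartAt ℂ y₀).source) :
    ContMDiffAt 𝓘(ℂ, ℂ) 𝓘(ℂ, ℂ) ω (chartAt ℂ y₀) y :=
  contMDiffOn_chart.contMDiffAt ((chartAt ℂ y₀).open_source.mem_nhds hy)

theorem contMDiffAt_chartAt_symm {y₀ : Y} {z : ℂ} (hz : z ∈ (chartAt ℂ y₀).target) :
    ContMDiffAt 𝓘(ℂ, ℂ) 𝓘(ℂ, ℂ) ω (chartAt ℂ y₀).symm z :=
  contMDiffOn_chart_symm.contMDiffAt ((chartAt ℂ y₀).open_target.mem_nhds hz)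

theorem contMDiffAt_iff_analyticAt_inChart [CompleteSpace F] (y₀ : Y) {f : Y × ℂ → F} {p : Y × ℂ}
    (hp : p.1 ∈ (chartAt ℂ y₀).source) :
    ContMDiffAt modelYΩ 𝓘(ℂ, F) ω f p ↔
      AnalyticAt ℂ (inChart y₀ f) (chartAt ℂ y₀ p.1, p.2) := by
  set φ := chartAt ℂ y₀ with hφ
  have hp' : φ p.1 ∈ φ.target := φ.map_source hp
  rw [← contMDiffAt_prod_iff_analyticAt]
  constructor
  · intro hf
    have h1 : ContMDiffAt modelYΩ modelYΩ ω (Prod.map φ.symm id) (φ p.1, p.2) :=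
      (contMDiffAt_chartAt_symm hp').prodMap contMDiffAt_id
    refine ContMDiffAt.comp _ (g := f) ?_ h1
    have e : Prod.map φ.symm id (φ p.1, p.2) = p := Prod.ext (φ.left_inv hp) rfl
    change ContMDiffAt modelYΩ 𝓘(ℂ, F) ω f (Prod.map φ.symm id (φ p.1, p.2))
    rwa [e]
  · intro hf
    have h1 : ContMDiffAt modelYΩ modelYΩ ω (Prod.map φ id) p :=
      (contMDiffAt_chartAt hp).prodMap contMDiffAt_id
    refine (ContMDiffAt.comp p (g := inChart y₀ f) hf h1).congr_of_eventuallyEq ?_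
    have : ∀ᶠ p' : Y × ℂ in 𝓝 p, p'.1 ∈ φ.source :=
      continuousAt_fst.eventually (φ.open_source.mem_nhds hp)
    filter_upwards [this] with p' h'
    simp [inChart, ← hφ, φ.left_inv h']

theorem ContMDiffAt.differentiableAt_slice {f : Y × ℂ → F} {y : Y} {z : ℂ}
    (hf : ContMDiffAt modelYΩ 𝓘(ℂ, F) ω f (y, z)) :
    DifferentiableAt ℂ (fun z => f (y, z)) z := by
  have h1 : ContMDiffAt 𝓘(ℂ, ℂ) modelYΩ ω (fun z : ℂ => (y, z)) z :=
    contMDiffAt_const.prodMk contMDiffAt_id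
  have h2 : ContMDiffAt 𝓘(ℂ, ℂ) 𝓘(ℂ, F) ω (fun z => f (y, z)) z := hf.comp z h1
  exact h2.contDiffAt.differentiableAt (by simp)

theorem ContMDiffAt.slice_left {f : Y × ℂ → F} {y : Y} {z : ℂ}
    (hf : ContMDiffAt modelYΩ 𝓘(ℂ, F) ω f (y, z)) :
    ContMDiffAt 𝓘(ℂ, ℂ) 𝓘(ℂ, F) ω (fun y => f (y, z)) y :=
  hf.comp y (contMDiffAt_id.prodMk contMDiffAt_const)

/-- The derivative `∂_ħ` of a function on `Y × ℂ`. -/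
def dħ (f : Y × ℂ → F) (p : Y × ℂ) : F := deriv (fun z => f (p.1, z)) p.2

theorem analyticAt_deriv_snd [CompleteSpace F] {g : ℂ × ℂ → F} {q : ℂ × ℂ}
    (hg : AnalyticAt ℂ g q) : AnalyticAt ℂ (fun q => deriv (fun z => g (q.1, z)) q.2) q := by
  have h1 : AnalyticAt ℂ (fun q => fderiv ℂ g q ((0, 1) : ℂ × ℂ)) q :=
    ((ContinuousLinearMap.apply ℂ F ((0, 1) : ℂ × ℂ)).analyticAt _).comp hg.fderiv
  refine h1.congr ?_
  filter_upwards [hg.eventually_analyticAt] with q' h'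
  have h2 : HasDerivAt (fun z : ℂ => (q'.1, z)) ((0, 1) : ℂ × ℂ) q'.2 :=
    (hasDerivAt_const _ _).prodMk (hasDerivAt_id _)
  exact (h'.differentiableAt.hasFDerivAt.comp_hasDerivAt q'.2 h2).deriv.symm

theorem contMDiffAt_dħ [CompleteSpace F] {f : Y × ℂ → F} {p : Y × ℂ}
    (hf : ContMDiffAt modelYΩ 𝓘(ℂ, F) ω f p) : ContMDiffAt modelYΩ 𝓘(ℂ, F) ω (dħ f) p := by
  have hp := mem_chart_source ℂ p.1
  rw [contMDiffAt_iff_analyticAt_inChart p.1 hp] at hf ⊢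
  exact analyticAt_deriv_snd hf

theorem contMDiffOn_dħ [CompleteSpace F] {f : Y × ℂ → F} {W : Set (Y × ℂ)} (hW : IsOpen W)
    (hf : ContMDiffOn modelYΩ 𝓘(ℂ, F) ω f W) : ContMDiffOn modelYΩ 𝓘(ℂ, F) ω (dħ f) W :=
  fun _ hp => (contMDiffAt_dħ (hf.contMDiffAt (hW.mem_nhds hp))).contMDiffWithinAt

/-- Chain rule through the chart at `y`. The tangent vector enters only through a factor independent
of `f`, so commuting with ∂_ħ reduces to mixed partial derivatives in ℂ². -/
theorem dY_eq_deriv_chart (y : Y) (f : Y → ℂ) (hf : ContMDiffAt 𝓘(ℂ, ℂ) 𝓘(ℂ, ℂ) ω f y)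
    (ξ : TangentSpace 𝓘(ℂ, ℂ) y) :
    dY f y ξ = deriv (fun z => f ((chartAt ℂ y).symm z)) (chartAt ℂ y y) *
      dY (chartAt ℂ y) y ξ := by
  set φ := chartAt ℂ y with hφ
  have hy : y ∈ φ.source := mem_chart_source ℂ y
  have hg : ContMDiffAt 𝓘(ℂ, ℂ) 𝓘(ℂ, ℂ) ω (fun z => f (φ.symm z)) (φ y) := by
    refine ContMDiffAt.comp (φ y) (g := f) ?_ (contMDiffAt_chartAt_symm (φ.map_source hy))
    rwa [φ.left_inv hy]
  have h1 : f =ᶠ[𝓝 y] (fun z => f (φ.symm z)) ∘ φ := by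
    filter_upwards [φ.open_source.mem_nhds hy] with y' h'
    simp [φ.left_inv h']
  have h2 := mfderiv_comp y (hg.mdifferentiableAt (by simp))
    ((contMDiffAt_chartAt hy).mdifferentiableAt (by simp))
  simp only [dY]
  rw [h1.mfderiv_eq, h2]
  rw [mfderiv_eq_fderiv]
  change fderiv ℂ (fun z => f (φ.symm z)) (φ y) (mfderiv 𝓘(ℂ, ℂ) 𝓘(ℂ, ℂ) φ y ξ) = _
  rw [← toSpanSingleton_deriv]
  exact mul_comm (G := ℂ) _ _

theorem deriv_comm_of_analyticAt {g : ℂ × ℂ → ℂ} {q : ℂ × ℂ} (hg : AnalyticAt ℂ g q) :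
    HasDerivAt (fun w => deriv (fun z => g (z, w)) q.1)
      (deriv (fun z => deriv (fun w => g (z, w)) q.2) q.1) q.2 := by
  have hs : IsSymmSndFDerivAt ℂ g q :=
    (hg.contDiffAt (n := 2)).isSymmSndFDerivAt (by simp)
  have hA := hg.fderiv.differentiableAt
  have e1 : ∀ᶠ q' in 𝓝 q, deriv (fun z => g (z, q'.2)) q'.1 = fderiv ℂ g q' (1, 0) := by
    filter_upwards [hg.eventually_analyticAt] with q' h'
    exact (h'.differentiableAt.hasFDerivAt.comp_hasDerivAt q'.1
      ((hasDerivAt_id q'.1).prodMk (hasDerivAt_const q'.1 q'.2))).deriv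
  have e2 : ∀ᶠ q' in 𝓝 q, deriv (fun w => g (q'.1, w)) q'.2 = fderiv ℂ g q' (0, 1) := by
    filter_upwards [hg.eventually_analyticAt] with q' h'
    exact (h'.differentiableAt.hasFDerivAt.comp_hasDerivAt q'.2
      ((hasDerivAt_const q'.2 q'.1).prodMk (hasDerivAt_id q'.2))).deriv
  have l1 : Filter.Tendsto (fun w : ℂ => (q.1, w)) (𝓝 q.2) (𝓝 q) :=
    (Continuous.prodMk_right q.1).tendsto _
  have l2 : Filter.Tendsto (fun z : ℂ => (z, q.2)) (𝓝 q.1) (𝓝 q) :=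
    (Continuous.prodMk_left q.2).tendsto _
  have d1 : HasDerivAt (fun w => fderiv ℂ g (q.1, w) (1, 0))
      (fderiv ℂ (fderiv ℂ g) q (0, 1) (1, 0)) q.2 :=
    ((ContinuousLinearMap.apply ℂ ℂ ((1, 0) : ℂ × ℂ)).hasFDerivAt.comp_hasDerivAt q.2
      (hA.hasFDerivAt.comp_hasDerivAt q.2
        ((hasDerivAt_const q.2 q.1).prodMk (hasDerivAt_id q.2))) :)
  have d2 : HasDerivAt (fun z => fderiv ℂ g (z, q.2) (0, 1))
      (fderiv ℂ (fderiv ℂ g) q (1, 0) (0, 1)) q.1 :=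
    ((ContinuousLinearMap.apply ℂ ℂ ((0, 1) : ℂ × ℂ)).hasFDerivAt.comp_hasDerivAt q.1
      (hA.hasFDerivAt.comp_hasDerivAt q.1
        ((hasDerivAt_id q.1).prodMk (hasDerivAt_const q.1 q.2))) :)
  have e2' : (fun z => deriv (fun w => g (z, w)) q.2) =ᶠ[𝓝 q.1]
      fun z => fderiv ℂ g (z, q.2) (0, 1) := l2.eventually e2
  have e1' : (fun w => deriv (fun z => g (z, w)) q.1) =ᶠ[𝓝 q.2]
      fun w => fderiv ℂ g (q.1, w) (1, 0) := l1.eventually e1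
  rw [e2'.deriv_eq, d2.deriv, hs.eq (1, 0) (0, 1)]
  exact d1.congr_of_eventuallyEq e1'

/-- The derivatives along `Y` and along `ħ` commute. -/
theorem hasDerivAt_dY {f : Y × ℂ → ℂ} {y : Y} {z : ℂ}
    (hf : ContMDiffAt modelYΩ 𝓘(ℂ, ℂ) ω f (y, z)) (ξ : TangentSpace 𝓘(ℂ, ℂ) y) :
    HasDerivAt (fun z => dY (fun y => f (y, z)) y ξ) (dY (fun y => dħ f (y, z)) y ξ) z := by
  have hy := mem_chart_source ℂ y
  have hg := (contMDiffAt_iff_analyticAt_inChart y (p := (y, z)) hy).1 hf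
  have h1 : ∀ᶠ w in 𝓝 z, dY (fun y => f (y, w)) y ξ =
      deriv (fun x => inChart y f (x, w)) (chartAt ℂ y y) * dY (chartAt ℂ y) y ξ := by
    have l1 : Filter.Tendsto (fun w : ℂ => (chartAt ℂ y y, w)) (𝓝 z) (𝓝 (chartAt ℂ y y, z)) :=
      (Continuous.prodMk_right _).tendsto _
    filter_upwards [l1.eventually hg.eventually_analyticAt] with w hw
    have := (contMDiffAt_iff_analyticAt_inChart y (p := (y, w)) hy).2 hw
    exact dY_eq_deriv_chart y _ this.slice_left ξ
  have h2 := dY_eq_deriv_chart y (fun y => dħ f (y, z)) (contMDiffAt_dħ hf).slice_left ξ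
  rw [h2]
  exact ((deriv_comm_of_analyticAt hg).mul_const _).congr_of_eventuallyEq h1

/-- Extension of holomorphic functions across `ħ = 0`. -/
theorem exists_extension [CompleteSpace F] {U : Set Y} (hU : IsOpen U) {ρ : ℝ} {f : Y × ℂ → F}
    (hf : ContMDiffOn modelYΩ 𝓘(ℂ, F) ω f (U ×ˢ (ball 0 ρ \ {0})))
    (hb : ∀ y ∈ U, ∃ C, ∀ᶠ z in 𝓝[≠] (0 : ℂ), ‖f (y, z)‖ ≤ C) :
    ∃ g : Y × ℂ → F, ContMDiffOn modelYΩ 𝓘(ℂ, F) ω g (U ×ˢ ball 0 ρ) ∧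
      ∀ p, p.2 ≠ 0 → g p = f p := by
  classical
  -- Each slice is filled in by its own limit at 0, by Riemann's theorem. The bound in `hb` may
  -- depend on `y`.
  let g : Y × ℂ → F := fun p =>
    Function.update (fun z => f (p.1, z)) 0 ((𝓝[≠] (0 : ℂ)).limUnder fun z => f (p.1, z)) p.2
  have hg : ∀ p, p.2 ≠ 0 → g p = f p := fun p hp => by simp [g, Function.update_of_ne hp]
  have hWo : IsOpen (U ×ˢ (ball (0 : ℂ) ρ \ {0})) :=
    hU.prod (isOpen_ball.sdiff isClosed_singleton)
  have hgd : ∀ y ∈ U, DifferentiableOn ℂ (fun z => g (y, z)) (ball 0 ρ) := by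
    intro y hy z hz
    have hfd : ∀ z ∈ ball (0 : ℂ) ρ, z ≠ 0 → DifferentiableAt ℂ (fun z => f (y, z)) z :=
      fun z hz hz0 => (hf.contMDiffAt (hWo.mem_nhds (x := (y, z))
        ⟨hy, hz, hz0⟩)).differentiableAt_slice
    by_cases hz0 : z = 0
    · subst hz0
      obtain ⟨C, hC⟩ := hb y hy
      have hs : {z : ℂ | z ∈ ball (0 : ℂ) ρ ∧ (z ≠ 0 → ‖f (y, z)‖ ≤ C)} ∈ 𝓝 (0 : ℂ) :=
        Filter.inter_mem (isOpen_ball.mem_nhds hz) (eventually_nhdsWithin_iff.1 hC)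
      have := differentiableOn_update_limUnder_of_bddAbove (f := fun z => f (y, z)) hs
        (fun w hw => (hfd w hw.1.1 hw.2).differentiableWithinAt)
        ⟨C, by rintro _ ⟨w, hw, rfl⟩; exact hw.1.2 hw.2⟩
      exact (this.differentiableAt hs).differentiableWithinAt
    · refine DifferentiableAt.differentiableWithinAt
        ((hfd z hz hz0).congr_of_eventuallyEq ?_)
      filter_upwards [isOpen_ne.mem_nhds hz0] with w hw using hg _ hw
  refine ⟨g, fun p hp => ContMDiffAt.contMDiffWithinAt ?_, hg⟩
  obtain ⟨ρ', hρ', hρ'ρ⟩ := exists_between (mem_ball.1 hp.2)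
  have hρ'0 : 0 < ρ' := dist_nonneg.trans_lt hρ'
  set φ := chartAt ℂ p.1 with hφ
  have hy : p.1 ∈ φ.source := mem_chart_source ℂ p.1
  rw [contMDiffAt_iff_analyticAt_inChart p.1 hy]
  have hU' : IsOpen (φ.target ∩ φ.symm ⁻¹' U) :=
    φ.symm.continuousOn.isOpen_inter_preimage φ.open_target hU
  have hcirc : ∀ z ∈ φ.target ∩ φ.symm ⁻¹' U, ∀ w ∈ sphere (0 : ℂ) ρ',
      AnalyticAt ℂ (inChart p.1 g) (z, w) := by
    intro z hz w hw
    have hw0 : w ≠ 0 := by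
      rintro rfl
      simp at hw
      exact hρ'0.ne hw
    have hwρ : w ∈ ball (0 : ℂ) ρ := sphere_subset_ball hρ'ρ hw
    have h1 : ContMDiffAt modelYΩ 𝓘(ℂ, F) ω g (φ.symm z, w) := by
      refine (hf.contMDiffAt (hWo.mem_nhds (x := (φ.symm z, w))
        ⟨hz.2, hwρ, hw0⟩)).congr_of_eventuallyEq ?_
      have : ∀ᶠ p' : Y × ℂ in 𝓝 (φ.symm z, w), p'.2 ≠ 0 :=
        (continuousAt_snd (p := (φ.symm z, w))).eventually (isOpen_ne.mem_nhds hw0)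
      filter_upwards [this] with p' h' using hg _ h'
    have h2 := (contMDiffAt_iff_analyticAt_inChart p.1 (p := (φ.symm z, w))
      (φ.symm.map_source hz.1)).1 h1
    simpa [← hφ, φ.right_inv hz.1] using h2
  -- Joint holomorphy at ħ = 0 comes from a circle around 0 that encloses the point: there `g`
  -- agrees with `f`, which is known to be jointly holomorphic.
  refine analyticAt_of_holomorphic_on_circle hU' hρ'0 (w₀ := 0)
    (f := fun z w => inChart p.1 g (z, w)) ?_ ?_ ?_
    (q := (φ p.1, p.2)) ⟨⟨φ.map_source hy, by simpa [φ.left_inv hy] using hp.1⟩, hρ'⟩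
  · exact fun q hq => (hcirc q.1 hq.1 q.2 hq.2).continuousAt.continuousWithinAt
  · intro w hw z hz
    exact ((hcirc z hz w hw).differentiableAt.comp z (f := fun z => (z, w))
      (by fun_prop) :).differentiableWithinAt
  · intro z hz
    apply DifferentiableOn.diffContOnCl
    rw [closure_ball _ hρ'0.ne']
    exact (hgd _ hz.2).mono (closedBall_subset_ball hρ'ρ)

theorem exists_fundamental_solution_manifold {𝓐 : Type*} [NormedRing 𝓐] [NormedAlgebra ℂ 𝓐]
    [CompleteSpace 𝓐] (h1𝓐 : ‖(1 : 𝓐)‖ ≤ 1) {A : Y × ℂ → 𝓐} {p₀ : Y × ℂ} {N : Set (Y × ℂ)}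
    (hN : IsOpen N) (hp₀ : p₀ ∈ N) (hA : ContMDiffOn modelYΩ 𝓘(ℂ, 𝓐) ω A N) :
    ∃ (U : Set Y) (ρ : ℝ) (X : Y × ℂ → 𝓐), IsOpen U ∧ p₀.1 ∈ U ∧ 0 < ρ ∧
      U ×ˢ ball p₀.2 ρ ⊆ N ∧ ContMDiffOn modelYΩ 𝓘(ℂ, 𝓐) ω X (U ×ˢ ball p₀.2 ρ) ∧
      (∀ y ∈ U, ∀ w ∈ ball p₀.2 ρ, HasDerivAt (fun w => X (y, w)) (A (y, w) * X (y, w)) w) ∧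
      ∀ y ∈ U, ∀ w ∈ ball p₀.2 ρ, IsUnit (X (y, w)) := by
  set φ := chartAt ℂ p₀.1 with hφ
  have hy : p₀.1 ∈ φ.source := mem_chart_source ℂ p₀.1
  let N' : Set (ℂ × ℂ) := {q | q.1 ∈ φ.target ∧ (φ.symm q.1, q.2) ∈ N}
  have hN' : N' ∈ 𝓝 (φ p₀.1, p₀.2) := by
    have h1 : ContinuousAt (fun q : ℂ × ℂ => (φ.symm q.1, q.2)) (φ p₀.1, p₀.2) := by
      refine ContinuousAt.prodMk (ContinuousAt.comp (f := Prod.fst) ?_ continuousAt_fst)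
        continuousAt_snd
      exact φ.continuousAt_symm (φ.map_source hy)
    refine Filter.inter_mem
      (continuousAt_fst.eventually (φ.open_target.mem_nhds (φ.map_source hy)))
      (h1.eventually (hN.mem_nhds ?_))
    simpa [φ.left_inv hy] using hp₀
  have hA' : AnalyticOnNhd ℂ (fun q : ℂ × ℂ => inChart p₀.1 A (q.1, q.2)) N' := by
    intro q hq
    have h2 := (contMDiffAt_iff_analyticAt_inChart p₀.1 (p := (φ.symm q.1, q.2))
      (φ.symm.map_source hq.1)).1 (hA.contMDiffAt (hN.mem_nhds hq.2))
    simpa [← hφ, φ.right_inv hq.1] using h2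
  obtain ⟨V, ρ, X, hV, hzV, hρ, hVN, hX, hXd, hXu⟩ :=
    exists_fundamental_solution h1𝓐 (A := fun z w => inChart p₀.1 A (z, w)) hN' hA'
  refine ⟨φ.source ∩ φ ⁻¹' V, ρ, fun p => X (φ p.1) p.2,
    φ.continuousOn.isOpen_inter_preimage φ.open_source hV, ⟨hy, hzV⟩, hρ, ?_, ?_, ?_, ?_⟩
  · intro p hp
    have := (hVN (show (φ p.1, p.2) ∈ _ from ⟨hp.1.2, hp.2⟩)).2
    simpa [φ.left_inv hp.1.1] using this
  · intro p hp
    refine ContMDiffAt.contMDiffWithinAt ?_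
    rw [contMDiffAt_iff_analyticAt_inChart p₀.1 hp.1.1]
    refine (hX (φ p.1, p.2) ⟨hp.1.2, hp.2⟩).congr ?_
    have : ∀ᶠ q : ℂ × ℂ in 𝓝 (φ p.1, p.2), q.1 ∈ φ.target :=
      continuousAt_fst.eventually (φ.open_target.mem_nhds (φ.map_source hp.1.1))
    filter_upwards [this] with q hq
    simp [inChart, ← hφ, φ.right_inv hq]
  · intro y hy' w hw
    have := hXd (φ y) hy'.2 w hw
    simpa [inChart, ← hφ, φ.left_inv hy'.1] using this
  · exact fun y hy' w hw => hXu _ hy'.2 w hw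

end HolomorphicFunctions
end

noncomputable section

/-! ### Sections and frames of holomorphic bundles -/

section Frames

open Set Module

variable {EB H : Type*} [NormedAddCommGroup EB] [NormedSpace ℂ EB]
    [TopologicalSpace H] {J : ModelWithCorners ℂ EB H} {B : Type v} [TopologicalSpace B]
    [ChartedSpace H B] {r : ℕ} {E : HolBundle.{u} J B r}

namespace HolBundle

theorem Hol.mono {W W' : Set B} {m : ∀ b, E.fib b} (hm : E.Hol W m) (h : W' ⊆ W) : E.Hol W' m :=
  ContMDiffOn.mono hm h

theorem Hol.congr {W : Set B} {m n : ∀ b, E.fib b} (hm : E.Hol W m) (h : ∀ p ∈ W, n p = m p) :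
    E.Hol W n :=
  ContMDiffOn.congr hm fun p hp => by rw [h p hp]

theorem hol_of_locally {W : Set B} {m : ∀ b, E.fib b}
    (h : ∀ p ∈ W, ∃ N, IsOpen N ∧ p ∈ N ∧ E.Hol N m) : E.Hol W m := fun p hp => by
  obtain ⟨N, hN, hpN, hm⟩ := h p hp
  exact (ContMDiffOn.contMDiffAt hm (hN.mem_nhds hpN)).contMDiffWithinAt

theorem Hol.add {W : Set B} {m n : ∀ b, E.fib b} (hm : E.Hol W m) (hn : E.Hol W n) :
    E.Hol W (fun p => m p + n p) :=
  ContMDiffOn.add_section hm hn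

theorem Hol.sub {W : Set B} {m n : ∀ b, E.fib b} (hm : E.Hol W m) (hn : E.Hol W n) :
    E.Hol W (fun p => m p - n p) :=
  ContMDiffOn.sub_section hm hn

theorem Hol.smul {W : Set B} {f : B → ℂ} {m : ∀ b, E.fib b}
    (hf : ContMDiffOn J 𝓘(ℂ, ℂ) ω f W) (hm : E.Hol W m) : E.Hol W (fun p => f p • m p) :=
  ContMDiffOn.smul_section hf hm

theorem Hol.const_smul {W : Set B} (a : ℂ) {m : ∀ b, E.fib b} (hm : E.Hol W m) :
    E.Hol W (fun p => a • m p) :=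
  Hol.smul contMDiffOn_const hm

theorem hol_zero (W : Set B) : E.Hol W (fun _ => 0) :=
  contMDiffOn_zeroSection ℂ E.fib

theorem Hol.sum {ι : Type*} {s : Finset ι} {W : Set B} {m : ι → ∀ b, E.fib b}
    (hm : ∀ i ∈ s, E.Hol W (m i)) : E.Hol W (fun p => ∑ i ∈ s, m i p) :=
  ContMDiffOn.sum_section hm

instance (p : B) : FiniteDimensional ℂ (E.fib p) :=
  ((trivializationAt (Fin r → ℂ) E.fib p).linearEquivAt ℂ p
    (FiberBundle.mem_baseSet_trivializationAt' p)).symm.finiteDimensional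

theorem finrank_fib (p : B) : finrank ℂ (E.fib p) = r := by
  rw [((trivializationAt (Fin r → ℂ) E.fib p).linearEquivAt ℂ p
    (FiberBundle.mem_baseSet_trivializationAt' p)).finrank_eq]
  simp

variable (E) in
/-- A frame of the bundle `E` on `N`. -/
abbrev IsFrame (N : Set B) (e : Fin r → ∀ b, E.fib b) : Prop :=
  IsLocalFrameOn J (Fin r → ℂ) ω e N

theorem isFrame_of_linearIndependent {N : Set B} {e : Fin r → ∀ b, E.fib b}
    (he : ∀ j, E.Hol N (e j)) (hi : ∀ p ∈ N, LinearIndependent ℂ fun j => e j p) :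
    E.IsFrame N e where
  linearIndependent hx := hi _ hx
  generating hx := ((hi _ hx).span_eq_top_of_card_eq_finrank' (by
    rw [finrank_fib]; simp)).ge
  contMDiffOn := he

variable (E) in
/-- The coordinate of a vector in the trivialization at `p₀`. -/
def coord (p₀ : B) (m : ∀ b, E.fib b) (p : B) : Fin r → ℂ :=
  (trivializationAt (Fin r → ℂ) E.fib p₀ ⟨p, m p⟩).2

variable (E) in
/-- The domain of the trivialization at `p₀`. -/
abbrev base (p₀ : B) : Set B := (trivializationAt (Fin r → ℂ) E.fib p₀).baseSet

theorem coord_eq (p₀ : B) {p : B} (hp : p ∈ E.base p₀) (m : ∀ b, E.fib b) :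
    E.coord p₀ m p = (trivializationAt (Fin r → ℂ) E.fib p₀).linearEquivAt ℂ p hp (m p) := rfl

theorem hol_iff_coord (p₀ : B) {W : Set B} (hW : IsOpen W) (hWb : W ⊆ E.base p₀)
    {m : ∀ b, E.fib b} :
    E.Hol W m ↔ ContMDiffOn J 𝓘(ℂ, Fin r → ℂ) ω (E.coord p₀ m) W :=
  Trivialization.contMDiffOn_section_iff (IB := J) (n := ω)
    (e := trivializationAt (Fin r → ℂ) E.fib p₀) hW hWb

variable (E) in
/-- The endomorphism of `ℂ^r` sending the standard basis to the coordinates of a frame. -/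
def frameMap (p₀ : B) (e : Fin r → ∀ b, E.fib b) (p : B) : (Fin r → ℂ) →L[ℂ] (Fin r → ℂ) :=
  ∑ j, (ContinuousLinearMap.smulRightL ℂ (Fin r → ℂ) (Fin r → ℂ)
    (ContinuousLinearMap.proj j)) (E.coord p₀ (e j) p)

theorem frameMap_apply (p₀ : B) (e : Fin r → ∀ b, E.fib b) {p : B} (hp : p ∈ E.base p₀)
    (c : Fin r → ℂ) : E.frameMap p₀ e p c =
      (trivializationAt (Fin r → ℂ) E.fib p₀).linearEquivAt ℂ p hp (∑ j, c j • e j p) := by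
  simp [frameMap, coord_eq p₀ hp]

theorem contMDiffOn_frameMap (p₀ : B) {e : Fin r → ∀ b, E.fib b} {W : Set B} (hW : IsOpen W)
    (hWb : W ⊆ E.base p₀) (he : ∀ j, E.Hol W (e j)) :
    ContMDiffOn J 𝓘(ℂ, (Fin r → ℂ) →L[ℂ] (Fin r → ℂ)) ω (E.frameMap p₀ e) W := by
  have : ∀ j ∈ Finset.univ, ContMDiffOn J 𝓘(ℂ, (Fin r → ℂ) →L[ℂ] (Fin r → ℂ)) ω
      (fun p => (ContinuousLinearMap.smulRightL ℂ (Fin r → ℂ) (Fin r → ℂ)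
        (ContinuousLinearMap.proj j)) (E.coord p₀ (e j) p)) W := fun j _ =>
    (ContinuousLinearMap.contMDiff _).comp_contMDiffOn ((hol_iff_coord p₀ hW hWb).1 (he j))
  exact (contMDiffOn_finsetSum this).congr fun p _ => by simp [frameMap]

theorem isUnit_frameMap_iff (p₀ : B) (e : Fin r → ∀ b, E.fib b) {p : B} (hp : p ∈ E.base p₀) :
    IsUnit (E.frameMap p₀ e p) ↔ LinearIndependent ℂ fun j => e j p := by
  rw [Fintype.linearIndependent_iff, ContinuousLinearMap.isUnit_iff_bijective]
  constructor
  · intro h c hc i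
    have : E.frameMap p₀ e p c = E.frameMap p₀ e p 0 := by
      rw [frameMap_apply p₀ e hp, hc, map_zero, map_zero]
    exact congrFun (h.1 this) i
  · intro h
    have hinj : Function.Injective (E.frameMap p₀ e p : (Fin r → ℂ) →ₗ[ℂ] (Fin r → ℂ)) := by
      rw [← LinearMap.ker_eq_bot, LinearMap.ker_eq_bot']
      intro c hc
      have hc' : E.frameMap p₀ e p c = 0 := hc
      rw [frameMap_apply p₀ e hp, LinearEquiv.map_eq_zero_iff] at hc'
      exact funext (h c hc')
    exact ⟨hinj, LinearMap.injective_iff_surjective.1 hinj⟩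

theorem isOpen_isUnit_inter {𝓐 : Type*} [NormedRing 𝓐] [NormedAlgebra ℂ 𝓐] [CompleteSpace 𝓐]
    {W : Set B} (hW : IsOpen W) {X : B → 𝓐} (hX : ContinuousOn X W) :
    IsOpen (W ∩ {p | IsUnit (X p)}) :=
  hX.isOpen_inter_preimage hW Units.isOpen

/-- Sections which are linearly independent at a point form a frame in a neighbourhood. -/
theorem exists_isFrame_of_linearIndependent_at {p₀ : B} {N : Set B} (hN : IsOpen N) (hp₀ : p₀ ∈ N)
    {e : Fin r → ∀ b, E.fib b} (he : ∀ j, E.Hol N (e j))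
    (hi : LinearIndependent ℂ fun j => e j p₀) :
    ∃ N' ⊆ N, IsOpen N' ∧ p₀ ∈ N' ∧ E.IsFrame N' e := by
  have hb : p₀ ∈ E.base p₀ := FiberBundle.mem_baseSet_trivializationAt' p₀
  have ho : IsOpen (N ∩ E.base p₀) :=
    hN.inter (trivializationAt (Fin r → ℂ) E.fib p₀).open_baseSet
  have hc := contMDiffOn_frameMap p₀ ho inter_subset_right fun j => (he j).mono inter_subset_left
  refine ⟨_, fun p hp => hp.1.1, isOpen_isUnit_inter ho hc.continuousOn,
    ⟨⟨hp₀, hb⟩, (isUnit_frameMap_iff p₀ e hb).2 hi⟩, ?_⟩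
  exact isFrame_of_linearIndependent (fun j => (he j).mono fun p hp => hp.1.1)
    fun p hp => (isUnit_frameMap_iff p₀ e hp.1.2).1 hp.2

theorem exists_isFrame (E : HolBundle.{u} J B r) (p₀ : B) :
    ∃ N e, IsOpen N ∧ p₀ ∈ N ∧ E.IsFrame N e :=
  ⟨_, _, (trivializationAt (Fin r → ℂ) E.fib p₀).open_baseSet,
    FiberBundle.mem_baseSet_trivializationAt' p₀,
    Trivialization.isLocalFrameOn_localFrame_baseSet J ω (trivializationAt (Fin r → ℂ) E.fib p₀)
      (Pi.basisFun ℂ (Fin r))⟩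

/-- The coordinates of a holomorphic section in a frame are holomorphic. -/
theorem IsFrame.contMDiffOn_coeff {N W : Set B} (hW : IsOpen W) (hWN : W ⊆ N)
    {e : Fin r → ∀ b, E.fib b} (he : E.IsFrame N e) {m : ∀ b, E.fib b} (hm : E.Hol W m)
    (j : Fin r) : ContMDiffOn J 𝓘(ℂ, ℂ) ω (fun p => he.coeff j p (m p)) W := by
  intro p₀ hp₀
  have hb : p₀ ∈ E.base p₀ := FiberBundle.mem_baseSet_trivializationAt' p₀
  have ho : IsOpen (W ∩ E.base p₀) :=
    hW.inter (trivializationAt (Fin r → ℂ) E.fib p₀).open_baseSet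
  have hc := contMDiffOn_frameMap p₀ ho inter_subset_right
    fun j => (he.contMDiffOn j).mono (inter_subset_left.trans hWN)
  have hm' := (hol_iff_coord p₀ ho inter_subset_right).1 (Hol.mono hm inter_subset_left)
  have hu : ∀ p ∈ W ∩ E.base p₀, IsUnit (E.frameMap p₀ e p) := fun p hp =>
    (isUnit_frameMap_iff p₀ e hp.2).2 (he.linearIndependent (hWN hp.1))
  -- The coordinates in the frame are the inverse of `frameMap` applied to the coordinates in the
  -- trivialization, and inversion is analytic.
  have hinv : ContMDiffAt J 𝓘(ℂ, (Fin r → ℂ) →L[ℂ] (Fin r → ℂ)) ω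
      (fun p => Ring.inverse (E.frameMap p₀ e p)) p₀ := by
    obtain ⟨a, ha⟩ := hu p₀ ⟨hp₀, hb⟩
    have h1 : ContDiffAt ℂ ω Ring.inverse (E.frameMap p₀ e p₀) := ha ▸ contDiffAt_ringInverse ℂ a
    exact h1.contMDiffAt.comp p₀ (hc.contMDiffAt (ho.mem_nhds ⟨hp₀, hb⟩))
  have h2 := hinv.clm_apply (hm'.contMDiffAt (ho.mem_nhds ⟨hp₀, hb⟩))
  have h3 : ContMDiffAt J 𝓘(ℂ, ℂ) ω
      (fun p => (Ring.inverse (E.frameMap p₀ e p) (E.coord p₀ m p)) j) p₀ :=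
    (ContinuousLinearMap.contMDiff (ContinuousLinearMap.proj (R := ℂ) (φ := fun _ => ℂ) j)).contMDiffAt.comp p₀ h2
  refine ContMDiffAt.contMDiffWithinAt (h3.congr_of_eventuallyEq ?_)
  filter_upwards [ho.mem_nhds ⟨hp₀, hb⟩] with p hp
  have h4 : E.frameMap p₀ e p (fun j => he.coeff j p (m p)) = E.coord p₀ m p := by
    rw [frameMap_apply p₀ e hp.2, ← he.coeff_sum_eq m (hWN hp.1), coord_eq]
  have h5 := congrArg (fun T : (Fin r → ℂ) →L[ℂ] (Fin r → ℂ) => T fun j => he.coeff j p (m p))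
    (Ring.inverse_mul_cancel _ (hu p hp))
  rw [← h4]
  exact (congrFun h5 j).symm

theorem IsFrame.coeff_eq_of_sum {N : Set B} {e : Fin r → ∀ b, E.fib b} (he : E.IsFrame N e)
    {p : B} (hp : p ∈ N) {x : E.fib p} {c : Fin r → ℂ} (h : x = ∑ j, c j • e j p) (j : Fin r) :
    he.coeff j p x = c j := by
  have h1 : he.coeff j p = (he.toBasisAt hp).coord j := by simp [IsLocalFrameOn.coeff, hp]
  have h2 : ∀ j, (he.toBasisAt hp) j = e j p := fun j => he.toBasisAt_coe hp j
  simp only [h1, h, ← h2, Basis.coord_apply, (he.toBasisAt hp).repr_sum_self]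

theorem IsFrame.sum_coeff {N : Set B} {e : Fin r → ∀ b, E.fib b} (he : E.IsFrame N e)
    {p : B} (hp : p ∈ N) (x : E.fib p) : x = ∑ j, he.coeff j p x • e j p := by
  have h1 : ∀ j, he.coeff j p x = (he.toBasisAt hp).repr x j := fun j => by
    simp [IsLocalFrameOn.coeff, hp]
  have h2 : ∀ j, (he.toBasisAt hp) j = e j p := fun j => he.toBasisAt_coe hp j
  simp only [h1, ← h2]
  exact ((he.toBasisAt hp).sum_repr x).symm

/-- A local holomorphic section through a given vector. -/
theorem exists_hol_through (E : HolBundle.{u} J B r) (p : B) (x : E.fib p) :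
    ∃ N m, IsOpen N ∧ p ∈ N ∧ E.Hol N m ∧ m p = x := by
  obtain ⟨N, e, hN, hp, he⟩ := E.exists_isFrame p
  exact ⟨N, fun q => ∑ j, he.coeff j p x • e j q, hN, hp,
    Hol.sum fun j _ => Hol.const_smul _ (he.contMDiffOn j), (he.sum_coeff hp x).symm⟩

end HolBundle

end Frames

/-! ### Sections across ħ = 0: uniqueness and gluing. -/

section OverDisc

open Set Module

variable {Y : Type v} [TopologicalSpace Y] [ChartedSpace ℂ Y] [IsManifold 𝓘(ℂ, ℂ) ω Y]
  {r : ℕ} {E : HolBundle.{u} modelYΩ (Y × ℂ) r}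

namespace HolBundle

/-- Holomorphic sections which agree for `ħ ≠ 0` agree. -/
theorem Hol.eq_of_eq_off_zero {W : Set (Y × ℂ)} (hW : IsOpen W) {m n : ∀ p, E.fib p}
    (hm : E.Hol W m) (hn : E.Hol W n) (h : ∀ p ∈ W, p.2 ≠ 0 → m p = n p) :
    ∀ p ∈ W, m p = n p := by
  rintro ⟨y, z⟩ hp
  by_cases hz : z ≠ 0
  · exact h _ hp hz
  rw [not_not] at hz
  subst hz
  obtain ⟨N, e, hN, hpN, he⟩ := E.exists_isFrame (y, (0 : ℂ))
  have ho := hW.inter hN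
  have hc : ∀ m : (∀ p, E.fib p), E.Hol W m → ∀ j,
      Filter.Tendsto (fun z : ℂ => he.coeff j (y, z) (m (y, z))) (𝓝[≠] 0)
        (𝓝 (he.coeff j (y, 0) (m (y, 0)))) := by
    intro m hm j
    have h1 : ContinuousAt (fun p => he.coeff j p (m p)) (y, (0 : ℂ)) :=
      ((HolBundle.IsFrame.contMDiffOn_coeff ho inter_subset_right he (hm.mono inter_subset_left)
        j).continuousOn).continuousAt (ho.mem_nhds ⟨hp, hpN⟩)
    have h2 : Filter.Tendsto (fun z : ℂ => (y, z)) (𝓝[≠] 0) (𝓝 (y, (0 : ℂ))) :=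
      ((Continuous.prodMk_right y).tendsto 0).mono_left nhdsWithin_le_nhds
    exact Filter.Tendsto.comp h1 h2
  rw [he.sum_coeff hpN (m (y, 0)), he.sum_coeff hpN (n (y, 0))]
  refine Finset.sum_congr rfl fun j _ => ?_
  congr 1
  refine tendsto_nhds_unique_of_eventuallyEq (hc m hm j) (hc n hn j) ?_
  have h3 : ∀ᶠ z : ℂ in 𝓝 0, (y, z) ∈ W :=
    ((Continuous.prodMk_right y).tendsto (0 : ℂ)).eventually (hW.mem_nhds hp)
  filter_upwards [nhdsWithin_le_nhds h3, self_mem_nhdsWithin] with z hz hz0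
  rw [h _ hz hz0]

/-- A section over `ħ ≠ 0` which extends holomorphically across `ħ = 0` locally does so
globally. -/
theorem exists_hol_of_locally {W : Set (Y × ℂ)} (hW : IsOpen W) {s : ∀ p, E.fib p}
    (h : ∀ p ∈ W, ∃ N n, IsOpen N ∧ p ∈ N ∧ E.Hol N n ∧ ∀ q ∈ N, q.2 ≠ 0 → n q = s q) :
    ∃ m, E.Hol W m ∧ ∀ p, p.2 ≠ 0 → m p = s p := by
  classical
  choose! N n hN hp hn hns using h
  -- At a point of ħ = 0 the local extension attached to that very point is used. Any two local
  -- extensions agree where both are defined, so the choice does not matter.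
  refine ⟨fun p => if p.2 = 0 then n p p else s p, ?_, fun p hp => by simp [hp]⟩
  refine hol_of_locally fun p hpW =>
    ⟨N p ∩ W, (hN p hpW).inter hW, ⟨hp p hpW, hpW⟩, ?_⟩
  refine ((hn p hpW).mono inter_subset_left).congr fun q hq => ?_
  split_ifs with hq0
  · exact Hol.eq_of_eq_off_zero ((hN q hq.2).inter (hN p hpW))
      ((hn q hq.2).mono inter_subset_left) ((hn p hpW).mono inter_subset_right)
      (fun q' hq' h0 => (hns q hq.2 q' hq'.1 h0).trans (hns p hpW q' hq'.2 h0).symm) q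
      ⟨hp q hq.2, hq.1⟩
  · exact (hns p hpW q hq.1 hq0).symm

end HolBundle

end OverDisc
end

noncomputable section

/-! ### Elementary properties of the operators -/

section Operators

open Set Module HolBundle

variable {Y : Type v} [TopologicalSpace Y] [ChartedSpace ℂ Y] [IsManifold 𝓘(ℂ, ℂ) ω Y]

theorem dY_const (c : ℂ) (y : Y) (ξ : TangentSpace 𝓘(ℂ, ℂ) y) : dY (fun _ => c) y ξ = 0 := by
  simp only [dY]
  rw [mfderiv_const]
  rfl

theorem dY_add {f g : Y → ℂ} {y : Y} (hf : ContMDiffAt 𝓘(ℂ, ℂ) 𝓘(ℂ, ℂ) ω f y)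
    (hg : ContMDiffAt 𝓘(ℂ, ℂ) 𝓘(ℂ, ℂ) ω g y) (ξ : TangentSpace 𝓘(ℂ, ℂ) y) :
    dY (fun y => f y + g y) y ξ = dY f y ξ + dY g y ξ := by
  have := mfderiv_add (hf.mdifferentiableAt (by simp)) (hg.mdifferentiableAt (by simp))
  exact congrArg (fun T => T ξ) this

theorem dY_const_mul (c : ℂ) {f : Y → ℂ} {y : Y} (hf : ContMDiffAt 𝓘(ℂ, ℂ) 𝓘(ℂ, ℂ) ω f y)
    (ξ : TangentSpace 𝓘(ℂ, ℂ) y) : dY (fun y => c * f y) y ξ = c * dY f y ξ := by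
  have := const_smul_mfderiv (hf.mdifferentiableAt (by simp)) c
  exact congrArg (fun T => T ξ) this

namespace SmoothTriple

variable (T : SmoothTriple.{u} Y)

theorem D_zero {W : Set (Y × ℂ)} (hW : IsOpen W) {p : Y × ℂ} (hp : p ∈ W) :
    T.D (fun _ => 0) p = 0 := by
  refine LinearMap.ext fun ξ => ?_
  have h := T.D_leibniz W hW (fun _ => 0) (fun _ => 0) contMDiffOn_const (hol_zero W) p hp ξ
  simpa [dY_const] using h

theorem D_sum {ι : Type*} (s : Finset ι) {W : Set (Y × ℂ)} (hW : IsOpen W)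
    {m : ι → ∀ p, T.E.fib p} (hm : ∀ i ∈ s, T.E.Hol W (m i)) {p : Y × ℂ} (hp : p ∈ W) :
    T.D (fun q => ∑ i ∈ s, m i q) p = ∑ i ∈ s, T.D (m i) p := by
  classical
  induction s using Finset.induction_on with
  | empty => simpa using T.D_zero hW hp
  | insert i s hi ih =>
    simp only [Finset.sum_insert hi]
    rw [← ih fun j hj => hm j (Finset.mem_insert_of_mem hj)]
    exact T.D_add W hW _ _ (hm i (Finset.mem_insert_self _ _))
      (Hol.sum fun j hj => hm j (Finset.mem_insert_of_mem hj)) p hp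

theorem D_sum_smul {ι : Type*} [Fintype ι] {W : Set (Y × ℂ)} (hW : IsOpen W)
    {f : ι → Y × ℂ → ℂ} {m : ι → ∀ p, T.E.fib p}
    (hf : ∀ i, ContMDiffOn modelYΩ 𝓘(ℂ, ℂ) ω (f i) W) (hm : ∀ i, T.E.Hol W (m i)) {p : Y × ℂ}
    (hp : p ∈ W) (ξ : TangentSpace 𝓘(ℂ, ℂ) p.1) :
    T.D (fun q => ∑ i, f i q • m i q) p ξ =
      ∑ i, (f i p • T.D (m i) p ξ + (p.2 * dY (fun y => f i (y, p.2)) p.1 ξ) • m i p) := by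
  rw [T.D_sum _ hW (fun i _ => Hol.smul (hf i) (hm i)) hp, LinearMap.sum_apply]
  exact Finset.sum_congr rfl fun i _ => T.D_leibniz W hW _ _ (hf i) (hm i) p hp ξ

end SmoothTriple

namespace IntegrableStructure

variable {T : SmoothTriple.{u} Y} (S : IntegrableStructure T)

theorem δ_zero {W : Set (Y × ℂ)} (hW : IsOpen W) {p : Y × ℂ} (hp : p ∈ W) :
    S.δ (fun _ => 0) p = 0 := by
  have h := S.δ_leibniz W hW (fun _ => 0) (fun _ => 0) contMDiffOn_const (hol_zero W) p hp
  simpa using h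

theorem δ_sum {ι : Type*} (s : Finset ι) {W : Set (Y × ℂ)} (hW : IsOpen W)
    {m : ι → ∀ p, T.E.fib p} (hm : ∀ i ∈ s, T.E.Hol W (m i)) {p : Y × ℂ} (hp : p ∈ W) :
    S.δ (fun q => ∑ i ∈ s, m i q) p = ∑ i ∈ s, S.δ (m i) p := by
  classical
  induction s using Finset.induction_on with
  | empty => simpa using S.δ_zero hW hp
  | insert i s hi ih =>
    simp only [Finset.sum_insert hi]
    rw [← ih fun j hj => hm j (Finset.mem_insert_of_mem hj)]
    exact S.δ_add W hW _ _ (hm i (Finset.mem_insert_self _ _))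
      (Hol.sum fun j hj => hm j (Finset.mem_insert_of_mem hj)) p hp

theorem δ_sum_smul {ι : Type*} [Fintype ι] {W : Set (Y × ℂ)} (hW : IsOpen W)
    {f : ι → Y × ℂ → ℂ} {m : ι → ∀ p, T.E.fib p}
    (hf : ∀ i, ContMDiffOn modelYΩ 𝓘(ℂ, ℂ) ω (f i) W) (hm : ∀ i, T.E.Hol W (m i)) {p : Y × ℂ}
    (hp : p ∈ W) :
    S.δ (fun q => ∑ i, f i q • m i q) p =
      ∑ i, (f i p • S.δ (m i) p + (p.2 ^ 2 * dħ (f i) p) • m i p) := by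
  rw [S.δ_sum _ hW (fun i _ => Hol.smul (hf i) (hm i)) hp]
  exact Finset.sum_congr rfl fun i _ => S.δ_leibniz W hW _ _ (hf i) (hm i) p hp

end IntegrableStructure

end Operators

/-! ### The natural integrable structure of an analytized Rees triple -/

section ReesExpansion

open Set Module HolBundle

variable {Y : Type v} [TopologicalSpace Y] [ChartedSpace ℂ Y] [IsManifold 𝓘(ℂ, ℂ) ω Y]
  {𝒱 : FilteredFlatBundle.{u} Y} {T : SmoothTriple.{u} Y}

/-- Coordinates on a fibre. -/
def HolBundle.coordEquiv {EB H : Type*} [NormedAddCommGroup EB] [NormedSpace ℂ EB]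
    [TopologicalSpace H] {J : ModelWithCorners ℂ EB H} {B : Type v} [TopologicalSpace B]
    [ChartedSpace H B] {r : ℕ} (E : HolBundle.{u} J B r) (b : B) : E.fib b ≃ₗ[ℂ] (Fin r → ℂ) :=
  (trivializationAt (Fin r → ℂ) E.fib b).linearEquivAt ℂ b
    (FiberBundle.mem_baseSet_trivializationAt' b)

/-- An expansion of a section of `H'` on `N` in terms of sections coming from the Rees module. -/
structure ReesExpansion (φ : AnalytizationIso 𝒱 T) (N : Set (Y × ℂ)) (m : ∀ p, T.E.fib p) where
  n : ℕ
  f : Fin n → Y × ℂ → ℂ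
  d : Fin n → ℤ
  v : Fin n → ∀ y, 𝒱.V.fib y
  e : Fin n → ∀ p, T.E.fib p
  isOpen : IsOpen N
  hol_f : ∀ i, ContMDiffOn modelYΩ 𝓘(ℂ, ℂ) ω (f i) N
  hol_v : ∀ i, 𝒱.V.Hol (Prod.fst '' N) (v i)
  mem_F : ∀ i, ∀ y ∈ Prod.fst '' N, v i y ∈ 𝒱.F (d i) y
  hol_e : ∀ i, T.E.Hol (Prod.fst ⁻¹' (Prod.fst '' N)) (e i)
  e_eq : ∀ i p, p.1 ∈ Prod.fst '' N → ∀ hp : p.2 ≠ 0, e i p = φ.Φ p hp (p.2 ^ d i • v i p.1)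
  eq_sum : ∀ p ∈ N, m p = ∑ i, f i p • e i p

namespace AnalytizationIso

variable (φ : AnalytizationIso 𝒱 T)

theorem exists_extension_of_mem_F {U : Set Y} (hU : IsOpen U) {v : ∀ y, 𝒱.V.fib y} {d : ℤ}
    (hv : 𝒱.V.Hol U v) (hd : ∀ y ∈ U, v y ∈ 𝒱.F d y) :
    ∃ m, T.E.Hol (Prod.fst ⁻¹' U) m ∧
      ∀ p : Y × ℂ, p.1 ∈ U → ∀ hp : p.2 ≠ 0, m p = φ.Φ p hp (p.2 ^ d • v p.1) := by
  have hsub : Prod.fst '' ((Prod.fst : Y × ℂ → Y) ⁻¹' U) ⊆ U := image_preimage_subset _ _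
  obtain ⟨m, hm, h⟩ := (φ.sections (Prod.fst ⁻¹' U) (hU.preimage continuous_fst)
    (fun p => p.2 ^ d • v p.1)).1 fun p hp =>
      ⟨Prod.fst ⁻¹' U, 1, fun _ _ => 1, fun _ => d, fun _ => v, hU.preimage continuous_fst, hp,
        subset_rfl, fun _ => contMDiffOn_const, fun _ => hv.mono hsub,
        fun _ y hy => hd y (hsub hy), fun q _ _ => by simp⟩
  exact ⟨m, hm, fun p hp hp0 => h p hp hp0⟩

/-- The section of `V` over `ħ ≠ 0` corresponding to a section of `H'`. -/
def inv (m : ∀ p, T.E.fib p) (p : Y × ℂ) : 𝒱.V.fib p.1 :=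
  open Classical in if hp : p.2 ≠ 0 then (φ.Φ p hp).symm (m p) else 0

theorem inv_of_ne (m : ∀ p, T.E.fib p) (p : Y × ℂ) (hp : p.2 ≠ 0) :
    φ.inv m p = (φ.Φ p hp).symm (m p) := by
  simp [inv, hp]

/-- The definition of a Rees section gives the sum only for ħ ≠ 0. Each ħ^{d_i} v_i extends to a
section of `H'`, and the identity passes to ħ = 0 by continuity. -/
theorem exists_expansion {W : Set (Y × ℂ)} (hW : IsOpen W) {m : ∀ p, T.E.fib p}
    (hm : T.E.Hol W m) {p : Y × ℂ} (hp : p ∈ W) :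
    ∃ N ⊆ W, p ∈ N ∧ Nonempty (ReesExpansion φ N m) := by
  obtain ⟨N, n, f, d, v, hN, hpN, hNW, hf, hv, hd, hs⟩ :=
    (φ.sections W hW (φ.inv m)).2 ⟨m, hm, fun p _ hp0 => by simp [φ.inv_of_ne m p hp0]⟩ p hp
  have hU : IsOpen (Prod.fst '' N) := isOpenMap_fst _ hN
  choose e he heq using fun i => φ.exists_extension_of_mem_F hU (hv i) (hd i)
  refine ⟨N, hNW, hpN, ⟨⟨n, f, d, v, e, hN, hf, hv, hd, he, heq, ?_⟩⟩⟩
  have hNsub : N ⊆ Prod.fst ⁻¹' (Prod.fst '' N) := subset_preimage_image _ _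
  refine Hol.eq_of_eq_off_zero hN (hm.mono hNW)
    (Hol.sum fun i _ => Hol.smul (hf i) ((he i).mono hNsub)) fun q hq hq0 => ?_
  have h1 : φ.Φ q hq0 (φ.inv m q) = m q := by simp [φ.inv_of_ne m q hq0]
  rw [← h1, hs q hq hq0, map_sum]
  refine Finset.sum_congr rfl fun i _ => ?_
  rw [heq i q (hNsub hq) hq0, ← map_smul, smul_smul]

end AnalytizationIso

namespace ReesExpansion

variable {φ : AnalytizationIso 𝒱 T} {N : Set (Y × ℂ)} {m : ∀ p, T.E.fib p}
  (X : ReesExpansion φ N m)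

theorem subset_preimage (_X : ReesExpansion φ N m) : N ⊆ Prod.fst ⁻¹' (Prod.fst '' N) :=
  subset_preimage_image _ _

theorem inv_eq {q : Y × ℂ} (hq : q ∈ N) (hq0 : q.2 ≠ 0) :
    φ.inv m q = ∑ i, (X.f i q * q.2 ^ X.d i) • X.v i q.1 := by
  rw [φ.inv_of_ne m q hq0, X.eq_sum q hq, map_sum]
  refine Finset.sum_congr rfl fun i _ => ?_
  rw [X.e_eq i q (X.subset_preimage hq) hq0, map_smul, LinearEquiv.symm_apply_apply, smul_smul]

/-- The coefficients of the derivative of an expansion. -/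
def δf (i : Fin X.n) (q : Y × ℂ) : ℂ := q.2 ^ 2 * dħ (X.f i) q + X.d i * q.2 * X.f i q

theorem hasDerivAt_slice {y : Y} {z : ℂ} (hq : (y, z) ∈ N) (i : Fin X.n) :
    HasDerivAt (fun z => X.f i (y, z)) (dħ (X.f i) (y, z)) z :=
  (((X.hol_f i).contMDiffAt (X.isOpen.mem_nhds hq)).differentiableAt_slice).hasDerivAt

/-- This explains `δf`: ħ²∂_ħ(f ħ^d) is `δf` times ħ^d, so the exponents and the vectors of an
expansion stay the same. -/
theorem hasDerivAt_slice_mul {y : Y} {z : ℂ} (hq : (y, z) ∈ N) (hz : z ≠ 0) (i : Fin X.n) :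
    HasDerivAt (fun z => X.f i (y, z) * z ^ X.d i)
      ((z ^ 2)⁻¹ * (X.δf i (y, z) * z ^ X.d i)) z := by
  have h := (X.hasDerivAt_slice hq i).mul (hasDerivAt_zpow (X.d i) z (Or.inl hz))
  refine h.congr_deriv ?_
  simp only [δf]
  rw [zpow_sub_one₀ hz]
  field_simp

theorem eventually_mem {y : Y} {z : ℂ} (X : ReesExpansion φ N m) (hq : (y, z) ∈ N) :
    ∀ᶠ w in 𝓝 z, (y, w) ∈ N :=
  ((Continuous.prodMk_right y).tendsto z).eventually (X.isOpen.mem_nhds hq)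

theorem hasDerivAt_inv {y : Y} {z : ℂ} (hq : (y, z) ∈ N) (hz : z ≠ 0) {F : Type*}
    [NormedAddCommGroup F] [NormedSpace ℂ F] (L : 𝒱.V.fib y →ₗ[ℂ] F) :
    HasDerivAt (fun w => L (φ.inv m (y, w)))
      ((z ^ 2)⁻¹ • L (∑ i, (X.δf i (y, z) * z ^ X.d i) • X.v i y)) z := by
  have h1 : HasDerivAt (fun w => ∑ i, (X.f i (y, w) * w ^ X.d i) • L (X.v i y))
      (∑ i, ((z ^ 2)⁻¹ * (X.δf i (y, z) * z ^ X.d i)) • L (X.v i y)) z :=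
    HasDerivAt.fun_sum fun i _ => (X.hasDerivAt_slice_mul hq hz i).smul_const _
  refine (h1.congr_of_eventuallyEq ?_).congr_deriv ?_
  · filter_upwards [X.eventually_mem hq, isOpen_ne.mem_nhds hz] with w hw hw0
    rw [X.inv_eq hw hw0]
    simp
  · simp only [map_sum, map_smul, Finset.smul_sum, smul_smul]

theorem hol_δf (i : Fin X.n) : ContMDiffOn modelYΩ 𝓘(ℂ, ℂ) ω (X.δf i) N := by
  have h2 : ContMDiffOn modelYΩ 𝓘(ℂ, ℂ) ω (fun q : Y × ℂ => q.2) N := contMDiffOn_snd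
  exact ((h2.pow 2).mul (contMDiffOn_dħ X.isOpen (X.hol_f i))).add
    ((contMDiffOn_const.mul h2).mul (X.hol_f i))

theorem D_eq {q : Y × ℂ} (hq : q ∈ N) (hq0 : q.2 ≠ 0) (ξ : TangentSpace 𝓘(ℂ, ℂ) q.1) :
    T.D m q ξ = φ.Φ q hq0 (∑ i, ((X.f i q * q.2 ^ (X.d i + 1)) • 𝒱.conn (X.v i) q.1 ξ +
      (q.2 * dY (fun y => X.f i (y, q.2)) q.1 ξ * q.2 ^ X.d i) • X.v i q.1)) := by
  have hh : ∀ i, T.E.Hol N (X.e i) := fun i => (X.hol_e i).mono X.subset_preimage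
  have h1 := T.D_local N X.isOpen m (fun q => ∑ i, X.f i q • X.e i q)
    ((Hol.sum fun i _ => Hol.smul (X.hol_f i) (hh i)).congr X.eq_sum)
    (Hol.sum fun i _ => Hol.smul (X.hol_f i) (hh i)) X.eq_sum q hq
  rw [h1, T.D_sum_smul X.isOpen X.hol_f hh hq, map_sum]
  refine Finset.sum_congr rfl fun i _ => ?_
  have hU : IsOpen (Prod.fst '' N) := isOpenMap_fst _ X.isOpen
  rw [φ.map_D (X.d i) _ hU (X.v i) (X.hol_v i) (X.mem_F i) (X.e i) (X.hol_e i) (X.e_eq i) q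
    (X.subset_preimage hq) hq0, X.e_eq i q (X.subset_preimage hq) hq0, map_add,
    ← (φ.Φ q hq0).map_smul (X.f i q), ← (φ.Φ q hq0).map_smul (q.2 * _), smul_smul, smul_smul,
    smul_smul, zpow_add_one₀ hq0, mul_comm (q.2 ^ X.d i) q.2, ← mul_assoc]

end ReesExpansion

end ReesExpansion
end

/-! ### The action of ħ²∂_ħ on expansions, its divisibility by ħ, and its monodromy. -/

noncomputable section

section NaturalStructure

open Set Module HolBundle

variable {Y : Type v} [TopologicalSpace Y] [ChartedSpace ℂ Y] [IsManifold 𝓘(ℂ, ℂ) ω Y]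
  {𝒱 : FilteredFlatBundle.{u} Y} {T : SmoothTriple.{u} Y}

namespace ReesExpansion

variable {φ : AnalytizationIso 𝒱 T} {N : Set (Y × ℂ)} {m : ∀ p, T.E.fib p}
  (X : ReesExpansion φ N m)

/-- The expansion of the derivative. -/
def delta {n : ∀ p, T.E.fib p} (h : ∀ q ∈ N, n q = ∑ i, X.δf i q • X.e i q) :
    ReesExpansion φ N n :=
  { X with
    f := X.δf
    hol_f := X.hol_δf
    eq_sum := h }

theorem sum_e {q : Y × ℂ} (hq : q ∈ N) (hq0 : q.2 ≠ 0) (c : Fin X.n → ℂ) :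
    ∑ i, c i • X.e i q = φ.Φ q hq0 (∑ i, (c i * q.2 ^ X.d i) • X.v i q.1) := by
  rw [map_sum]
  refine Finset.sum_congr rfl fun i _ => ?_
  rw [X.e_eq i q (X.subset_preimage hq) hq0, ← map_smul, smul_smul]

theorem hol_sum_δf : T.E.Hol N fun q => ∑ i, X.δf i q • X.e i q :=
  Hol.sum fun i _ => Hol.smul (X.hol_δf i) ((X.hol_e i).mono X.subset_preimage)

/-- An expansion determines the action of a compatible integrable structure. -/
theorem δ_eq {S : IntegrableStructure T} (hS : φ.IsCompatible S) (hm : T.E.Hol N m) :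
    ∀ q ∈ N, S.δ m q = ∑ i, X.δf i q • X.e i q := by
  refine Hol.eq_of_eq_off_zero X.isOpen (S.δ_hol N X.isOpen m hm) X.hol_sum_δf
    fun q hq hq0 => ?_
  have hh : ∀ i, T.E.Hol N (X.e i) := fun i => (X.hol_e i).mono X.subset_preimage
  rw [S.δ_local N X.isOpen m (fun q => ∑ i, X.f i q • X.e i q) hm
    (Hol.sum fun i _ => Hol.smul (X.hol_f i) (hh i)) X.eq_sum q hq,
    S.δ_sum_smul X.isOpen X.hol_f hh hq]
  refine Finset.sum_congr rfl fun i _ => ?_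
  have hU : IsOpen (Prod.fst '' N) := isOpenMap_fst _ X.isOpen
  rw [hS (X.d i) _ hU (X.v i) (X.hol_v i) (X.mem_F i) (X.e i) (X.hol_e i) (X.e_eq i) q
    (X.subset_preimage hq) hq0, X.e_eq i q (X.subset_preimage hq) hq0,
    ← (φ.Φ q hq0).map_smul, ← (φ.Φ q hq0).map_smul, ← (φ.Φ q hq0).map_smul, ← map_add,
    smul_smul, smul_smul, smul_smul, ← add_smul, zpow_add_one₀ hq0, δf]
  congr 2
  ring

end ReesExpansion

namespace AnalytizationIso

variable (φ : AnalytizationIso 𝒱 T)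

/-- The natural action of `ħ²∂_ħ` on the analytization of a Rees module. -/
def natδ (m : ∀ p, T.E.fib p) (p : Y × ℂ) : T.E.fib p :=
  open Classical in
  -- The fibre carries a topology but no norm, so the derivative is taken after `coordEquiv`. The
  -- value 0 at ħ = 0 is the right one, since ħ²∂_ħ maps a Rees module into ħ times itself.
  if hp : p.2 ≠ 0 then φ.Φ p hp ((𝒱.V.coordEquiv p.1).symm
    (p.2 ^ 2 • deriv (fun w => 𝒱.V.coordEquiv p.1 (φ.inv m (p.1, w))) p.2)) else 0

variable {φ}

theorem natδ_of_zero (m : ∀ p, T.E.fib p) {p : Y × ℂ} (hp : p.2 = 0) : φ.natδ m p = 0 := by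
  simp [natδ, hp]

theorem natδ_of_hasDerivAt {m : ∀ p, T.E.fib p} {p : Y × ℂ} (hp : p.2 ≠ 0) {x : 𝒱.V.fib p.1}
    (h : HasDerivAt (fun w => 𝒱.V.coordEquiv p.1 (φ.inv m (p.1, w)))
      ((p.2 ^ 2)⁻¹ • 𝒱.V.coordEquiv p.1 x) p.2) : φ.natδ m p = φ.Φ p hp x := by
  have h2 : p.2 ^ 2 ≠ 0 := pow_ne_zero 2 hp
  rw [natδ, dif_pos hp, h.deriv, smul_inv_smul₀ h2, LinearEquiv.symm_apply_apply]

/-- These are the coefficients that `ReesExpansion.δ_eq` finds for any compatible structure. At ħ =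
0 both sides vanish because every `δf` contains a factor ħ. -/
theorem natδ_eq {N : Set (Y × ℂ)} {m : ∀ p, T.E.fib p} (X : ReesExpansion φ N m) :
    ∀ q ∈ N, φ.natδ m q = ∑ i, X.δf i q • X.e i q := by
  intro q hq
  by_cases hq0 : q.2 = 0
  · rw [natδ_of_zero m hq0]
    simp [ReesExpansion.δf, hq0]
  · rw [natδ_of_hasDerivAt hq0 (X.hasDerivAt_inv hq hq0 (𝒱.V.coordEquiv q.1).toLinearMap),
      X.sum_e hq hq0]

theorem differentiableAt_inv {W : Set (Y × ℂ)} (hW : IsOpen W) {m : ∀ p, T.E.fib p}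
    (hm : T.E.Hol W m) {p : Y × ℂ} (hp : p ∈ W) (hp0 : p.2 ≠ 0) :
    DifferentiableAt ℂ (fun w => 𝒱.V.coordEquiv p.1 (φ.inv m (p.1, w))) p.2 := by
  obtain ⟨N, hNW, hpN, ⟨X⟩⟩ := φ.exists_expansion hW hm hp
  exact (X.hasDerivAt_inv hpN hp0 (𝒱.V.coordEquiv p.1).toLinearMap).differentiableAt

theorem natδ_hol {W : Set (Y × ℂ)} (hW : IsOpen W) {m : ∀ p, T.E.fib p} (hm : T.E.Hol W m) :
    T.E.Hol W (φ.natδ m) := by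
  refine hol_of_locally fun p hp => ?_
  obtain ⟨N, hNW, hpN, ⟨X⟩⟩ := φ.exists_expansion hW hm hp
  exact ⟨N, X.isOpen, hpN, X.hol_sum_δf.congr (natδ_eq X)⟩

/-- Each coefficient `δf` is ħ(ħ∂_ħ f + d f); divide term by term and glue. The operator is left
arbitrary so that the argument serves both `natδ` and a given compatible structure. -/
theorem exists_log_of_locally {δ : (∀ p, T.E.fib p) → ∀ p, T.E.fib p} {W : Set (Y × ℂ)}
    (hW : IsOpen W) {m : ∀ p, T.E.fib p} (hm : T.E.Hol W m)
    (hδ : ∀ N ⊆ W, ∀ X : ReesExpansion φ N m, ∀ q ∈ N, δ m q = ∑ i, X.δf i q • X.e i q) :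
    ∃ n, T.E.Hol W n ∧ ∀ p ∈ W, δ m p = p.2 • n p := by
  obtain ⟨n, hn, hns⟩ := exists_hol_of_locally hW (s := fun p => p.2⁻¹ • δ m p) (fun p hp => by
    obtain ⟨N, hNW, hpN, ⟨X⟩⟩ := φ.exists_expansion hW hm hp
    have hsnd : ContMDiffOn modelYΩ 𝓘(ℂ, ℂ) ω (fun q : Y × ℂ => q.2) N := contMDiffOn_snd
    refine ⟨N, fun q => ∑ i, (q.2 * dħ (X.f i) q + X.d i * X.f i q) • X.e i q, X.isOpen, hpN,
      Hol.sum fun i _ => Hol.smul ((hsnd.mul (contMDiffOn_dħ X.isOpen (X.hol_f i))).add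
        (contMDiffOn_const.mul (X.hol_f i))) ((X.hol_e i).mono X.subset_preimage), ?_⟩
    intro q hq hq0
    rw [hδ N hNW X q hq, Finset.smul_sum]
    refine Finset.sum_congr rfl fun i _ => ?_
    rw [smul_smul]
    congr 1
    simp only [ReesExpansion.δf]
    field_simp)
  refine ⟨n, hn, fun p hp => ?_⟩
  by_cases hp0 : p.2 = 0
  · obtain ⟨N, hNW, hpN, ⟨X⟩⟩ := φ.exists_expansion hW hm hp
    rw [hδ N hNW X p hpN]
    simp [ReesExpansion.δf, hp0]
  · rw [hns p hp0, smul_inv_smul₀ hp0]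

/-- The compatibility `map_C` is stated on F_i ⊗ F_j with twists by powers of ħ. Taking both indices
so large that the filtration is everything, the powers cancel. -/
theorem C_eq (y : Y) (z : Circle) (a : T.E.fib (y, (z : ℂ))) (b : T.E.fib (y, antipode z)) :
    T.C y z a b = 𝒱.k y ((φ.Φ (y, (z : ℂ)) z.coe_ne_zero).symm a)
      ((φ.Φ (y, antipode z) (antipode_circle_ne_zero z)).symm b) := by
  obtain ⟨_, i, hi⟩ := 𝒱.F_finite
  have hz : (z : ℂ) ^ i ≠ 0 := zpow_ne_zero _ z.coe_ne_zero
  have hz' : (antipode z) ^ i ≠ 0 := zpow_ne_zero _ (antipode_circle_ne_zero z)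
  obtain ⟨v, rfl⟩ := (φ.Φ (y, (z : ℂ)) z.coe_ne_zero).surjective a
  obtain ⟨w, rfl⟩ := (φ.Φ (y, antipode z) (antipode_circle_ne_zero z)).surjective b
  have h := φ.map_C y z i i v ((hi y).2 ▸ Submodule.mem_top) w ((hi y).2 ▸ Submodule.mem_top)
  simp only [map_smul, LinearMap.smul_apply, LinearMap.map_smulₛₗ, smul_eq_mul, map_zpow₀,
    LinearEquiv.symm_apply_apply] at h ⊢
  have hz'' : (conj (antipode (z : ℂ))) ^ i ≠ 0 := by
    rw [← map_zpow₀]; exact (map_ne_zero _).2 hz'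
  rw [mul_assoc, mul_left_comm] at h
  exact mul_left_cancel₀ hz'' (mul_left_cancel₀ hz h)

/-- A form of the computation for arbitrary scalar coefficients, because `T.D m` mixes the exponents
d and d + 1 and is not given as a `ReesExpansion`. -/
theorem natδ_of_sum {ι : Type*} [Fintype ι] {m : ∀ p, T.E.fib p} {y : Y} {z : ℂ} (hz : z ≠ 0)
    {a : ι → ℂ → ℂ} {A : ι → ℂ} {x : ι → 𝒱.V.fib y}
    (h : ∀ᶠ w in 𝓝 z, φ.inv m (y, w) = ∑ i, a i w • x i)
    (ha : ∀ i, HasDerivAt (a i) ((z ^ 2)⁻¹ * A i) z) :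
    φ.natδ m (y, z) = φ.Φ (y, z) hz (∑ i, A i • x i) := by
  refine natδ_of_hasDerivAt (p := (y, z)) hz ?_
  have h3 : HasDerivAt (fun w => ∑ i, a i w • 𝒱.V.coordEquiv y (x i)) _ z :=
    HasDerivAt.fun_sum fun i _ => (ha i).smul_const _
  refine (h3.congr_of_eventuallyEq ?_).congr_deriv ?_
  · filter_upwards [h] with w hw
    rw [hw]
    simp only [map_sum, map_smul]
  · simp only [map_sum, map_smul, Finset.smul_sum, smul_smul]

/-- In an expansion, (ħξ)m is Σ f ħ^{d+1} ∇_ξ v + ħ ξ(f) ħ^d v. Compared with the same formula for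
ħ²∂_ħ m, differentiating the additional factor ħ in both kinds of terms yields the commutator; that
ξ and ∂_ħ commute on coefficients is `hasDerivAt_dY`. -/
theorem δ_D_aux {m : ∀ p, T.E.fib p} {N : Set (Y × ℂ)} (X : ReesExpansion φ N m) {p : Y × ℂ}
    (hp : p ∈ N) (hp0 : p.2 ≠ 0) (ξ : ∀ y : Y, TangentSpace 𝓘(ℂ, ℂ) y) :
    φ.natδ (fun q => T.D m q (ξ q.1)) p =
      T.D (φ.natδ m) p (ξ p.1) + p.2 • T.D m p (ξ p.1) := by
  obtain ⟨y, z⟩ := p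
  replace hp0 : z ≠ 0 := hp0
  have hf : ∀ i, ContMDiffAt modelYΩ 𝓘(ℂ, ℂ) ω (X.f i) (y, z) := fun i =>
    (X.hol_f i).contMDiffAt (X.isOpen.mem_nhds hp)
  have h1 : ∀ i, HasDerivAt (fun w => X.f i (y, w) * w ^ (X.d i + 1))
      ((z ^ 2)⁻¹ * ((X.δf i (y, z) + z * X.f i (y, z)) * z ^ (X.d i + 1))) z := by
    intro i
    refine ((X.hasDerivAt_slice hp i).mul
      (hasDerivAt_zpow (X.d i + 1) z (Or.inl hp0))).congr_deriv ?_
    simp only [ReesExpansion.δf]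
    rw [zpow_sub_one₀ hp0]
    push_cast
    field_simp
    ring
  have h2 : ∀ i, HasDerivAt (fun w => w * dY (fun y => X.f i (y, w)) y (ξ y) * w ^ X.d i)
      ((z ^ 2)⁻¹ * ((z * dY (fun y => X.δf i (y, z)) y (ξ y) +
        z * (z * dY (fun y => X.f i (y, z)) y (ξ y))) * z ^ X.d i)) z := by
    intro i
    have e1 : dY (fun y => X.δf i (y, z)) y (ξ y) =
        z ^ 2 * dY (fun y => dħ (X.f i) (y, z)) y (ξ y) +
          X.d i * z * dY (fun y => X.f i (y, z)) y (ξ y) := by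
      have c1 := (contMDiffAt_dħ (hf i)).slice_left
      have c2 := (hf i).slice_left
      rw [← dY_const_mul _ c1, ← dY_const_mul _ c2]
      exact dY_add (f := fun y => z ^ 2 * dħ (X.f i) (y, z))
        (g := fun y => X.d i * z * X.f i (y, z)) (contMDiffAt_const.mul c1)
        (contMDiffAt_const.mul c2) _
    rw [e1]
    refine (((hasDerivAt_id z).mul (hasDerivAt_dY (hf i) (ξ y))).mul
      (hasDerivAt_zpow (X.d i) z (Or.inl hp0))).congr_deriv ?_
    simp only [Pi.mul_apply, id]
    rw [zpow_sub_one₀ hp0]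
    field_simp
    ring
  have h3 : ∀ᶠ w in 𝓝 z, φ.inv (fun q => T.D m q (ξ q.1)) (y, w) =
      ∑ i : Fin X.n ⊕ Fin X.n, Sum.elim (fun i w => X.f i (y, w) * w ^ (X.d i + 1))
        (fun i w => w * dY (fun y => X.f i (y, w)) y (ξ y) * w ^ X.d i) i w •
      (Sum.elim (fun i => 𝒱.conn (X.v i) y (ξ y)) (fun i => X.v i y) i : 𝒱.V.fib y) := by
    filter_upwards [X.eventually_mem hp, isOpen_ne.mem_nhds hp0] with w hw hw0
    rw [φ.inv_of_ne _ (y, w) hw0, LinearEquiv.symm_apply_eq, Fintype.sum_sum_type,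
      ← Finset.sum_add_distrib]
    exact X.D_eq hw hw0 (ξ y)
  rw [natδ_of_sum hp0 h3 (A := Sum.elim
    (fun i => (X.δf i (y, z) + z * X.f i (y, z)) * z ^ (X.d i + 1))
    (fun i => (z * dY (fun y => X.δf i (y, z)) y (ξ y) +
        z * (z * dY (fun y => X.f i (y, z)) y (ξ y))) * z ^ X.d i))
    (by rintro (i | i); exacts [h1 i, h2 i])]
  have e1 := (X.delta (natδ_eq X)).D_eq hp hp0 (ξ y)
  have e2 := X.D_eq hp hp0 (ξ y)
  refine Eq.trans ?_ (congrArg₂ (fun a b => a + z • b) e1 e2).symm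
  rw [← map_smul, ← map_add]
  congr 1
  rw [Fintype.sum_sum_type, ← Finset.sum_add_distrib]
  simp only [Finset.smul_sum]
  refine Eq.trans ?_ Finset.sum_add_distrib
  refine Finset.sum_congr rfl fun i _ => ?_
  simp only [Sum.elim_inl, Sum.elim_inr, ReesExpansion.delta]
  module

/-- In expansions C(m, n̄) is a finite sum of scalar functions of ħ times values of `𝒱.k` that do
not involve ħ, so the product rule applies. Rotating ħ rotates σ(ħ) in the same direction; the minus
sign in the formula is the conjugate of i. -/
theorem natδ_C {W W' : Set (Y × ℂ)} (hW : IsOpen W) (hW' : IsOpen W') {m n : ∀ p, T.E.fib p}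
    (hm : T.E.Hol W m) (hn : T.E.Hol W' n) {y : Y} {z : Circle} (hz : (y, (z : ℂ)) ∈ W)
    (hz' : (y, antipode z) ∈ W') :
    HasDerivAt
      (fun t : ℝ => T.C y (z * Circle.exp t) (m (y, ((z * Circle.exp t : Circle) : ℂ)))
        (n (y, antipode ((z * Circle.exp t : Circle) : ℂ))))
      (I * (T.C y z ((z : ℂ)⁻¹ • φ.natδ m (y, (z : ℂ))) (n (y, antipode z)) -
        T.C y z (m (y, (z : ℂ))) ((antipode z)⁻¹ • φ.natδ n (y, antipode z)))) 0 := by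
  obtain ⟨N, -, hN, ⟨X⟩⟩ := φ.exists_expansion hW hm hz
  obtain ⟨N', -, hN', ⟨X'⟩⟩ := φ.exists_expansion hW' hn hz'
  have hz0 := z.coe_ne_zero
  have hz0' := antipode_circle_ne_zero z
  set s : ℂ := antipode z with hs
  have hant : ∀ t : ℝ, antipode ((z * Circle.exp t : Circle) : ℂ) = s * exp (t * I) := by
    intro t
    rw [hs, antipode, antipode, Circle.coe_mul, Circle.coe_exp, map_mul, ← exp_conj]
    simp only [map_mul, conj_ofReal, conj_I, mul_neg, exp_neg]
    field_simp
  have hexp : ∀ c : ℂ, HasDerivAt (fun t : ℝ => c * exp (t * I)) (c * I) 0 := by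
    intro c
    have h1 : HasDerivAt (fun t : ℝ => (t : ℂ) * I) I 0 := by
      simpa using (hasDerivAt_id (0 : ℝ)).ofReal_comp.mul_const I
    simpa using (h1.cexp).const_mul c
  have hγ : ∀ t : ℝ, ((z * Circle.exp t : Circle) : ℂ) = z * exp (t * I) := fun t => by simp
  have hγ0 : ∀ c : ℂ, c * exp ((0 : ℝ) * I) = c := fun c => by simp
  have ha : ∀ i, HasDerivAt (fun t : ℝ => X.f i (y, z * exp (t * I)) *
      (z * exp (t * I)) ^ X.d i) (I * ((z : ℂ)⁻¹ * (X.δf i (y, z) * (z : ℂ) ^ X.d i))) 0 := by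
    intro i
    have h := X.hasDerivAt_slice_mul hN hz0 i
    rw [← hγ0 z] at h
    refine (h.scomp (0 : ℝ) (hexp z)).congr_deriv ?_
    rw [hγ0, smul_eq_mul]
    field_simp
  have hb : ∀ i, HasDerivAt (fun t : ℝ => conj (X'.f i (y, s * exp (t * I)) *
      (s * exp (t * I)) ^ X'.d i)) (conj (I * (s⁻¹ * (X'.δf i (y, s) * s ^ X'.d i)))) 0 := by
    intro i
    have h := X'.hasDerivAt_slice_mul hN' hz0' i
    rw [← hγ0 s] at h
    refine ((h.scomp (0 : ℝ) (hexp s)).star).congr_deriv ?_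
    rw [hγ0, smul_eq_mul]
    change conj _ = _
    congr 1
    field_simp
  have hsum := HasDerivAt.fun_sum (u := Finset.univ) fun i _ =>
    HasDerivAt.fun_sum (u := Finset.univ) fun j _ =>
      ((ha i).mul (hb j)).mul_const (𝒱.k y (X.v i y) (X'.v j y))
  refine (hsum.congr_of_eventuallyEq ?_).congr_deriv ?_
  · have c1 : Filter.Tendsto (fun t : ℝ => (z : ℂ) * exp (t * I)) (𝓝 0) (𝓝 z) := by
      simpa using (hexp z).continuousAt.tendsto
    have c2 : Filter.Tendsto (fun t : ℝ => s * exp (t * I)) (𝓝 0) (𝓝 s) := by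
      simpa using (hexp s).continuousAt.tendsto
    filter_upwards [c1.eventually (X.eventually_mem hN), c2.eventually (X'.eventually_mem hN')]
      with t h1 h2
    have h3 : φ.inv m (y, ((z * Circle.exp t : Circle) : ℂ)) = _ :=
      X.inv_eq (by rwa [hγ]) (Circle.coe_ne_zero _)
    have h4 : φ.inv n (y, antipode ((z * Circle.exp t : Circle) : ℂ)) = _ :=
      X'.inv_eq (by rwa [hant]) (antipode_circle_ne_zero _)
    rw [φ.inv_of_ne _ _ (Circle.coe_ne_zero _)] at h3
    rw [φ.inv_of_ne _ _ (antipode_circle_ne_zero _)] at h4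
    rw [C_eq, h3, h4]
    simp only [hant]
    simp only [map_sum, LinearMap.sum_apply, map_smul, LinearMap.smul_apply,
      LinearMap.map_smulₛₗ, smul_eq_mul, hγ, Pi.mul_apply, Finset.mul_sum]
    rw [Finset.sum_comm]
    refine Finset.sum_congr rfl fun i _ => Finset.sum_congr rfl fun j _ => ?_
    ring
  · have e1 : (φ.Φ (y, (z : ℂ)) hz0).symm ((z : ℂ)⁻¹ • φ.natδ m (y, (z : ℂ))) =
        ∑ i, ((z : ℂ)⁻¹ * (X.δf i (y, z) * (z : ℂ) ^ X.d i)) • X.v i y := by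
      rw [map_smul, natδ_eq X _ hN, X.sum_e hN hz0, LinearEquiv.symm_apply_apply,
        Finset.smul_sum]
      simp only [smul_smul]
    have e2 : (φ.Φ (y, s) hz0').symm (s⁻¹ • φ.natδ n (y, s)) =
        ∑ i, (s⁻¹ * (X'.δf i (y, s) * s ^ X'.d i)) • X'.v i y := by
      rw [map_smul, natδ_eq X' _ hN', X'.sum_e hN' hz0', LinearEquiv.symm_apply_apply,
        Finset.smul_sum]
      simp only [smul_smul]
    have e3 := X.inv_eq hN hz0
    have e4 := X'.inv_eq hN' hz0'
    rw [φ.inv_of_ne _ _ hz0] at e3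
    rw [φ.inv_of_ne _ _ hz0'] at e4
    rw [C_eq, C_eq, e1, e2, e3, e4]
    simp only [map_sum, LinearMap.sum_apply, map_smul, LinearMap.smul_apply,
      LinearMap.map_smulₛₗ, smul_eq_mul, Finset.mul_sum, mul_sub]
    rw [Finset.sum_comm (s := Finset.univ (α := Fin X'.n)),
      Finset.sum_comm (s := Finset.univ (α := Fin X'.n)), ← Finset.sum_sub_distrib]
    refine Finset.sum_congr rfl fun i _ => ?_
    rw [← Finset.sum_sub_distrib]
    refine Finset.sum_congr rfl fun j _ => ?_
    simp only [Complex.ofReal_zero, zero_mul, exp_zero, mul_one, map_mul, conj_I]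
    ring

variable (φ) in
/-- The natural integrable structure of the analytization of a Rees triple. -/
def natStructure : IntegrableStructure T where
  δ := φ.natδ
  δ_local W hW m n hm hn h p hp := by
    by_cases hp0 : p.2 = 0
    · rw [natδ_of_zero _ hp0, natδ_of_zero _ hp0]
    · have he : (fun w => 𝒱.V.coordEquiv p.1 (φ.inv m (p.1, w))) =ᶠ[𝓝 p.2]
          fun w => 𝒱.V.coordEquiv p.1 (φ.inv n (p.1, w)) := by
        have h1 : ∀ᶠ w in 𝓝 p.2, (p.1, w) ∈ W :=
          ((Continuous.prodMk_right p.1).tendsto p.2).eventually (hW.mem_nhds hp)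
        filter_upwards [h1] with w hw
        simp only [inv, h _ hw]
      simp only [natδ, he.deriv_eq]
  δ_add W hW m n hm hn p hp := by
    by_cases hp0 : p.2 = 0
    · simp [natδ_of_zero _ hp0]
    · have h1 := differentiableAt_inv (φ := φ) hW hm hp hp0
      have h2 := differentiableAt_inv (φ := φ) hW hn hp hp0
      have he : (fun w => 𝒱.V.coordEquiv p.1 (φ.inv (fun q => m q + n q) (p.1, w))) =
          fun w => 𝒱.V.coordEquiv p.1 (φ.inv m (p.1, w)) +
            𝒱.V.coordEquiv p.1 (φ.inv n (p.1, w)) := by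
        funext w
        simp only [inv]
        split_ifs <;> simp
      simp only [natδ, dif_pos hp0]
      rw [he, deriv_fun_add h1 h2, smul_add, map_add, map_add]
  δ_leibniz W hW f m hf hm p hp := by
    by_cases hp0 : p.2 = 0
    · simp [natδ_of_zero _ hp0, hp0]
    · have h1 := differentiableAt_inv (φ := φ) hW hm hp hp0
      have h2 : DifferentiableAt ℂ (fun z => f (p.1, z)) p.2 :=
        (hf.contMDiffAt (hW.mem_nhds hp)).differentiableAt_slice
      have he : (fun w => 𝒱.V.coordEquiv p.1 (φ.inv (fun q => f q • m q) (p.1, w))) =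
          fun w => f (p.1, w) • 𝒱.V.coordEquiv p.1 (φ.inv m (p.1, w)) := by
        funext w
        simp only [inv]
        split_ifs <;> simp
      simp only [natδ, dif_pos hp0]
      rw [he, deriv_fun_smul h2 h1, smul_add, map_add, map_add, smul_comm, map_smul, map_smul]
      congr 1
      have h3 : (φ.Φ p hp0) (φ.inv m (p.1, p.2)) = m p := by
        rw [φ.inv_of_ne m p hp0, LinearEquiv.apply_symm_apply]
      rw [smul_smul, map_smul, map_smul, LinearEquiv.symm_apply_apply, h3]
  δ_hol W hW m hm := natδ_hol hW hm
  δ_D W U hW hU hWU m ξ hm hξ p hp := by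
    by_cases hp0 : p.2 = 0
    -- At ħ = 0 the left side is 0 by definition of `natδ`. On the right, `natδ m` is ħ n, so its
    -- image under ħξ also vanishes by the Leibniz rule.
    · obtain ⟨n, hn, hmn⟩ := exists_log_of_locally (φ := φ) (δ := φ.natδ) hW hm
        fun N _ X => natδ_eq X
      have h1 := T.D_local W hW (φ.natδ m) (fun q => q.2 • n q) (natδ_hol hW hm)
        (Hol.smul contMDiffOn_snd hn) hmn p hp
      rw [h1, natδ_of_zero _ hp0, T.D_leibniz W hW _ _ contMDiffOn_snd hn p hp]
      simp [hp0]
    · obtain ⟨N, hNW, hpN, ⟨X⟩⟩ := φ.exists_expansion hW hm hp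
      exact δ_D_aux X hpN hp0 ξ
  δ_C W W' hW hW' m n hm hn y z hz hz' := natδ_C hW hW' hm hn hz hz'

variable (φ) in
theorem isCompatible_natStructure : φ.IsCompatible φ.natStructure := by
  intro d U hU v hv hd m hm hmv p hp hp0
  obtain ⟨y, z⟩ := p
  replace hp0 : z ≠ 0 := hp0
  have := natδ_of_sum (φ := φ) (ι := Unit) (m := m) (y := y) hp0 (a := fun _ w => w ^ d)
    (A := fun _ => d * z ^ (d + 1)) (x := fun _ => v y) (by
      filter_upwards [isOpen_ne.mem_nhds hp0] with w hw
      rw [φ.inv_of_ne _ (y, w) hw, hmv (y, w) hp hw]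
      simp) (fun _ => (hasDerivAt_zpow d z (Or.inl hp0)).congr_deriv (by
        rw [zpow_sub_one₀ hp0, zpow_add_one₀ hp0]
        field_simp))
  refine Eq.trans this ?_
  simp

theorem isLogarithmic_of_isCompatible {S : IntegrableStructure T} (hS : φ.IsCompatible S) :
    S.IsLogarithmic := fun _ hW _ hm =>
  exists_log_of_locally hW hm fun _ hNW X => X.δ_eq hS (hm.mono hNW)

theorem mk_Φ_congr {y : Y} {a b : ℂ} (h : a = b) (ha : a ≠ 0) (hb : b ≠ 0) (x : 𝒱.V.fib y) :
    TotalSpace.mk' (Fin T.rank → ℂ) (y, a) (φ.Φ (y, a) ha x) =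
      TotalSpace.mk' (Fin T.rank → ℂ) (y, b) (φ.Φ (y, b) hb x) := by
  subst h; rfl

/-- Read in V, the equation δ m = 0 says that the ħ-derivative vanishes. A parallel section along
the loop is therefore a locally constant map from ℝ to the fixed fibre of V at `y`. -/
theorem trivialMonodromy_of_isCompatible {S : IntegrableStructure T} (hS : φ.IsCompatible S) :
    S.TrivialMonodromy := by
  intro y a ha s hs
  have hne : ∀ t : ℝ, exp (t * I) * a ≠ 0 := fun t => mul_ne_zero (exp_ne_zero _) ha
  let x : ℝ → 𝒱.V.fib y := fun t => (φ.Φ (y, exp (t * I) * a) (hne t)).symm (s t)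
  have hx : IsLocallyConstant x := by
    rw [IsLocallyConstant.iff_eventually_eq]
    intro t
    obtain ⟨W, m, hW, hyW, hm, hδ, hsm⟩ := hs t
    obtain ⟨N, hNW, hpN, ⟨X⟩⟩ := φ.exists_expansion hW hm hyW
    have hxm : ∀ᶠ t' in 𝓝 t, x t' = φ.inv m (y, exp (t' * I) * a) := by
      filter_upwards [hsm] with t' h'
      rw [φ.inv_of_ne _ _ (hne t'), ← h']
    have hconst : ∀ᶠ w in 𝓝 (exp (t * I) * a), φ.inv m (y, w) = φ.inv m (y, exp (t * I) * a) := by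
      obtain ⟨ε, hε, hεN⟩ := Metric.eventually_nhds_iff_ball.1
        ((X.eventually_mem hpN).and (isOpen_ne.mem_nhds (hne t)))
      have hd : ∀ w ∈ Metric.ball (exp (t * I) * a) ε,
          HasDerivAt (fun w => 𝒱.V.coordEquiv y (φ.inv m (y, w))) 0 w := by
        intro w hw
        obtain ⟨hwN, hw0⟩ := hεN w hw
        refine (X.hasDerivAt_inv hwN hw0 (𝒱.V.coordEquiv y).toLinearMap).congr_deriv ?_
        have h1 : φ.Φ (y, w) hw0 (∑ i, (X.δf i (y, w) * w ^ X.d i) • X.v i y) = 0 := by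
          rw [← hδ _ (hNW hwN), X.δ_eq hS (hm.mono hNW) _ hwN, X.sum_e hwN hw0]
        rw [LinearEquiv.map_eq_zero_iff] at h1
        rw [h1, map_zero, smul_zero]
      filter_upwards [Metric.ball_mem_nhds _ hε] with w hw
      exact (𝒱.V.coordEquiv y).injective (eqOn_ball_of_hasDerivAt_eq (f' := fun _ => 0) hd
        (fun w _ => hasDerivAt_const w _) rfl w hw)
    have hcont : Filter.Tendsto (fun t' : ℝ => exp (t' * I) * a) (𝓝 t)
        (𝓝 (exp (t * I) * a)) := by
      apply Continuous.tendsto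
      fun_prop
    filter_upwards [hxm, hcont.eventually hconst] with t' h1 h2
    rw [h1, h2, hxm.self_of_nhds]
  have h0 : x (2 * Real.pi) = x 0 := hx.apply_eq_of_preconnectedSpace _ _
  have hs' : ∀ t, s t = φ.Φ (y, exp (t * I) * a) (hne t) (x t) := fun t => by simp [x]
  rw [hs', hs', h0]
  exact mk_Φ_congr (by simp [exp_two_pi_mul_I]) _ _ _

end AnalytizationIso

end NaturalStructure
end

noncomputable section

/-! ### Horizontal sections of an integrable structure -/

section Horizontal

open Set Module HolBundle Metric

variable {Y : Type v} [TopologicalSpace Y] [ChartedSpace ℂ Y] [IsManifold 𝓘(ℂ, ℂ) ω Y]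
  {T : SmoothTriple.{u} Y} (S : IntegrableStructure T)

namespace IntegrableStructure

/-- The holomorphic section `m` on `W` is horizontal in the direction of `ħ`. -/
structure IsHorizontal (W : Set (Y × ℂ)) (m : ∀ p, T.E.fib p) : Prop where
  hol : T.E.Hol W m
  δ_eq_zero : ∀ p ∈ W, S.δ m p = 0

variable {S}

theorem IsHorizontal.mono {W W' : Set (Y × ℂ)} {m : ∀ p, T.E.fib p}
    (hm : S.IsHorizontal W m) (h : W' ⊆ W) : S.IsHorizontal W' m :=
  ⟨hm.hol.mono h, fun p hp => hm.δ_eq_zero p (h hp)⟩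

theorem IsHorizontal.congr {W : Set (Y × ℂ)} (hW : IsOpen W) {m n : ∀ p, T.E.fib p}
    (hm : S.IsHorizontal W m) (h : ∀ p ∈ W, n p = m p) : S.IsHorizontal W n :=
  ⟨hm.hol.congr h, fun p hp => by
    rw [S.δ_local W hW n m (hm.hol.congr h) hm.hol h p hp, hm.δ_eq_zero p hp]⟩

theorem isHorizontal_of_locally {W : Set (Y × ℂ)} {m : ∀ p, T.E.fib p}
    (h : ∀ p ∈ W, ∃ N, IsOpen N ∧ p ∈ N ∧ S.IsHorizontal N m) : S.IsHorizontal W m where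
  hol := hol_of_locally fun p hp => by
    obtain ⟨N, hN, hpN, hm⟩ := h p hp
    exact ⟨N, hN, hpN, hm.hol⟩
  δ_eq_zero p hp := by
    obtain ⟨N, hN, hpN, hm⟩ := h p hp
    exact hm.δ_eq_zero p hpN

theorem isHorizontal_sum {ι : Type*} [Fintype ι] {W : Set (Y × ℂ)} (hW : IsOpen W) {U : Set Y}
    (hWU : ∀ p ∈ W, p.1 ∈ U) {c : ι → Y → ℂ} {m : ι → ∀ p, T.E.fib p}
    (hc : ∀ i, ContMDiffOn 𝓘(ℂ, ℂ) 𝓘(ℂ, ℂ) ω (c i) U) (hm : ∀ i, S.IsHorizontal W (m i)) :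
    S.IsHorizontal W fun p => ∑ i, c i p.1 • m i p := by
  have h1 : ∀ i, ContMDiffOn modelYΩ 𝓘(ℂ, ℂ) ω (fun p : Y × ℂ => c i p.1) W := fun i =>
    (hc i).comp contMDiffOn_fst hWU
  refine ⟨Hol.sum fun i _ => Hol.smul (h1 i) (hm i).hol, fun p hp => ?_⟩
  rw [S.δ_sum_smul hW h1 (fun i => (hm i).hol) hp]
  refine Finset.sum_eq_zero fun i _ => ?_
  simp [(hm i).δ_eq_zero p hp, dħ]

/-- The coordinates of a horizontal section in a horizontal frame are locally constant in the
direction of `ħ`. -/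
theorem IsHorizontal.eventually_coeff_eq {N W : Set (Y × ℂ)} (hN : IsOpen N) (hW : IsOpen W)
    {v : Fin T.rank → ∀ p, T.E.fib p} (hv : T.E.IsFrame N v) (hδ : ∀ j, S.IsHorizontal N (v j))
    {m : ∀ p, T.E.fib p} (hm : S.IsHorizontal W m) {y : Y} {z : ℂ} (hz : z ≠ 0)
    (hpN : (y, z) ∈ N) (hpW : (y, z) ∈ W) (j : Fin T.rank) :
    ∀ᶠ w in 𝓝 z, hv.coeff j (y, w) (m (y, w)) = hv.coeff j (y, z) (m (y, z)) := by
  have ho := hN.inter hW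
  have hc : ∀ j, ContMDiffOn modelYΩ 𝓘(ℂ, ℂ) ω (fun p => hv.coeff j p (m p)) (N ∩ W) :=
    HolBundle.IsFrame.contMDiffOn_coeff ho inter_subset_left hv (hm.hol.mono inter_subset_right)
  have hd : ∀ p ∈ N ∩ W, p.2 ≠ 0 → ∀ j, dħ (fun p => hv.coeff j p (m p)) p = 0 := by
    intro p hp hp0 j
    have h1 : ∀ q ∈ N ∩ W, m q = ∑ j, hv.coeff j q (m q) • v j q := fun q hq =>
      HolBundle.IsFrame.sum_coeff hv hq.1 _
    have hh : ∀ j, T.E.Hol (N ∩ W) (v j) := fun j => (hδ j).hol.mono inter_subset_left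
    have h2 := S.δ_local _ ho _ _ (hm.hol.mono inter_subset_right)
      (Hol.sum fun j _ => Hol.smul (hc j) (hh j)) h1 p hp
    rw [hm.δ_eq_zero p hp.2, S.δ_sum_smul ho hc hh hp] at h2
    have h3 : (0 : T.E.fib p) =
        ∑ j, (p.2 ^ 2 * dħ (fun p => hv.coeff j p (m p)) p) • v j p := by
      rw [h2]
      refine Finset.sum_congr rfl fun j _ => ?_
      rw [(hδ j).δ_eq_zero p hp.1, smul_zero, zero_add]
    have h4 := HolBundle.IsFrame.coeff_eq_of_sum hv hp.1 h3 j
    rw [map_zero] at h4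
    exact (mul_eq_zero.1 h4.symm).resolve_left (pow_ne_zero 2 hp0)
  have h1 : ∀ᶠ w in 𝓝 z, (y, w) ∈ N ∩ W ∧ w ≠ 0 :=
    (((Continuous.prodMk_right y).tendsto z).eventually (ho.mem_nhds ⟨hpN, hpW⟩)).and
      (isOpen_ne.mem_nhds hz)
  obtain ⟨ε, hε, hεN⟩ := Metric.eventually_nhds_iff_ball.1 h1
  filter_upwards [ball_mem_nhds z hε] with w hw
  refine eqOn_ball_of_hasDerivAt_eq (f' := fun _ => 0)
    (f := fun w => hv.coeff j (y, w) (m (y, w))) (fun w hw => ?_)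
    (fun w _ => hasDerivAt_const w _) rfl w hw
  obtain ⟨h3, h4⟩ := hεN w hw
  have h5 := (((hc j).contMDiffAt (ho.mem_nhds h3)).differentiableAt_slice).hasDerivAt
  exact h5.congr_deriv (hd _ h3 h4 j)

variable (S)

/-- Local existence of horizontal frames. -/
theorem exists_horizontal_frame {p₀ : Y × ℂ} (hp₀ : p₀.2 ≠ 0) :
    ∃ (U : Set Y) (ρ : ℝ) (v : Fin T.rank → ∀ p, T.E.fib p), IsOpen U ∧ p₀.1 ∈ U ∧ 0 < ρ ∧
      (∀ w ∈ ball p₀.2 ρ, w ≠ 0) ∧ T.E.IsFrame (U ×ˢ ball p₀.2 ρ) v ∧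
      ∀ j, S.IsHorizontal (U ×ˢ ball p₀.2 ρ) (v j) := by
  obtain ⟨N₀, e, hN₀, hpN₀, he⟩ := T.E.exists_isFrame p₀
  let N : Set (Y × ℂ) := N₀ ∩ {p | p.2 ≠ 0}
  have hN : IsOpen N := hN₀.inter (isOpen_ne_fun continuous_snd continuous_const)
  have hee : ∀ k, T.E.Hol N (e k) := fun k => (he.contMDiffOn k).mono inter_subset_left
  -- The matrix of -ħ⁻²δ in the frame `e`: a combination Σ x_k e_k is killed by δ exactly when its
  -- coefficients solve x' = A x. The columns of the fundamental solution give the horizontal frame.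
  let a : Fin T.rank → Fin T.rank → Y × ℂ → ℂ := fun j k p =>
    -(p.2 ^ 2)⁻¹ * he.coeff j p (S.δ (e k) p)
  let L : Fin T.rank → Fin T.rank → ((Fin T.rank → ℂ) →L[ℂ] (Fin T.rank → ℂ)) := fun j k =>
    (ContinuousLinearMap.proj (R := ℂ) (φ := fun _ : Fin T.rank => ℂ) k).smulRight
      (Pi.single j (1 : ℂ))
  let A : Y × ℂ → ((Fin T.rank → ℂ) →L[ℂ] (Fin T.rank → ℂ)) := fun p =>
    ∑ j, ∑ k, a j k p • L j k
  have hA' : ∀ p x j, A p x j = ∑ k, a j k p * x k := by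
    intro p x j
    simp [A, L, Finset.sum_apply, Pi.single_apply]
  have ha : ∀ j k, ContMDiffOn modelYΩ 𝓘(ℂ, ℂ) ω (a j k) N := fun j k => by
    have h1 : ContMDiffOn modelYΩ 𝓘(ℂ, ℂ) ω (fun p : Y × ℂ => -(p.2 ^ 2)⁻¹) N := by
      intro p hp
      have h2 : ContDiffAt ℂ ω (fun w : ℂ => -(w ^ 2)⁻¹) p.2 :=
        ((contDiffAt_id.pow 2).inv (pow_ne_zero 2 hp.2)).neg
      exact (h2.contMDiffAt.comp p contMDiffAt_snd).contMDiffWithinAt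
    exact h1.mul (HolBundle.IsFrame.contMDiffOn_coeff hN inter_subset_left he
      (S.δ_hol N hN _ (hee k)) j)
  have hA : ContMDiffOn modelYΩ 𝓘(ℂ, (Fin T.rank → ℂ) →L[ℂ] (Fin T.rank → ℂ)) ω A N := by
    refine contMDiffOn_finsetSum fun j _ => contMDiffOn_finsetSum fun k _ => ?_
    exact (ha j k).smul contMDiffOn_const
  obtain ⟨U, ρ, X, hU, hpU, hρ, hsub, hX, hXd, hXu⟩ := exists_fundamental_solution_manifold
    ContinuousLinearMap.norm_id_le hN ⟨hpN₀, hp₀⟩ hA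
  have ho : IsOpen (U ×ˢ ball p₀.2 ρ) := hU.prod isOpen_ball
  let x : Fin T.rank → Fin T.rank → Y × ℂ → ℂ := fun l k p => X p (Pi.single l 1) k
  have hx : ∀ l k, ContMDiffOn modelYΩ 𝓘(ℂ, ℂ) ω (x l k) (U ×ˢ ball p₀.2 ρ) := by
    intro l k
    exact (ContinuousLinearMap.contMDiff ((ContinuousLinearMap.proj (R := ℂ)
      (φ := fun _ : Fin T.rank => ℂ) k).comp (ContinuousLinearMap.apply ℂ (Fin T.rank → ℂ)
        (Pi.single l (1 : ℂ) : Fin T.rank → ℂ)))).comp_contMDiffOn hX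
  have hxd : ∀ l k, ∀ p ∈ U ×ˢ ball p₀.2 ρ, dħ (x l k) p = ∑ i, a k i p * x l i p := by
    rintro l k ⟨y, w⟩ ⟨hy, hw⟩
    have h1 := ((ContinuousLinearMap.proj (R := ℂ)
      (φ := fun _ : Fin T.rank => ℂ) k).comp (ContinuousLinearMap.apply ℂ (Fin T.rank → ℂ)
        (Pi.single l (1 : ℂ) : Fin T.rank → ℂ))).hasFDerivAt.comp_hasDerivAt w (hXd y hy w hw)
    refine HasDerivAt.deriv (h1.congr_deriv ?_)
    exact hA' (y, w) (X (y, w) (Pi.single l 1)) k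
  have heU : ∀ k, T.E.Hol (U ×ˢ ball p₀.2 ρ) (e k) := fun k => (hee k).mono hsub
  refine ⟨U, ρ, fun l p => ∑ k, x l k p • e k p, hU, hpU, hρ,
    fun w hw => (hsub (mk_mem_prod hpU hw)).2, ?_, fun l => ⟨?_, ?_⟩⟩
  · refine isFrame_of_linearIndependent
      (fun l => Hol.sum fun k _ => Hol.smul (hx l k) (heU k)) fun p hp => ?_
    rw [Fintype.linearIndependent_iff]
    intro c hc
    have h1 : ∀ k, X p c k = ∑ l, c l * x l k p := by
      intro k
      conv_lhs => rw [pi_eq_sum_univ' c]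
      simp [x, Finset.sum_apply]
    have h2 : ∑ k, X p c k • e k p = 0 := by
      rw [← hc]
      simp only [h1, Finset.sum_smul, Finset.smul_sum, smul_smul]
      exact Finset.sum_comm
    have h3 := Fintype.linearIndependent_iff.1 (he.linearIndependent (hsub hp).1) _ h2
    have h4 : X p c = X p 0 := by
      rw [map_zero]; exact funext h3
    have h5 := ((ContinuousLinearMap.isUnit_iff_bijective).1 (hXu p.1 hp.1 p.2 hp.2)).1 h4
    exact fun i => congrFun h5 i
  · exact Hol.sum fun k _ => Hol.smul (hx l k) (heU k)
  · intro p hp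
    have hp2 : p.2 ≠ 0 := (hsub hp).2
    rw [S.δ_sum_smul ho (hx l) heU hp]
    have h1 : ∀ k, S.δ (e k) p = ∑ j, he.coeff j p (S.δ (e k) p) • e j p := fun k =>
      HolBundle.IsFrame.sum_coeff he (hsub hp).1 _
    rw [Finset.sum_add_distrib]
    have h2 : ∑ k, x l k p • S.δ (e k) p =
        ∑ j, (∑ k, x l k p * he.coeff j p (S.δ (e k) p)) • e j p := by
      simp only [Finset.sum_smul]
      rw [Finset.sum_comm]
      refine Finset.sum_congr rfl fun k _ => ?_
      conv_lhs => rw [h1 k]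
      rw [Finset.smul_sum]
      simp only [smul_smul]
    rw [h2, ← Finset.sum_add_distrib]
    refine Finset.sum_eq_zero fun j _ => ?_
    rw [← add_smul, hxd l j p hp, Finset.mul_sum, ← Finset.sum_add_distrib]
    convert zero_smul ℂ _
    refine Finset.sum_eq_zero fun k _ => ?_
    simp only [a]
    field_simp
    ring

end IntegrableStructure

end Horizontal
end

noncomputable section

/-! ### Parallel transport in the direction of `ħ` -/

section ParallelTransport

open Set Module HolBundle Metric

variable {Y : Type v} [TopologicalSpace Y] [ChartedSpace ℂ Y] [IsManifold 𝓘(ℂ, ℂ) ω Y]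
  {T : SmoothTriple.{u} Y} {S : IntegrableStructure T}

namespace IntegrableStructure

/-- Both sections have locally constant coordinates in a common horizontal frame, so agreement and
disagreement at a point both persist nearby. -/
theorem IsHorizontal.eventually_eq_iff {W W' : Set (Y × ℂ)} (hW : IsOpen W) (hW' : IsOpen W')
    {m m' : ∀ p, T.E.fib p} (hm : S.IsHorizontal W m) (hm' : S.IsHorizontal W' m') {y : Y} {z : ℂ}
    (hz : z ≠ 0) (hp : (y, z) ∈ W) (hp' : (y, z) ∈ W') :
    ∀ᶠ w in 𝓝 z, (m (y, w) = m' (y, w) ↔ m (y, z) = m' (y, z)) := by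
  obtain ⟨U, ρ, v, hU, hyU, hρ, h0, hv, hδ⟩ := S.exists_horizontal_frame (p₀ := (y, z)) hz
  have hN : IsOpen (U ×ˢ ball z ρ) := hU.prod isOpen_ball
  have hpN : (y, z) ∈ U ×ˢ ball z ρ := mk_mem_prod hyU (mem_ball_self hρ)
  have h1 := Filter.eventually_all.2 fun j => hm.eventually_coeff_eq hN hW hv hδ hz hpN hp j
  have h2 := Filter.eventually_all.2 fun j => hm'.eventually_coeff_eq hN hW' hv hδ hz hpN hp' j
  have h3 : ∀ w ∈ ball z ρ, ∀ a b : T.E.fib (y, w),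
      a = b ↔ ∀ j, hv.coeff j (y, w) a = hv.coeff j (y, w) b := fun w hw a b =>
    ⟨fun h j => by rw [h], fun h => by
      rw [HolBundle.IsFrame.sum_coeff hv (mk_mem_prod hyU hw) a,
        HolBundle.IsFrame.sum_coeff hv (mk_mem_prod hyU hw) b]
      simp only [h]⟩
  filter_upwards [h1, h2, ball_mem_nhds z hρ] with w e1 e2 hw
  rw [h3 w hw, h3 z (mem_ball_self hρ)]
  simp only [e1, e2]

variable (S) in
theorem exists_horizontal_through {y : Y} {z : ℂ} (hz : z ≠ 0) (x : T.E.fib (y, z)) :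
    ∃ W m, IsOpen W ∧ (y, z) ∈ W ∧ S.IsHorizontal W m ∧ m (y, z) = x := by
  obtain ⟨U, ρ, v, hU, hyU, hρ, h0, hv, hδ⟩ := S.exists_horizontal_frame (p₀ := (y, z)) hz
  have hN : IsOpen (U ×ˢ ball z ρ) := hU.prod isOpen_ball
  have hpN : (y, z) ∈ U ×ˢ ball z ρ := mk_mem_prod hyU (mem_ball_self hρ)
  exact ⟨_, _, hN, hpN, isHorizontal_sum hN (fun p hp => hp.1)
    (c := fun j _ => hv.coeff j (y, z) x) (fun j => contMDiffOn_const) hδ,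
    (HolBundle.IsFrame.sum_coeff hv hpN x).symm⟩

variable (S) in
/-- The section `g` over `{y} × ℂ` is flat away from `ħ = 0`. -/
def IsFlatAlong (y : Y) (g : ∀ z : ℂ, T.E.fib (y, z)) : Prop :=
  ∀ z : ℂ, z ≠ 0 → ∃ W m, IsOpen W ∧ (y, z) ∈ W ∧ S.IsHorizontal W m ∧
    ∀ᶠ w in 𝓝 z, g w = m (y, w)

theorem preconnectedSpace_punctured : PreconnectedSpace {z : ℂ // z ≠ 0} := by
  have h : IsPreconnected ({0}ᶜ : Set ℂ) :=
    (isConnected_compl_singleton_of_one_lt_rank (by simp) 0).isPreconnected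
  exact isPreconnected_iff_preconnectedSpace.1 h

/-- Uniqueness of continuation: agreement is a locally constant proposition on the connected
punctured plane. -/
theorem IsFlatAlong.eq {y : Y} {g g' : ∀ z : ℂ, T.E.fib (y, z)} (hg : S.IsFlatAlong y g)
    (hg' : S.IsFlatAlong y g') {a : ℂ} (ha : a ≠ 0) (h : g a = g' a) {z : ℂ} (hz : z ≠ 0) :
    g z = g' z := by
  have := preconnectedSpace_punctured
  have hl : IsLocallyConstant fun z : {z : ℂ // z ≠ 0} => g z = g' z := by
    rw [IsLocallyConstant.iff_eventually_eq]
    rintro ⟨z, hz⟩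
    obtain ⟨W, m, hW, hp, hm, hgm⟩ := hg z hz
    obtain ⟨W', m', hW', hp', hm', hgm'⟩ := hg' z hz
    have h1 := hm.eventually_eq_iff hW hW' hm' hz hp hp'
    have h2 : ∀ᶠ w in 𝓝 z, (g w = g' w) = (g z = g' z) := by
      filter_upwards [h1, hgm, hgm'] with w e1 e2 e3
      rw [e2, e3, e1, hgm.self_of_nhds, hgm'.self_of_nhds]
    exact (continuous_subtype_val.tendsto (⟨z, hz⟩ : {z : ℂ // z ≠ 0})).eventually h2
  have := hl.apply_eq_of_preconnectedSpace ⟨a, ha⟩ ⟨z, hz⟩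
  exact this.mp h

/-- The étale space of the sheaf of horizontal sections over `{y} × (ℂ ∖ {0})`. -/
structure HorizontalGerm (S : IntegrableStructure T) (y : Y) where
  base : {z : ℂ // z ≠ 0}
  val : T.E.fib (y, (base : ℂ))

namespace HorizontalGerm

/-- The finest topology for which all local horizontal sections are continuous. -/
instance (y : Y) : TopologicalSpace (S.HorizontalGerm y) where
  IsOpen A := ∀ x ∈ A, ∀ W m, IsOpen W → (y, (x.base : ℂ)) ∈ W → S.IsHorizontal W m →
    m (y, (x.base : ℂ)) = x.val → ∀ᶠ b : {z : ℂ // z ≠ 0} in 𝓝 x.base,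
      (⟨b, m (y, (b : ℂ))⟩ : S.HorizontalGerm y) ∈ A
  isOpen_univ _ _ _ _ _ _ _ _ := Filter.Eventually.of_forall fun _ => mem_univ _
  isOpen_inter A B hA hB x hx W m hW hp hm h :=
    (hA x hx.1 W m hW hp hm h).and (hB x hx.2 W m hW hp hm h)
  isOpen_sUnion s hs x hx W m hW hp hm h := by
    obtain ⟨A, hA, hxA⟩ := hx
    exact (hs A hA x hxA W m hW hp hm h).mono fun b hb => ⟨A, hA, hb⟩

variable {y : Y}

theorem isOpen_iff {A : Set (S.HorizontalGerm y)} : IsOpen A ↔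
    ∀ x ∈ A, ∀ W m, IsOpen W → (y, (x.base : ℂ)) ∈ W → S.IsHorizontal W m →
    m (y, (x.base : ℂ)) = x.val → ∀ᶠ b : {z : ℂ // z ≠ 0} in 𝓝 x.base,
      (⟨b, m (y, (b : ℂ))⟩ : S.HorizontalGerm y) ∈ A := Iff.rfl

theorem continuous_base : Continuous (base : S.HorizontalGerm y → {z : ℂ // z ≠ 0}) := by
  refine continuous_def.2 fun O hO => isOpen_iff.2 fun x hx W m _ _ _ _ => ?_
  exact hO.mem_nhds hx

theorem exists_eq {x : S.HorizontalGerm y} {b : {z : ℂ // z ≠ 0}} (h : x.base = b) :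
    ∃ v, x = ⟨b, v⟩ := by
  subst h; exact ⟨x.val, rfl⟩

theorem isOpen_section {W : Set (Y × ℂ)} (hW : IsOpen W) {m : ∀ p, T.E.fib p}
    (hm : S.IsHorizontal W m) :
    IsOpen {x : S.HorizontalGerm y | (y, (x.base : ℂ)) ∈ W ∧ m (y, (x.base : ℂ)) = x.val} := by
  refine isOpen_iff.2 ?_
  rintro ⟨⟨z, hz⟩, x⟩ ⟨hp, hmx⟩ W' m' hW' hp' hm' hmx'
  have h1 := hm.eventually_eq_iff hW hW' hm' hz hp hp'
  have h2 : ∀ᶠ w in 𝓝 z, (y, w) ∈ W :=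
    ((Continuous.prodMk_right y).tendsto z).eventually (hW.mem_nhds hp)
  have h3 := continuous_subtype_val.continuousAt (x := (⟨z, hz⟩ : {z : ℂ // z ≠ 0}))
  filter_upwards [h3.eventually h1, h3.eventually h2] with b e1 e2
  exact ⟨e2, e1.2 (hmx.trans hmx'.symm)⟩

/-- Vectors of constants. -/
def Constants (r : ℕ) := Fin r → ℂ

/-- The synonym `Constants` exists to carry the discrete topology, since the fibres of a covering
are discrete, without meeting the product topology of ℂ^r. -/
instance (r : ℕ) : TopologicalSpace (Constants r) := ⊥

instance (r : ℕ) : DiscreteTopology (Constants r) := ⟨rfl⟩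

/-- A horizontal frame over a disc trivializes the germs: a germ is a base point together with its
vector of coordinates, and these are locally constant along horizontal sections. -/
theorem isCoveringMap_base :
    IsCoveringMap (base : S.HorizontalGerm y → {z : ℂ // z ≠ 0}) := by
  rintro ⟨z, hz⟩
  obtain ⟨U, ρ, v, hU, hyU, hρ, h0, hv, hδ⟩ := S.exists_horizontal_frame (p₀ := (y, z)) hz
  have hN : IsOpen (U ×ˢ ball z ρ) := hU.prod isOpen_ball
  let B : Set {z : ℂ // z ≠ 0} := {b | (b : ℂ) ∈ ball z ρ}
  have hB : IsOpen B := isOpen_ball.preimage continuous_subtype_val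
  refine IsEvenlyCovered.to_isEvenlyCovered_preimage (I := Constants T.rank)
    ⟨inferInstance, B, mem_ball_self hρ, hB, hB.preimage continuous_base,
    { toFun := fun x => (⟨x.1.base, x.2⟩, fun j => hv.coeff j (y, (x.1.base : ℂ)) x.1.val)
      invFun := fun q => ⟨⟨q.1.1, ∑ j, q.2 j • v j (y, (q.1.1 : ℂ))⟩, q.1.2⟩
      left_inv := ?_
      right_inv := ?_
      continuous_toFun := ?_
      continuous_invFun := ?_ }, fun x => rfl⟩
  · rintro ⟨⟨b, x⟩, hb⟩
    have := HolBundle.IsFrame.sum_coeff hv (mk_mem_prod hyU hb) x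
    exact Subtype.ext (congrArg (HorizontalGerm.mk b) this.symm)
  · rintro ⟨⟨b, hb⟩, c⟩
    refine Prod.ext rfl (funext fun j => ?_)
    exact HolBundle.IsFrame.coeff_eq_of_sum hv (mk_mem_prod hyU hb) rfl j
  · refine Continuous.prodMk ((continuous_base.comp continuous_subtype_val).subtype_mk _)
      (continuous_discrete_rng.2 fun c => ?_)
    have ho : IsOpen {x : S.HorizontalGerm y | x.base ∈ B ∧
        ∀ j, hv.coeff j (y, (x.base : ℂ)) x.val = c j} := by
      refine isOpen_iff.2 ?_
      rintro ⟨⟨z', hz'⟩, x⟩ ⟨hx, hxc⟩ W m hW hp hm hmx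
      have h1 := Filter.eventually_all.2 fun j =>
        hm.eventually_coeff_eq hN hW hv hδ hz' (mk_mem_prod hyU hx) hp j
      have h3 := continuous_subtype_val.continuousAt (x := (⟨z', hz'⟩ : {z : ℂ // z ≠ 0}))
      filter_upwards [h3.eventually h1, hB.mem_nhds hx] with b e1 e2
      refine ⟨e2, fun j => (e1 j).trans ?_⟩
      rw [← hxc j]
      exact congrArg _ hmx
    convert ho.preimage continuous_subtype_val using 1
    ext ⟨x, hx⟩
    exact ⟨fun h => ⟨hx, fun j => congrFun h j⟩, fun h => funext h.2⟩
  · refine Continuous.subtype_mk (continuous_def.2 fun A hA => isOpen_iff_mem_nhds.2 ?_) _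
    rintro ⟨⟨⟨w, hw⟩, hb⟩, c⟩ hbc
    have h1 := isOpen_iff.1 hA _ hbc _ (fun p => ∑ j, c j • v j p) hN (mk_mem_prod hyU hb)
      (isHorizontal_sum hN (fun p hp => hp.1) (c := fun j _ => c j)
        (fun j => contMDiffOn_const) hδ) rfl
    have h2 : ∀ᶠ b : B in 𝓝 ⟨⟨w, hw⟩, hb⟩,
        (⟨b.1, ∑ j, c j • v j (y, (b.1 : ℂ))⟩ : S.HorizontalGerm y) ∈ A :=
      (continuous_subtype_val.tendsto (⟨⟨w, hw⟩, hb⟩ : B)).eventually h1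
    have h3 : ∀ᶠ c' : Constants T.rank in 𝓝 c, c' = c := by simp [nhds_discrete]
    rw [nhds_prod_eq]
    filter_upwards [h2.prod_mk h3] with q hq
    obtain ⟨h4, h5⟩ := hq
    rw [mem_preimage, h5]
    exact h4

theorem eq_of_mk_eq {x x' : S.HorizontalGerm y}
    (h : TotalSpace.mk' (Fin T.rank → ℂ) (y, (x.base : ℂ)) x.val =
      TotalSpace.mk' (Fin T.rank → ℂ) (y, (x'.base : ℂ)) x'.val) : x = x' := by
  obtain ⟨⟨z, hz⟩, x⟩ := x
  obtain ⟨⟨z', hz'⟩, x'⟩ := x'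
  have h1 : z = z' := congrArg (fun t => t.proj.2) h
  subst h1
  have h2 : x = x' := by
    rw [TotalSpace.mk_inj] at h
    exact h
  rw [h2]

end HorizontalGerm

/-- Parallel transport along `{y} × (ℂ ∖ {0})` when the monodromy is trivial. -/
theorem TrivialMonodromy.exists_isFlatAlong (hS : S.TrivialMonodromy) {y : Y} {a : ℂ} (ha : a ≠ 0)
    (x : T.E.fib (y, a)) : ∃ g, S.IsFlatAlong y g ∧ g a = x := by
  have hne : ∀ ζ : ℂ, exp (ζ * I) * a ≠ 0 := fun ζ => mul_ne_zero (exp_ne_zero _) ha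
  -- The universal covering of the punctured plane, based at `a`. It lifts to the space of germs
  -- because ℂ is simply connected, and on real ζ the lift is a parallel section along the loop of
  -- `TrivialMonodromy`.
  let γ : C(ℂ, {z : ℂ // z ≠ 0}) := ⟨fun ζ => ⟨exp (ζ * I) * a, hne ζ⟩, by fun_prop⟩
  have hγ : ∀ ζ : ℂ, γ ζ = ⟨exp (ζ * I) * a, hne ζ⟩ := fun _ => rfl
  have hγ0 : γ 0 = ⟨a, ha⟩ := Subtype.ext (by simp [hγ])
  have hcov := HorizontalGerm.isCoveringMap_base (S := S) (y := y)
  obtain ⟨F, ⟨hF0, hF⟩, -⟩ := hcov.existsUnique_continuousMap_lifts γ 0 ⟨⟨a, ha⟩, x⟩ hγ0.symm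
  have hFb : ∀ ζ, (F ζ).base = γ ζ := congrFun hF
  choose s hs using fun ζ => HorizontalGerm.exists_eq (hFb ζ)
  have hpar : ∀ ζ : ℂ, ∀ W m, IsOpen W → (y, exp (ζ * I) * a) ∈ W → S.IsHorizontal W m →
      m (y, exp (ζ * I) * a) = s ζ →
      ∀ᶠ ζ' in 𝓝 ζ, m (y, exp (ζ' * I) * a) = s ζ' := by
    intro ζ W m hW hp hm hms
    have h1 := (HorizontalGerm.isOpen_section (y := y) hW hm).preimage F.continuous
    have h2 : ζ ∈ F ⁻¹' {x : S.HorizontalGerm y |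
        (y, (x.base : ℂ)) ∈ W ∧ m (y, (x.base : ℂ)) = x.val} := by
      rw [mem_preimage, hs]
      exact ⟨hp, hms⟩
    filter_upwards [h1.mem_nhds h2] with ζ' h3
    rw [mem_preimage, hs] at h3
    exact h3.2
  have hper : F (2 * Real.pi) = F 0 := by
    have h1 : S.IsParallel y a fun t => s t := by
      intro t
      obtain ⟨W, m, hW, hp, hm, hms⟩ := S.exists_horizontal_through (hne t) (s t)
      refine ⟨W, m, hW, hp, hm.hol, hm.δ_eq_zero, ?_⟩
      have := continuous_ofReal.continuousAt.eventually (hpar t W m hW hp hm hms)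
      exact this.mono fun t' h' => h'.symm
    have h2 := hS y a ha _ h1
    have h3 : F ((2 * Real.pi : ℝ) : ℂ) = F ((0 : ℝ) : ℂ) := by
      rw [hs, hs]
      exact HorizontalGerm.eq_of_mk_eq h2
    simpa using h3
  -- Trivial monodromy gives equality at the single point 0; uniqueness of lifts turns it into
  -- periodicity. The lift therefore depends only on the point of ℂ ∖ {0} below ζ.
  have hperiod : Function.Periodic F (2 * Real.pi) := by
    have h1 : γ.comp ⟨fun ζ => ζ + 2 * Real.pi, by fun_prop⟩ = γ := by
      ext ζ
      simp [hγ, add_mul, exp_add, exp_two_pi_mul_I]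
    have h2 := hcov.eq_of_comp_eq (g₁ := fun ζ => F (ζ + 2 * Real.pi)) (g₂ := F) (by fun_prop)
      F.continuous (by
        funext ζ
        simp only [Function.comp, hFb]
        exact congrArg (fun f : C(ℂ, {z : ℂ // z ≠ 0}) => f ζ) h1) 0 (by simpa using hper)
    exact congrFun h2
  have hex : ∀ z : ℂ, ∃ x : T.E.fib (y, z), ∀ hz : z ≠ 0, ∀ ζ, γ ζ = ⟨z, hz⟩ →
      F ζ = ⟨⟨z, hz⟩, x⟩ := by
    intro z
    by_cases hz : z = 0
    · exact ⟨0, fun h => absurd hz h⟩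
    have h0 : γ (log (z / a) / I) = ⟨z, hz⟩ := by
      refine Subtype.ext ?_
      simp only [hγ]
      rw [div_mul_cancel₀ _ I_ne_zero, exp_log (div_ne_zero hz ha), div_mul_cancel₀ _ ha]
    obtain ⟨x, hx⟩ := HorizontalGerm.exists_eq ((hFb _).trans h0)
    refine ⟨x, fun hz' ζ hζ => ?_⟩
    rw [← hx]
    have h1 : exp (ζ * I) = exp (log (z / a) / I * I) :=
      mul_right_cancel₀ ha (congrArg Subtype.val (hζ.trans h0.symm))
    obtain ⟨n, hn⟩ := exp_eq_exp_iff_exists_int.1 h1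
    have h2 : ζ = log (z / a) / I + n * (2 * Real.pi) := by
      refine mul_right_cancel₀ I_ne_zero ?_
      rw [hn]; ring
    rw [h2]
    exact hperiod.int_mul n _
  choose g hg using hex
  refine ⟨g, fun z hz => ?_, ?_⟩
  · obtain ⟨W, m, hW, hp, hm, hmg⟩ := S.exists_horizontal_through hz (g z)
    refine ⟨W, m, hW, hp, hm, ?_⟩
    obtain ⟨ζ, hζ⟩ : ∃ ζ, γ ζ = ⟨z, hz⟩ := by
      refine ⟨log (z / a) / I, Subtype.ext ?_⟩
      simp only [hγ]
      rw [div_mul_cancel₀ _ I_ne_zero, exp_log (div_ne_zero hz ha), div_mul_cancel₀ _ ha]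
    have hz' : exp (ζ * I) * a = z := congrArg Subtype.val hζ
    have h1 := (HorizontalGerm.isOpen_section (y := y) hW hm).preimage F.continuous
    have h2 : ζ ∈ F ⁻¹' {x : S.HorizontalGerm y |
        (y, (x.base : ℂ)) ∈ W ∧ m (y, (x.base : ℂ)) = x.val} := by
      rw [mem_preimage, hg z hz ζ hζ]
      exact ⟨hp, hmg⟩
    -- The covering has non-zero derivative, so neighbourhoods of ζ map onto neighbourhoods of z and
    -- local flatness descends from the lift to `g`.
    have hd : HasStrictDerivAt (fun ζ : ℂ => exp (ζ * I) * a) (exp (ζ * I) * I * a) ζ := by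
      simpa using ((((hasStrictDerivAt_id ζ).mul_const I).cexp).mul_const a)
    have h3 := hd.map_nhds_eq (mul_ne_zero (mul_ne_zero (exp_ne_zero _) I_ne_zero) ha)
    have h4 := Filter.image_mem_map (m := fun ζ : ℂ => exp (ζ * I) * a) (h1.mem_nhds h2)
    rw [h3, hz'] at h4
    filter_upwards [h4, isOpen_ne.mem_nhds hz] with w hw hw0
    obtain ⟨ζ', h5, h6⟩ := hw
    rw [mem_preimage, hg w hw0 ζ' (Subtype.ext h6)] at h5
    exact h5.2.symm
  · have h1 := (hg a ha 0 hγ0).symm.trans hF0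
    have h2 := congrArg (fun q : S.HorizontalGerm y =>
      TotalSpace.mk' (Fin T.rank → ℂ) (y, (q.base : ℂ)) q.val) h1
    exact (TotalSpace.mk_inj).1 h2

end IntegrableStructure

end ParallelTransport
end

noncomputable section

/-! ### Restriction of bundles to a slice and extension of sections by parallel transport -/

section Restriction

open Set Module

variable {Y : Type v} [TopologicalSpace Y] [ChartedSpace ℂ Y] [IsManifold 𝓘(ℂ, ℂ) ω Y]

/-- The inclusion of `Y × {c}`. -/
def sliceMap (Y : Type v) [TopologicalSpace Y] [ChartedSpace ℂ Y] (c : ℂ) :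
    ContMDiffMap 𝓘(ℂ, ℂ) modelYΩ Y (Y × ℂ) ω :=
  ⟨fun y => (y, c), contMDiff_id.prodMk contMDiff_const⟩

namespace HolBundle

variable {r : ℕ}

/-- The restriction of a bundle on `Y × ℂ` to `Y × {c}`. -/
def slice (E : HolBundle.{u} modelYΩ (Y × ℂ) r) (c : ℂ) : HolBundle.{u} 𝓘(ℂ, ℂ) Y r where
  fib := sliceMap Y c *ᵖ E.fib
  fibTop := inferInstance
  fibGroup y := E.fibGroup (y, c)
  fibModule y := E.fibModule (y, c)
  totalTop := inferInstance
  fiberBundle := FiberBundle.pullback (sliceMap Y c)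
  vectorBundle := VectorBundle.pullback _ (sliceMap Y c)
  holomorphic := ContMDiffVectorBundle.pullback (Fin r → ℂ) E.fib 𝓘(ℂ, ℂ) (sliceMap Y c)

variable {E : HolBundle.{u} modelYΩ (Y × ℂ) r} {c : ℂ}

theorem Hol.slice {W : Set (Y × ℂ)} (hW : IsOpen W) {m : ∀ p, E.fib p} (hm : E.Hol W m) :
    (E.slice c).Hol {y | (y, c) ∈ W} fun y => m (y, c) := by
  refine hol_of_locally fun y₀ hy₀ => ?_
  have ho : IsOpen (W ∩ E.base (y₀, c)) :=
    hW.inter (trivializationAt (Fin r → ℂ) E.fib (y₀, c)).open_baseSet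
  have ho' : IsOpen {y | (y, c) ∈ W ∩ E.base (y₀, c)} := ho.preimage (Continuous.prodMk_left c)
  refine ⟨_, ho', ⟨hy₀, FiberBundle.mem_baseSet_trivializationAt' _⟩, ?_⟩
  refine (hol_iff_coord (E := E.slice c) y₀ ho' (fun y hy => hy.2)).2 ?_
  have h1 := (hol_iff_coord (y₀, c) ho inter_subset_right).1 (hm.mono inter_subset_left)
  exact h1.comp (sliceMap Y c).contMDiff.contMDiffOn fun y hy => hy

theorem IsFrame.slice {N : Set (Y × ℂ)} (hN : IsOpen N) {e : Fin r → ∀ p, E.fib p}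
    (he : E.IsFrame N e) : (E.slice c).IsFrame {y | (y, c) ∈ N} fun j y => e j (y, c) :=
  isFrame_of_linearIndependent (fun j => Hol.slice hN (he.contMDiffOn j))
    fun _ hy => he.linearIndependent hy

theorem IsFrame.contMDiffOn_slice_coeff {N : Set (Y × ℂ)} (hN : IsOpen N)
    {e : Fin r → ∀ p, E.fib p} (he : E.IsFrame N e) {U : Set Y} (hU : IsOpen U)
    (hUN : ∀ y ∈ U, (y, c) ∈ N) {v : ∀ y, (E.slice c).fib y} (hv : (E.slice c).Hol U v)
    (j : Fin r) : ContMDiffOn 𝓘(ℂ, ℂ) 𝓘(ℂ, ℂ) ω (fun y => he.coeff j (y, c) (v y)) U := by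
  have h1 : (E.slice c).IsFrame {y | (y, c) ∈ N} _ := IsFrame.slice hN he
  refine (IsFrame.contMDiffOn_coeff hU hUN h1 hv j).congr fun y hy => ?_
  exact (IsFrame.coeff_eq_of_sum h1 (hUN y hy) (IsFrame.sum_coeff he (hUN y hy) (v y)) j).symm

end HolBundle

end Restriction

section Transport

open Set Module HolBundle Metric

variable {Y : Type v} [TopologicalSpace Y] [ChartedSpace ℂ Y] [IsManifold 𝓘(ℂ, ℂ) ω Y]
  {T : SmoothTriple.{u} Y} {S : IntegrableStructure T}

namespace IntegrableStructure

theorem IsHorizontal.isFlatAlong {U : Set Y} (hU : IsOpen U) {m : ∀ p, T.E.fib p}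
    (hm : S.IsHorizontal (U ×ˢ {0}ᶜ) m) {y : Y} (hy : y ∈ U) :
    S.IsFlatAlong y fun z => m (y, z) := fun _ hz =>
  ⟨_, m, hU.prod isOpen_compl_singleton, mk_mem_prod hy hz, hm, Filter.Eventually.of_forall
    fun _ => rfl⟩

theorem IsFlatAlong.add {y : Y} {g g' : ∀ z : ℂ, T.E.fib (y, z)} (hg : S.IsFlatAlong y g)
    (hg' : S.IsFlatAlong y g') : S.IsFlatAlong y fun z => g z + g' z := by
  intro z hz
  obtain ⟨W, m, hW, hp, hm, hgm⟩ := hg z hz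
  obtain ⟨W', m', hW', hp', hm', hgm'⟩ := hg' z hz
  have ho := hW.inter hW'
  have h1 := hm.mono (inter_subset_left (t := W'))
  have h2 := hm'.mono (inter_subset_right (s := W))
  refine ⟨_, fun p => m p + m' p, ho, ⟨hp, hp'⟩, ⟨h1.hol.add h2.hol, fun p hp => ?_⟩, ?_⟩
  · rw [S.δ_add _ ho m m' h1.hol h2.hol p hp, h1.δ_eq_zero p hp, h2.δ_eq_zero p hp, add_zero]
  · filter_upwards [hgm, hgm'] with w e1 e2
    rw [e1, e2]

theorem IsFlatAlong.smul {y : Y} {g : ∀ z : ℂ, T.E.fib (y, z)} (hg : S.IsFlatAlong y g) (a : ℂ) :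
    S.IsFlatAlong y fun z => a • g z := by
  intro z hz
  obtain ⟨W, m, hW, hp, hm, hgm⟩ := hg z hz
  refine ⟨W, fun p => a • m p, hW, hp, ⟨hm.hol.const_smul a, fun p hp => ?_⟩, ?_⟩
  · rw [S.δ_leibniz W hW (fun _ => a) m contMDiffOn_const hm.hol p hp, hm.δ_eq_zero p hp]
    simp
  · filter_upwards [hgm] with w e1
    rw [e1]

theorem IsFlatAlong.coeff_eq {y : Y} {g : ∀ z : ℂ, T.E.fib (y, z)} (hg : S.IsFlatAlong y g)
    {U : Set Y} (hU : IsOpen U) (hy : y ∈ U) {z₀ : ℂ} {ρ : ℝ} (h0 : ∀ w ∈ ball z₀ ρ, w ≠ 0)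
    {v : Fin T.rank → ∀ p, T.E.fib p} (hv : T.E.IsFrame (U ×ˢ ball z₀ ρ) v)
    (hδ : ∀ j, S.IsHorizontal (U ×ˢ ball z₀ ρ) (v j)) (j : Fin T.rank) {z z' : ℂ}
    (hz : z ∈ ball z₀ ρ) (hz' : z' ∈ ball z₀ ρ) :
    hv.coeff j (y, z) (g z) = hv.coeff j (y, z') (g z') := by
  have key : ∀ w ∈ ball z₀ ρ, hv.coeff j (y, w) (g w) = hv.coeff j (y, z₀) (g z₀) := by
    refine eqOn_ball_of_hasDerivAt_eq (f' := fun _ => 0)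
      (f := fun w => hv.coeff j (y, w) (g w)) (fun w hw => ?_)
      (fun w _ => hasDerivAt_const w _) rfl
    obtain ⟨W, m, hW, hp, hm, hgm⟩ := hg w (h0 w hw)
    refine (hasDerivAt_const w (hv.coeff j (y, w) (g w))).congr_of_eventuallyEq ?_
    filter_upwards [hgm, hm.eventually_coeff_eq (hU.prod isOpen_ball) hW hv hδ (h0 w hw)
      (mk_mem_prod hy hw) hp j] with w' e1 e2
    rw [e1, e2, hgm.self_of_nhds]
  rw [key z hz, key z' hz']

namespace TrivialMonodromy

variable (hS : S.TrivialMonodromy)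

/-- Parallel transport of a vector over `ħ = 1`. -/
def flow (y : Y) (x : T.E.fib (y, (1 : ℂ))) : ∀ z : ℂ, T.E.fib (y, z) :=
  (hS.exists_isFlatAlong one_ne_zero x).choose

theorem isFlatAlong_flow (y : Y) (x : T.E.fib (y, (1 : ℂ))) : S.IsFlatAlong y (hS.flow y x) :=
  (hS.exists_isFlatAlong one_ne_zero x).choose_spec.1

theorem flow_one (y : Y) (x : T.E.fib (y, (1 : ℂ))) : hS.flow y x 1 = x :=
  (hS.exists_isFlatAlong one_ne_zero x).choose_spec.2

variable {hS} in
theorem eq_flow {y : Y} {g : ∀ z : ℂ, T.E.fib (y, z)} (hg : S.IsFlatAlong y g) {z : ℂ}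
    (hz : z ≠ 0) : g z = hS.flow y (g 1) z :=
  hg.eq (hS.isFlatAlong_flow y _) one_ne_zero (hS.flow_one y _).symm hz

/-- The isomorphisms between the fibres defined by parallel transport. -/
def transport (p : Y × ℂ) (hp : p.2 ≠ 0) : (T.E.slice 1).fib p.1 ≃ₗ[ℂ] T.E.fib p :=
  LinearEquiv.ofBijective
    { toFun := fun x => hS.flow p.1 x p.2
      map_add' := fun x x' => by
        have h := eq_flow (hS := hS)
          ((hS.isFlatAlong_flow p.1 x).add (hS.isFlatAlong_flow p.1 x')) hp
        simp only [flow_one] at h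
        exact h.symm
      map_smul' := fun a x => by
        have h := eq_flow (hS := hS) ((hS.isFlatAlong_flow p.1 x).smul a) hp
        simp only [flow_one] at h
        exact h.symm }
    ⟨fun x x' h => by
      have := (hS.isFlatAlong_flow p.1 x).eq (hS.isFlatAlong_flow p.1 x') hp h one_ne_zero
      rwa [flow_one, flow_one] at this, fun x => by
      obtain ⟨g, hg, hgx⟩ := hS.exists_isFlatAlong hp x
      exact ⟨g 1, (eq_flow (hS := hS) hg hp).symm.trans hgx⟩⟩

/-- Extension of a section over `ħ = 1` by parallel transport. -/
def ext (v : ∀ y, (T.E.slice 1).fib y) (p : Y × ℂ) : T.E.fib p := hS.flow p.1 (v p.1) p.2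

theorem ext_of_ne (v : ∀ y, (T.E.slice 1).fib y) (p : Y × ℂ) (hp : p.2 ≠ 0) :
    hS.ext v p = hS.transport p hp (v p.1) := rfl

theorem ext_one (v : ∀ y, (T.E.slice 1).fib y) (y : Y) : hS.ext v (y, 1) = v y :=
  hS.flow_one y _

variable {hS} in
theorem eq_ext {U : Set Y} (hU : IsOpen U) {m : ∀ p, T.E.fib p}
    (hm : S.IsHorizontal (U ×ˢ {0}ᶜ) m) {p : Y × ℂ} (hp : p ∈ U ×ˢ ({0}ᶜ : Set ℂ)) :
    m p = hS.ext (fun y => m (y, 1)) p :=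
  eq_flow (hm.isFlatAlong hU hp.1) hp.2

/-- In a horizontal frame over a box the coordinates of a parallel extension do not depend on ħ.
Holomorphy in y over the single value `z₁` thus spreads to the whole disc. -/
theorem isHorizontal_ext_of_coeff {U₀ U : Set Y} (hU₀ : IsOpen U₀) (hU : IsOpen U) (hUU₀ : U ⊆ U₀)
    {z₀ z₁ : ℂ} {ρ : ℝ} (h0 : ∀ w ∈ ball z₀ ρ, w ≠ 0) {e : Fin T.rank → ∀ p, T.E.fib p}
    (he : T.E.IsFrame (U₀ ×ˢ ball z₀ ρ) e) (hδ : ∀ j, S.IsHorizontal (U₀ ×ˢ ball z₀ ρ) (e j))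
    (hz₁ : z₁ ∈ ball z₀ ρ) {v : ∀ y, (T.E.slice 1).fib y}
    (hc : ∀ j, ContMDiffOn 𝓘(ℂ, ℂ) 𝓘(ℂ, ℂ) ω (fun y => he.coeff j (y, z₁) (hS.ext v (y, z₁))) U) :
    S.IsHorizontal (U ×ˢ ball z₀ ρ) (hS.ext v) := by
  have hsub : U ×ˢ ball z₀ ρ ⊆ U₀ ×ˢ ball z₀ ρ := prod_mono hUU₀ Subset.rfl
  have ho : IsOpen (U ×ˢ ball z₀ ρ) := hU.prod isOpen_ball
  refine (isHorizontal_sum ho (fun p hp => hp.1) hc fun j => (hδ j).mono hsub).congr ho ?_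
  rintro ⟨y, z⟩ hp
  refine (HolBundle.IsFrame.sum_coeff he (hsub hp) (hS.ext v (y, z))).trans ?_
  refine Finset.sum_congr rfl fun j _ => ?_
  congr 1
  exact (hS.isFlatAlong_flow y (v y)).coeff_eq hU₀ (hUU₀ hp.1) h0 he hδ j hp.2 hz₁

/-- The extension of a holomorphic section by parallel transport is holomorphic. -/
theorem isHorizontal_ext {U : Set Y} (hU : IsOpen U) {v : ∀ y, (T.E.slice 1).fib y}
    (hv : (T.E.slice 1).Hol U v) : S.IsHorizontal (U ×ˢ {0}ᶜ) (hS.ext v) := by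
  refine isHorizontal_of_locally ?_
  suffices h : ∀ y ∈ U, ∀ b : {z : ℂ // z ≠ 0}, ∃ N, IsOpen N ∧ (y, (b : ℂ)) ∈ N ∧
      S.IsHorizontal N (hS.ext v) from fun p hp => h p.1 hp.1 ⟨p.2, hp.2⟩
  intro y hy
  have := preconnectedSpace_punctured
  -- Holomorphy is propagated from ħ = 1: being horizontal near (y, ħ) is a locally constant
  -- condition on ħ in the connected punctured plane.
  have hl : IsLocallyConstant fun b : {z : ℂ // z ≠ 0} =>
      ∃ N, IsOpen N ∧ (y, (b : ℂ)) ∈ N ∧ S.IsHorizontal N (hS.ext v) := by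
    rw [IsLocallyConstant.iff_eventually_eq]
    rintro ⟨z, hz⟩
    obtain ⟨U₀, ρ, e, hU₀, hyU₀, hρ, h0, he, hδ⟩ := S.exists_horizontal_frame (p₀ := (y, z)) hz
    have hN₀ : IsOpen (U₀ ×ˢ ball z ρ) := hU₀.prod isOpen_ball
    have key : ∀ z₁ ∈ ball z ρ, ∀ z₂ ∈ ball z ρ,
        (∃ N, IsOpen N ∧ (y, z₁) ∈ N ∧ S.IsHorizontal N (hS.ext v)) →
        ∃ N, IsOpen N ∧ (y, z₂) ∈ N ∧ S.IsHorizontal N (hS.ext v) := by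
      rintro z₁ hz₁ z₂ hz₂ ⟨N, hN, hyN, hh⟩
      have hU₁ : IsOpen (U₀ ∩ {y | (y, z₁) ∈ N}) :=
        hU₀.inter (hN.preimage (Continuous.prodMk_left z₁))
      refine ⟨_, hU₁.prod isOpen_ball, mk_mem_prod ⟨hyU₀, hyN⟩ hz₂,
        hS.isHorizontal_ext_of_coeff hU₀ hU₁ inter_subset_left h0 he hδ hz₁ fun j => ?_⟩
      intro y' hy'
      have h1 := HolBundle.IsFrame.contMDiffOn_coeff (hN₀.inter hN) inter_subset_left he
        (hh.hol.mono inter_subset_right) j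
      have h2 : (y', z₁) ∈ U₀ ×ˢ ball z ρ ∩ N := ⟨mk_mem_prod hy'.1 hz₁, hy'.2⟩
      exact ((h1.contMDiffAt ((hN₀.inter hN).mem_nhds h2)).slice_left).contMDiffWithinAt
    have h2 : ∀ᶠ w in 𝓝 z, (∃ N, IsOpen N ∧ (y, w) ∈ N ∧ S.IsHorizontal N (hS.ext v)) =
        ∃ N, IsOpen N ∧ (y, z) ∈ N ∧ S.IsHorizontal N (hS.ext v) := by
      filter_upwards [ball_mem_nhds z hρ] with w hw
      exact propext ⟨key w hw z (mem_ball_self hρ), key z (mem_ball_self hρ) w hw⟩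
    exact (continuous_subtype_val.tendsto (⟨z, hz⟩ : {z : ℂ // z ≠ 0})).eventually h2
  have h1 : ∃ N, IsOpen N ∧ (y, (1 : ℂ)) ∈ N ∧ S.IsHorizontal N (hS.ext v) := by
    obtain ⟨U₀, ρ, e, hU₀, hyU₀, hρ, h0, he, hδ⟩ :=
      S.exists_horizontal_frame (p₀ := (y, (1 : ℂ))) one_ne_zero
    refine ⟨_, (hU₀.inter hU).prod isOpen_ball, mk_mem_prod ⟨hyU₀, hy⟩ (mem_ball_self hρ),
      hS.isHorizontal_ext_of_coeff hU₀ (hU₀.inter hU) inter_subset_left h0 he hδ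
        (mem_ball_self hρ) fun j => ?_⟩
    simp only [ext_one]
    exact HolBundle.IsFrame.contMDiffOn_slice_coeff (hU₀.prod isOpen_ball) he (hU₀.inter hU)
      (fun y hy => mk_mem_prod hy.1 (mem_ball_self hρ)) (hv.mono inter_subset_right) j
  intro b
  exact (hl.apply_eq_of_preconnectedSpace ⟨1, one_ne_zero⟩ b).mp h1

end TrivialMonodromy

end IntegrableStructure

end Transport
end

noncomputable section

/-! ### The connection and the pairing over `ħ = 1` -/

section Connection

open Set Module HolBundle Metric

variable {Y : Type v} [TopologicalSpace Y] [ChartedSpace ℂ Y] [IsManifold 𝓘(ℂ, ℂ) ω Y]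

/-- A local holomorphic vector field through a given tangent vector. -/
theorem exists_holField_through (y : Y) (ξ : TangentSpace 𝓘(ℂ, ℂ) y) :
    ∃ U Ξ, IsOpen U ∧ y ∈ U ∧ HolField Y U Ξ ∧ Ξ y = ξ := by
  -- Since ω + 1 = ω, no regularity is lost in passing to the tangent bundle.
  have : IsManifold 𝓘(ℂ, ℂ) (ω + 1) Y := inferInstanceAs (IsManifold 𝓘(ℂ, ℂ) ω Y)
  have hy : y ∈ (trivializationAt ℂ (TangentSpace 𝓘(ℂ, ℂ) : Y → Type) y).baseSet :=
    FiberBundle.mem_baseSet_trivializationAt' y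
  have he := Trivialization.isLocalFrameOn_localFrame_baseSet 𝓘(ℂ, ℂ) ω
      (trivializationAt ℂ (TangentSpace 𝓘(ℂ, ℂ) : Y → Type) y) (Basis.singleton (Fin 1) ℂ)
  refine ⟨_, fun y' => ∑ j, he.coeff j y ξ • (trivializationAt ℂ
    (TangentSpace 𝓘(ℂ, ℂ) : Y → Type) y).localFrame (Basis.singleton (Fin 1) ℂ) j y',
    (trivializationAt ℂ (TangentSpace 𝓘(ℂ, ℂ) : Y → Type) y).open_baseSet, hy, ?_, ?_⟩
  · exact ContMDiffOn.sum_section fun j _ =>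
      ContMDiffOn.smul_section contMDiffOn_const (he.contMDiffOn j)
  · have h1 : ∀ j, he.coeff j y ξ = (he.toBasisAt hy).repr ξ j := fun j => by
      simp [IsLocalFrameOn.coeff]
    simp only [h1, ← he.toBasisAt_coe hy]
    exact (he.toBasisAt hy).sum_repr ξ

theorem HolField.mono {U U' : Set Y} {ξ : ∀ y : Y, TangentSpace 𝓘(ℂ, ℂ) y} (h : HolField Y U ξ)
    (hU : U' ⊆ U) : HolField Y U' ξ := ContMDiffOn.mono h hU

variable {T : SmoothTriple.{u} Y} {S : IntegrableStructure T}

namespace IntegrableStructure.TrivialMonodromy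

variable (hS : S.TrivialMonodromy)

theorem isOpen_prod_compl {U : Set Y} (hU : IsOpen U) : IsOpen (U ×ˢ ({0}ᶜ : Set ℂ)) :=
  hU.prod isOpen_compl_singleton

theorem hol_ext {U : Set Y} (hU : IsOpen U) {v : ∀ y, (T.E.slice 1).fib y}
    (hv : (T.E.slice 1).Hol U v) : T.E.Hol (U ×ˢ {0}ᶜ) (hS.ext v) :=
  (hS.isHorizontal_ext hU hv).hol

/-- The connection over `ħ = 1`. -/
def conn (v : ∀ y, (T.E.slice 1).fib y) (y : Y) :
    TangentSpace 𝓘(ℂ, ℂ) y →ₗ[ℂ] (T.E.slice 1).fib y := T.D (hS.ext v) (y, 1)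

/-- For horizontal m the commutation rule leaves δ((ħξ)m) = ħ (ħξ)m. The contribution of ħ²∂_ħ(ħ⁻¹)
= -1 cancels it after division by ħ. -/
theorem isHorizontal_D_ext {U : Set Y} (hU : IsOpen U) {v : ∀ y, (T.E.slice 1).fib y}
    (hv : (T.E.slice 1).Hol U v) {ξ : ∀ y : Y, TangentSpace 𝓘(ℂ, ℂ) y} (hξ : HolField Y U ξ) :
    S.IsHorizontal (U ×ˢ {0}ᶜ) fun p => p.2⁻¹ • T.D (hS.ext v) p (ξ p.1) := by
  have ho := isOpen_prod_compl hU
  have h := hS.isHorizontal_ext hU hv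
  have hD := T.D_hol _ U ho hU (fun p hp => hp.1) _ ξ h.hol hξ
  have hinv : ContMDiffOn modelYΩ 𝓘(ℂ, ℂ) ω (fun p : Y × ℂ => p.2⁻¹) (U ×ˢ {0}ᶜ) := by
    intro p hp
    have h2 : ContDiffAt ℂ ω (fun w : ℂ => w⁻¹) p.2 := contDiffAt_id.inv hp.2
    exact (h2.contMDiffAt.comp p contMDiffAt_snd).contMDiffWithinAt
  refine ⟨Hol.smul hinv hD, fun p hp => ?_⟩
  have hp2 : p.2 ≠ 0 := hp.2
  rw [S.δ_leibniz _ ho _ _ hinv hD p hp, S.δ_D _ U ho hU (fun p hp => hp.1) _ ξ h.hol hξ p hp,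
    T.D_local _ ho _ (fun _ => 0) (S.δ_hol _ ho _ h.hol) (hol_zero _) h.δ_eq_zero p hp,
    T.D_zero ho hp, LinearMap.zero_apply, zero_add, smul_smul, ← add_smul, deriv_inv]
  convert zero_smul ℂ _
  field_simp
  ring

/-- `(ħξ) v = ħ ∇_ξ v` for the parallel extension of `v`. -/
theorem D_ext {U : Set Y} (hU : IsOpen U) {v : ∀ y, (T.E.slice 1).fib y}
    (hv : (T.E.slice 1).Hol U v) {p : Y × ℂ} (hp : p.1 ∈ U) (hp0 : p.2 ≠ 0)
    (ξ : TangentSpace 𝓘(ℂ, ℂ) p.1) :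
    T.D (hS.ext v) p ξ = p.2 • hS.transport p hp0 (hS.conn v p.1 ξ) := by
  obtain ⟨U', Ξ, hU', hpU', hΞ, rfl⟩ := exists_holField_through p.1 ξ
  have ho := hU.inter hU'
  have h1 := eq_ext (hS := hS) ho (hS.isHorizontal_D_ext ho (hv.mono inter_subset_left)
    (hΞ.mono inter_subset_right)) (p := p) ⟨⟨hp, hpU'⟩, hp0⟩
  have h2 : (1 : ℂ)⁻¹ • T.D (hS.ext v) (p.1, 1) (Ξ p.1) = T.D (hS.ext v) (p.1, 1) (Ξ p.1) := by
    rw [inv_one, one_smul]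
  rw [← inv_smul_eq_iff₀ hp0]
  exact h1.trans (congrArg (fun x : T.E.fib (p.1, (1 : ℂ)) => hS.flow p.1 x p.2) h2)

theorem contMDiffOn_zpow_snd {W : Set (Y × ℂ)} (hW : ∀ p ∈ W, p.2 ≠ 0) (d : ℤ) :
    ContMDiffOn modelYΩ 𝓘(ℂ, ℂ) ω (fun p : Y × ℂ => p.2 ^ d) W := by
  intro p hp
  have h2 : AnalyticAt ℂ (fun w : ℂ => w ^ d) p.2 := analyticAt_id.zpow (hW p hp)
  exact (h2.contDiffAt.contMDiffAt.comp p contMDiffAt_snd).contMDiffWithinAt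

theorem eventually_eq_zpow_smul_ext {W : Set (Y × ℂ)} (hW : IsOpen W) {U : Set Y}
    (hWU : ∀ p ∈ W, p.1 ∈ U) {d : ℤ} {v : ∀ y, (T.E.slice 1).fib y} {m : ∀ p, T.E.fib p}
    (hmv : ∀ p ∈ W, ∀ hp : p.2 ≠ 0, m p = hS.transport p hp (p.2 ^ d • v p.1)) :
    IsOpen (W ∩ {p | p.2 ≠ 0}) ∧ W ∩ {p | p.2 ≠ 0} ⊆ U ×ˢ {0}ᶜ ∧
      ∀ p ∈ W ∩ {p | p.2 ≠ 0}, m p = p.2 ^ d • hS.ext v p :=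
  ⟨hW.inter (isOpen_ne_fun continuous_snd continuous_const), fun p hp => ⟨hWU p hp.1, hp.2⟩,
    fun p hp => by rw [hmv p hp.1 hp.2, map_smul]; rfl⟩

theorem D_of_eq {W : Set (Y × ℂ)} (hW : IsOpen W) {U : Set Y} (hU : IsOpen U)
    (hWU : ∀ p ∈ W, p.1 ∈ U) {d : ℤ} {v : ∀ y, (T.E.slice 1).fib y} (hv : (T.E.slice 1).Hol U v)
    {m : ∀ p, T.E.fib p} (hm : T.E.Hol W m)
    (hmv : ∀ p ∈ W, ∀ hp : p.2 ≠ 0, m p = hS.transport p hp (p.2 ^ d • v p.1)) {p : Y × ℂ}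
    (hp : p ∈ W) (hp0 : p.2 ≠ 0) (ξ : TangentSpace 𝓘(ℂ, ℂ) p.1) :
    T.D m p ξ = hS.transport p hp0 (p.2 • p.2 ^ d • hS.conn v p.1 ξ) := by
  obtain ⟨ho, hsub, heq⟩ := hS.eventually_eq_zpow_smul_ext hW hWU hmv
  have h1 := (hS.hol_ext hU hv).mono hsub
  have h2 := contMDiffOn_zpow_snd (fun p (hp : p ∈ W ∩ {p | p.2 ≠ 0}) => hp.2) d
  have h3 : dY (fun y : Y => ((y, p.2) : Y × ℂ).2 ^ d) p.1 ξ = 0 :=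
    dY_const (p.2 ^ d) p.1 ξ
  rw [T.D_local _ ho m (fun p => p.2 ^ d • hS.ext v p) (hm.mono inter_subset_left)
    (Hol.smul h2 h1) heq p ⟨hp, hp0⟩, T.D_leibniz _ ho _ _ h2 h1 p ⟨hp, hp0⟩, h3,
    mul_zero, zero_smul, add_zero, hS.D_ext hU hv (hWU p hp) hp0, map_smul, map_smul]
  exact smul_comm _ _ _

theorem δ_of_eq {W : Set (Y × ℂ)} (hW : IsOpen W) {U : Set Y} (hU : IsOpen U)
    (hWU : ∀ p ∈ W, p.1 ∈ U) {d : ℤ} {v : ∀ y, (T.E.slice 1).fib y} (hv : (T.E.slice 1).Hol U v)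
    {m : ∀ p, T.E.fib p} (hm : T.E.Hol W m)
    (hmv : ∀ p ∈ W, ∀ hp : p.2 ≠ 0, m p = hS.transport p hp (p.2 ^ d • v p.1)) {p : Y × ℂ}
    (hp : p ∈ W) (hp0 : p.2 ≠ 0) :
    S.δ m p = hS.transport p hp0 (((d : ℂ) * p.2 ^ (d + 1)) • v p.1) := by
  obtain ⟨ho, hsub, heq⟩ := hS.eventually_eq_zpow_smul_ext hW hWU hmv
  have h1 := (hS.isHorizontal_ext hU hv).mono hsub
  have h2 := contMDiffOn_zpow_snd (fun p (hp : p ∈ W ∩ {p | p.2 ≠ 0}) => hp.2) d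
  rw [S.δ_local _ ho m (fun p => p.2 ^ d • hS.ext v p) (hm.mono inter_subset_left)
    (Hol.smul h2 h1.hol) heq p ⟨hp, hp0⟩, S.δ_leibniz _ ho _ _ h2 h1.hol p ⟨hp, hp0⟩,
    h1.δ_eq_zero p ⟨hp, hp0⟩, smul_zero, zero_add, (hasDerivAt_zpow d p.2 (Or.inl hp0)).deriv,
    map_smul, ext_of_ne _ _ _ hp0]
  congr 1
  rw [zpow_sub_one₀ hp0, zpow_add_one₀ hp0]
  field_simp

/-- Both terms of the derivative formula `δ_C` vanish on parallel sections, so the pairing is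
constant along the circle. The vectors are extended to local holomorphic sections because `δ_C`
speaks about sections. -/
theorem C_flow (y : Y) (z : Circle) (x x' : T.E.fib (y, (1 : ℂ))) :
    T.C y z (hS.flow y x z) (hS.flow y x' (antipode z)) =
      T.C y 1 (hS.flow y x (1 : Circle)) (hS.flow y x' (antipode (1 : Circle))) := by
  obtain ⟨U, v, hU, hyU, hv, rfl⟩ := (T.E.slice 1).exists_hol_through y x
  obtain ⟨U', v', hU', hyU', hv', rfl⟩ := (T.E.slice 1).exists_hol_through y x'
  let H : Circle → ℂ := fun z =>
    T.C y z (hS.ext v (y, (z : ℂ))) (hS.ext v' (y, antipode (z : ℂ)))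
  let h : ℝ → ℂ := fun t => H (Circle.exp t)
  have hd : ∀ t, HasDerivAt h 0 t := by
    intro t
    have hh := hS.isHorizontal_ext hU hv
    have hh' := hS.isHorizontal_ext hU' hv'
    have hp : (y, ((Circle.exp t : Circle) : ℂ)) ∈ U ×ˢ ({0}ᶜ : Set ℂ) :=
      ⟨hyU, Circle.coe_ne_zero _⟩
    have hp' : (y, antipode ((Circle.exp t : Circle) : ℂ)) ∈ U' ×ˢ ({0}ᶜ : Set ℂ) :=
      ⟨hyU', antipode_circle_ne_zero _⟩
    have h1 := S.δ_C _ _ (isOpen_prod_compl hU) (isOpen_prod_compl hU') _ _ hh.hol hh'.hol y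
      (Circle.exp t) hp hp'
    rw [hh.δ_eq_zero _ hp, hh'.δ_eq_zero _ hp'] at h1
    simp only [smul_zero, map_zero, LinearMap.zero_apply, sub_zero, mul_zero] at h1
    have h2 : HasDerivAt (fun s => h (t + s)) 0 (t - t) := by
      rw [sub_self]
      simp only [h, Circle.exp_add]
      exact h1
    simpa using h2.comp_sub_const t t
  have hc := is_const_of_deriv_eq_zero (fun t => (hd t).differentiableAt) (fun t => (hd t).deriv)
    (arg z) 0
  simp only [h] at hc
  rw [Circle.exp_arg, Circle.exp_zero] at hc
  exact hc

/-- The pairing over `ħ = 1`. -/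
def pairing (y : Y) : (T.E.slice 1).fib y →ₗ[ℂ] (T.E.slice 1).fib y →ₛₗ[starRingEnd ℂ] ℂ :=
  LinearMap.mk₂'ₛₗ (RingHom.id ℂ) (starRingEnd ℂ)
    -- Here σ(1) = -1: the second vector is transported from ħ = 1 to ħ = -1 before it is paired.
    (fun x x' => T.C y 1 (hS.transport (y, ((1 : Circle) : ℂ)) (Circle.coe_ne_zero _) x)
      (hS.transport (y, antipode (1 : Circle)) (antipode_circle_ne_zero _) x'))
    (fun _ _ _ => by rw [map_add, map_add, LinearMap.add_apply])
    (fun _ _ _ => by rw [map_smul, map_smul, LinearMap.smul_apply]; rfl)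
    (fun _ _ _ => by rw [map_add, map_add])
    (fun _ _ _ => by rw [map_smul, LinearMap.map_smulₛₗ])

theorem C_transport (y : Y) (z : Circle) (x x' : (T.E.slice 1).fib y) :
    T.C y z (hS.transport (y, (z : ℂ)) z.coe_ne_zero x)
      (hS.transport (y, antipode z) (antipode_circle_ne_zero z) x') = hS.pairing y x x' :=
  hS.C_flow y z x x'

theorem pairing_smooth {U : Set Y} (hU : IsOpen U) {v w : ∀ y, (T.E.slice 1).fib y}
    (hv : (T.E.slice 1).Hol U v) (hw : (T.E.slice 1).Hol U w) :
    ContMDiffOn 𝓘(ℝ, ℂ) 𝓘(ℝ, ℂ) ∞ (fun y => hS.pairing y (v y) (w y)) U :=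
  (T.C_smooth _ _ (isOpen_prod_compl hU) (isOpen_prod_compl hU) _ _ (hS.hol_ext hU hv)
    (hS.hol_ext hU hw) 1).mono fun _ hy =>
      ⟨⟨hy, Circle.coe_ne_zero _⟩, ⟨hy, antipode_circle_ne_zero _⟩⟩

theorem pairing_flat_left {U : Set Y} (hU : IsOpen U) {v w : ∀ y, (T.E.slice 1).fib y}
    (hv : (T.E.slice 1).Hol U v) (hw : (T.E.slice 1).Hol U w) {y : Y} (hy : y ∈ U)
    (ξ : TangentSpace 𝓘(ℂ, ℂ) y) :
    hS.pairing y (hS.conn v y ξ) (w y) = del (fun x => hS.pairing x (v x) (w x)) y ξ := by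
  have h := T.C_D_left _ _ (isOpen_prod_compl hU) (isOpen_prod_compl hU) _ _ (hS.hol_ext hU hv)
    (hS.hol_ext hU hw) y 1 ⟨hy, Circle.coe_ne_zero _⟩ ⟨hy, antipode_circle_ne_zero _⟩ ξ
  rw [hS.D_ext hU hv (p := (y, ((1 : Circle) : ℂ))) hy (Circle.coe_ne_zero _) ξ, map_smul] at h
  exact mul_left_cancel₀ (Circle.coe_ne_zero 1) h

theorem pairing_flat_right {U : Set Y} (hU : IsOpen U) {v w : ∀ y, (T.E.slice 1).fib y}
    (hv : (T.E.slice 1).Hol U v) (hw : (T.E.slice 1).Hol U w) {y : Y} (hy : y ∈ U)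
    (ξ : TangentSpace 𝓘(ℂ, ℂ) y) :
    hS.pairing y (v y) (hS.conn w y ξ) = delBar (fun x => hS.pairing x (v x) (w x)) y ξ := by
  have h := T.C_D_right _ _ (isOpen_prod_compl hU) (isOpen_prod_compl hU) _ _ (hS.hol_ext hU hv)
    (hS.hol_ext hU hw) y 1 ⟨hy, Circle.coe_ne_zero _⟩ ⟨hy, antipode_circle_ne_zero _⟩ ξ
  rw [hS.D_ext hU hw (p := (y, antipode (1 : Circle))) hy (antipode_circle_ne_zero _) ξ,
    LinearMap.map_smulₛₗ] at h
  exact mul_left_cancel₀ ((map_ne_zero _).2 (antipode_circle_ne_zero 1)) h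

end IntegrableStructure.TrivialMonodromy

end Connection
end

noncomputable section

/-! ### Regular singular systems and Taylor expansions in the direction of `ħ` -/

section RegularSingular

open Set Metric

/-- Grönwall's inequality along the ray e^{-t} w, from the circle of radius r down to z: the growth
rate is at most K and the time is log(r/|z|), so the norm of f is at most M (r/|z|)^K. -/
theorem norm_pow_smul_le_of_norm_deriv_le {F : Type*} [NormedAddCommGroup F] [NormedSpace ℂ F]
    {f f' : ℂ → F} {ρ : ℝ} (hρ : 0 < ρ) {K : ℕ}
    (hf : ∀ z ∈ ball (0 : ℂ) ρ, z ≠ 0 → HasDerivAt f (f' z) z)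
    (hK : ∀ z ∈ ball (0 : ℂ) ρ, z ≠ 0 → ‖z • f' z‖ ≤ K * ‖f z‖) :
    ∃ C, ∀ᶠ z in 𝓝[≠] (0 : ℂ), ‖z ^ K • f z‖ ≤ C := by
  set r := ρ / 2 with hr
  have hr0 : 0 < r := half_pos hρ
  have hball : ∀ z : ℂ, ‖z‖ ≤ r → z ∈ ball (0 : ℂ) ρ := fun z hz => by
    rw [mem_ball_zero_iff]; linarith
  obtain ⟨M, hM⟩ : ∃ M, ∀ z ∈ sphere (0 : ℂ) r, ‖f z‖ ≤ M := by
    refine (isCompact_sphere (0 : ℂ) r).exists_bound_of_continuousOn fun z hz => ?_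
    have h1 : ‖z‖ = r := mem_sphere_zero_iff_norm.1 hz
    exact (hf z (hball z h1.le) (norm_pos_iff.1 (h1 ▸ hr0))).continuousAt.continuousWithinAt
  refine ⟨M * r ^ K, ?_⟩
  filter_upwards [nhdsWithin_le_nhds (ball_mem_nhds (0 : ℂ) hr0), self_mem_nhdsWithin] with z hz hz0
  have hz1 : 0 < ‖z‖ := norm_pos_iff.2 hz0
  have hz2 : ‖z‖ < r := mem_ball_zero_iff.1 hz
  -- The point of the circle of radius r on the ray through z.
  set w : ℂ := (r / ‖z‖ : ℝ) * z with hw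
  have hwn : ‖w‖ = r := by
    rw [hw, norm_mul, norm_real, Real.norm_of_nonneg (by positivity), div_mul_cancel₀ _ hz1.ne']
  have hw0 : w ≠ 0 := norm_pos_iff.1 (hwn ▸ hr0)
  set t₀ := Real.log (r / ‖z‖) with ht₀
  have ht₀0 : 0 ≤ t₀ := Real.log_nonneg ((one_le_div hz1).2 hz2.le)
  have he0 : ∀ t : ℝ, exp (-t) * w ≠ 0 := fun t => mul_ne_zero (exp_ne_zero _) hw0
  have heb : ∀ t : ℝ, 0 ≤ t → exp (-t) * w ∈ ball (0 : ℂ) ρ := fun t ht => by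
    refine hball _ ?_
    rw [norm_mul, hwn, ← ofReal_neg, norm_exp_ofReal]
    exact mul_le_of_le_one_left hr0.le (Real.exp_le_one_iff.2 (by linarith))
  have hd : ∀ t : ℝ, 0 ≤ t → HasDerivAt (fun t : ℝ => f (exp (-t) * w))
      ((-(exp (-t) * w)) • f' (exp (-t) * w)) t := by
    intro t ht
    have h1 : HasDerivAt (fun t : ℝ => exp (-(t : ℂ)) * w) (-(exp (-t) * w)) t := by
      have := (((hasDerivAt_id t).ofReal_comp.neg).cexp).mul_const w
      simpa using this
    exact (hf _ (heb t ht) (he0 t)).scomp t h1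
  have hg := norm_le_gronwallBound_of_norm_deriv_right_le (δ := M) (K := K) (ε := 0) (a := 0)
    (b := t₀) (fun t ht => (hd t ht.1).continuousAt.continuousWithinAt)
    (fun t ht => (hd t ht.1).hasDerivWithinAt)
    (by simpa using hM w (mem_sphere_zero_iff_norm.2 hwn))
    (fun t ht => by
      rw [neg_smul, norm_neg, add_zero]
      exact hK _ (heb t ht.1) (he0 t)) t₀ ⟨ht₀0, le_rfl⟩
  have hz3 : exp (-(t₀ : ℂ)) * w = z := by
    rw [← ofReal_neg, ← ofReal_exp, ht₀, ← Real.log_inv, Real.exp_log (by positivity), hw,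
      ← mul_assoc, ← ofReal_mul, inv_mul_cancel₀ (by positivity), ofReal_one, one_mul]
  rw [hz3, gronwallBound_ε0, sub_zero, mul_comm (K : ℝ), Real.exp_mul, ht₀,
    Real.exp_log (by positivity), Real.rpow_natCast, div_pow] at hg
  rw [norm_smul, norm_pow]
  refine (mul_le_mul_of_nonneg_left hg (by positivity)).trans (le_of_eq ?_)
  field_simp

variable {Y : Type v} [TopologicalSpace Y] [ChartedSpace ℂ Y] [IsManifold 𝓘(ℂ, ℂ) ω Y]

/-- Solutions of a system with a regular singularity along `ħ = 0` have moderate growth. -/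
theorem exists_extension_of_regularSingular {ι : Type*} [Fintype ι] {U : Set Y} (hU : IsOpen U)
    {ρ : ℝ} (hρ : 0 < ρ) {f : ι → Y × ℂ → ℂ} {B : ι → ι → Y × ℂ → ℂ} {K : ℕ}
    (hf : ∀ i, ContMDiffOn modelYΩ 𝓘(ℂ, ℂ) ω (f i) (U ×ˢ (ball 0 ρ \ {0})))
    (hB : ∀ i, ∀ p ∈ U ×ˢ (ball (0 : ℂ) ρ \ {0}), ∑ k, ‖B i k p‖ ≤ K)
    (heq : ∀ i, ∀ p ∈ U ×ˢ (ball (0 : ℂ) ρ \ {0}), p.2 * dħ (f i) p = ∑ k, B i k p * f k p)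
    (i : ι) :
    ∃ g : Y × ℂ → ℂ, ContMDiffOn modelYΩ 𝓘(ℂ, ℂ) ω g (U ×ˢ ball 0 ρ) ∧
      ∀ p, p.2 ≠ 0 → g p = p.2 ^ K * f i p := by
  have ho : IsOpen (U ×ˢ (ball (0 : ℂ) ρ \ {0})) :=
    hU.prod (isOpen_ball.sdiff isClosed_singleton)
  refine exists_extension hU ((contMDiffOn_snd.pow K).mul (hf i)) fun y hy => ?_
  have hd : ∀ z ∈ ball (0 : ℂ) ρ, z ≠ 0 → HasDerivAt (fun z i => f i (y, z))
      (fun i => dħ (f i) (y, z)) z := by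
    intro z hz hz0
    rw [hasDerivAt_pi]
    intro i
    exact (((hf i).contMDiffAt (ho.mem_nhds (mk_mem_prod hy ⟨hz, hz0⟩))).differentiableAt_slice).hasDerivAt
  obtain ⟨C, hC⟩ := norm_pow_smul_le_of_norm_deriv_le hρ (K := K) hd fun z hz hz0 => by
    refine (pi_norm_le_iff_of_nonneg (by positivity)).2 fun i => ?_
    have h1 := heq i (y, z) ⟨hy, hz, hz0⟩
    rw [Pi.smul_apply, smul_eq_mul]
    refine (congrArg norm h1).le.trans ((norm_sum_le _ _).trans ?_)
    refine le_trans (Finset.sum_le_sum fun k _ => ?_)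
      ((Finset.sum_mul Finset.univ (fun k => ‖B i k (y, z)‖) ‖fun i => f i (y, z)‖).symm.le.trans
        (mul_le_mul_of_nonneg_right (hB i (y, z) ⟨hy, hz, hz0⟩) (norm_nonneg _)))
    rw [norm_mul]
    exact mul_le_mul_of_nonneg_left (norm_le_pi_norm (fun i => f i (y, z)) k) (norm_nonneg _)
  refine ⟨C, hC.mono fun z hz => (?_ : _ ≤ ‖z ^ K • fun i => f i (y, z)‖).trans hz⟩
  exact norm_le_pi_norm (z ^ K • fun i => f i (y, z)) i

/-- Division by `ħ`. -/
theorem exists_eq_add_mul {U : Set Y} (hU : IsOpen U) {ρ : ℝ} (hρ : 0 < ρ) {R : Y × ℂ → ℂ}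
    (hR : ContMDiffOn modelYΩ 𝓘(ℂ, ℂ) ω R (U ×ˢ ball 0 ρ)) :
    ∃ R' : Y × ℂ → ℂ, ContMDiffOn modelYΩ 𝓘(ℂ, ℂ) ω R' (U ×ˢ ball 0 ρ) ∧
      ∀ p, R p = R (p.1, 0) + p.2 * R' p := by
  have hs : ContMDiffOn 𝓘(ℂ, ℂ) 𝓘(ℂ, ℂ) ω (fun y => R (y, 0)) U := fun y hy =>
    ((hR.contMDiffAt ((hU.prod isOpen_ball).mem_nhds
      (mk_mem_prod hy (mem_ball_self hρ)))).slice_left).contMDiffWithinAt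
  have hsub : U ×ˢ (ball (0 : ℂ) ρ \ {0}) ⊆ U ×ˢ ball 0 ρ := prod_mono Subset.rfl sdiff_subset
  have hinv : ContMDiffOn modelYΩ 𝓘(ℂ, ℂ) ω (fun p : Y × ℂ => p.2⁻¹)
      (U ×ˢ (ball (0 : ℂ) ρ \ {0})) := by
    intro p hp
    have h2 : ContDiffAt ℂ ω (fun w : ℂ => w⁻¹) p.2 := contDiffAt_id.inv hp.2.2
    exact (h2.contMDiffAt.comp p contMDiffAt_snd).contMDiffWithinAt
  obtain ⟨R', hR', h⟩ := exists_extension hU (f := fun p => p.2⁻¹ * (R p - R (p.1, 0)))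
    (hinv.mul ((hR.mono hsub).sub (hs.comp contMDiffOn_fst fun p hp => hp.1))) fun y hy => by
      -- The quotient is the slope of R at ħ = 0, which converges and is therefore bounded, so the
      -- singularity is removable.
      have h1 := ((hR.contMDiffAt ((hU.prod isOpen_ball).mem_nhds
        (mk_mem_prod hy (mem_ball_self hρ)))).differentiableAt_slice).hasDerivAt
      have h2 := (hasDerivAt_iff_tendsto_slope.1 h1).norm.isBoundedUnder_le
      obtain ⟨C, hC⟩ := h2
      refine ⟨C, (Filter.eventually_map.1 hC).mono fun z hz => ?_⟩
      simpa [slope, vsub_eq_sub] using hz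
  refine ⟨R', hR', fun p => ?_⟩
  by_cases hp : p.2 = 0
  · rw [hp, zero_mul, add_zero, ← hp]
  · rw [h p hp, mul_inv_cancel_left₀ hp]
    ring

/-- Taylor expansion in `ħ` with holomorphic parameters. -/
theorem exists_taylor {U : Set Y} (hU : IsOpen U) {ρ : ℝ} (hρ : 0 < ρ) {G : Y × ℂ → ℂ}
    (hG : ContMDiffOn modelYΩ 𝓘(ℂ, ℂ) ω G (U ×ˢ ball 0 ρ)) (M : ℕ) :
    ∃ (a : ℕ → Y → ℂ) (R : Y × ℂ → ℂ), (∀ n, ContMDiffOn 𝓘(ℂ, ℂ) 𝓘(ℂ, ℂ) ω (a n) U) ∧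
      ContMDiffOn modelYΩ 𝓘(ℂ, ℂ) ω R (U ×ˢ ball 0 ρ) ∧
      ∀ p, G p = ∑ n ∈ Finset.range M, p.2 ^ n * a n p.1 + p.2 ^ M * R p := by
  induction M with
  | zero => exact ⟨fun _ _ => 0, G, fun _ => contMDiffOn_const, hG, fun p => by simp⟩
  | succ M ih =>
    obtain ⟨a, R, ha, hR, h⟩ := ih
    obtain ⟨R', hR', h'⟩ := exists_eq_add_mul hU hρ hR
    refine ⟨Function.update a M fun y => R (y, 0), R', fun n => ?_, hR', fun p => ?_⟩
    · by_cases hn : n = M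
      · subst hn
        rw [Function.update_self]
        exact fun y hy => ((hR.contMDiffAt ((hU.prod isOpen_ball).mem_nhds
          (mk_mem_prod hy (mem_ball_self hρ)))).slice_left).contMDiffWithinAt
      · rw [Function.update_of_ne hn]
        exact ha n
    · rw [h p, h' p, Finset.sum_range_succ, Function.update_self]
      have : ∀ n ∈ Finset.range M, p.2 ^ n * Function.update a M (fun y => R (y, 0)) n p.1 =
          p.2 ^ n * a n p.1 := fun n hn => by
        rw [Function.update_of_ne (Finset.mem_range.1 hn).ne]
      rw [Finset.sum_congr rfl this]
      ring

end RegularSingular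
end

noncomputable section

/-! ### Separation of exponents -/

section Exponents

open Set Module HolBundle Metric

variable {Y : Type v} [TopologicalSpace Y] [ChartedSpace ℂ Y] [IsManifold 𝓘(ℂ, ℂ) ω Y]
  {T : SmoothTriple.{u} Y} {S : IntegrableStructure T}

namespace IntegrableStructure.TrivialMonodromy

variable (hS : S.TrivialMonodromy)

/-- The section `ħ^d v` extends holomorphically to `W`. -/
def Extends (d : ℤ) (W : Set (Y × ℂ)) (v : ∀ y, (T.E.slice 1).fib y) : Prop :=
  ∃ m, T.E.Hol W m ∧ ∀ p ∈ W, ∀ hp : p.2 ≠ 0, m p = hS.transport p hp (p.2 ^ d • v p.1)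

variable {hS}

theorem extends_iff_ext {W : Set (Y × ℂ)} {d : ℤ} {v : ∀ y, (T.E.slice 1).fib y} :
    hS.Extends d W v ↔ ∃ m, T.E.Hol W m ∧ ∀ p ∈ W, p.2 ≠ 0 → m p = p.2 ^ d • hS.ext v p := by
  refine exists_congr fun m => and_congr_right fun _ => forall₂_congr fun p _ =>
    forall_congr' fun hp => ?_
  rw [map_smul, ext_of_ne _ _ _ hp]

/-- If a sum of terms with distinct exponents extends across `ħ = 0`, so does each term. -/
theorem extends_of_sum (hlog : S.IsLogarithmic) {ι : Type*} {W : Set (Y × ℂ)} (hW : IsOpen W)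
    {U : Set Y} (hU : IsOpen U) (hWU : ∀ p ∈ W, p.1 ∈ U) {d : ι → ℤ} (hd : Function.Injective d)
    (s : Finset ι) : ∀ {v : ι → ∀ y, (T.E.slice 1).fib y},
    (∀ i ∈ s, (T.E.slice 1).Hol U (v i)) → ∀ {m : ∀ p, T.E.fib p}, T.E.Hol W m →
    (∀ p ∈ W, p.2 ≠ 0 → m p = ∑ i ∈ s, p.2 ^ d i • hS.ext (v i) p) →
    ∀ i ∈ s, hS.Extends (d i) W (v i) := by
  classical
  induction s using Finset.induction_on with
  | empty => simp
  | insert k s hk ih =>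
    intro v hv m hm hmv
    have ho : IsOpen (W ∩ {p | p.2 ≠ 0}) :=
      hW.inter (isOpen_ne_fun continuous_snd continuous_const)
    have hsub : W ∩ {p | p.2 ≠ 0} ⊆ U ×ˢ {0}ᶜ := fun p hp => ⟨hWU p hp.1, hp.2⟩
    have hz : ∀ i, ContMDiffOn modelYΩ 𝓘(ℂ, ℂ) ω (fun p : Y × ℂ => p.2 ^ d i)
        (W ∩ {p | p.2 ≠ 0}) := fun i => contMDiffOn_zpow_snd (fun p hp => hp.2) (d i)
    have hh : ∀ i ∈ insert k s, S.IsHorizontal (W ∩ {p | p.2 ≠ 0}) (hS.ext (v i)) := fun i hi =>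
      (hS.isHorizontal_ext hU (hv i hi)).mono hsub
    -- The section n is ħ∂_ħ m: the term of exponent `d i` gets multiplied by `d i`.
    obtain ⟨n, hn, hmn⟩ := hlog W hW m hm
    have hnv : ∀ p ∈ W, p.2 ≠ 0 →
        n p = ∑ i ∈ insert k s, ((d i : ℂ) * p.2 ^ d i) • hS.ext (v i) p := by
      intro p hp hp0
      refine smul_right_injective _ hp0 ?_
      change p.2 • n p = p.2 • _
      rw [← hmn p hp, S.δ_local _ ho m (fun p => ∑ i ∈ insert k s, p.2 ^ d i • hS.ext (v i) p)
        (hm.mono inter_subset_left) (Hol.sum fun i hi => Hol.smul (hz i) (hh i hi).hol)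
        (fun q hq => hmv q hq.1 hq.2) p ⟨hp, hp0⟩,
        S.δ_sum _ ho (fun i hi => Hol.smul (hz i) (hh i hi).hol) ⟨hp, hp0⟩, Finset.smul_sum]
      refine Finset.sum_congr rfl fun i hi => ?_
      rw [S.δ_leibniz _ ho _ _ (hz i) (hh i hi).hol p ⟨hp, hp0⟩,
        (hh i hi).δ_eq_zero p ⟨hp, hp0⟩, smul_zero, zero_add,
        (hasDerivAt_zpow (d i) p.2 (Or.inl hp0)).deriv, smul_smul, zpow_sub_one₀ hp0]
      congr 1
      field_simp
    have key : ∀ i ∈ s, hS.Extends (d i) W (v i) := by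
      -- Passing to n - d_k m removes the k-th term and multiplies the others by d_i - d_k, which is
      -- non-zero by injectivity of `d`. This is a Vandermonde argument by induction on the number
      -- of terms.
      have h1 := ih (v := fun i y => ((d i : ℂ) - d k) • v i y)
        (fun i hi => (hv i (Finset.mem_insert_of_mem hi)).const_smul _)
        (m := fun p => n p - (d k : ℂ) • m p) (hn.sub (hm.const_smul _)) fun p hp hp0 => by
          rw [hnv p hp hp0, hmv p hp hp0, Finset.smul_sum, ← Finset.sum_sub_distrib,
            Finset.sum_insert hk]
          have h2 : ((d k : ℂ) * p.2 ^ d k) • hS.ext (v k) p -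
              (d k : ℂ) • p.2 ^ d k • hS.ext (v k) p = 0 := by rw [smul_smul, sub_self]
          rw [h2, zero_add]
          refine Finset.sum_congr rfl fun i _ => ?_
          rw [ext_of_ne _ _ _ hp0, ext_of_ne _ _ _ hp0, map_smul]
          module
      intro i hi
      obtain ⟨m', hm', h2⟩ := extends_iff_ext.1 (h1 i hi)
      have h3 : (d i : ℂ) - d k ≠ 0 := by
        rw [sub_ne_zero]
        intro h
        exact hk (hd (Int.cast_injective h) ▸ hi)
      refine extends_iff_ext.2 ⟨fun p => ((d i : ℂ) - d k)⁻¹ • m' p, hm'.const_smul _,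
        fun p hp hp0 => ?_⟩
      beta_reduce
      rw [h2 p hp hp0, ext_of_ne _ _ _ hp0, ext_of_ne _ _ _ hp0, map_smul, smul_comm (p.2 ^ d i),
        inv_smul_smul₀ h3]
    intro i hi
    rcases Finset.mem_insert.1 hi with rfl | hi
    · choose! m' hm' h2 using fun i hi => extends_iff_ext.1 (key i hi)
      refine extends_iff_ext.2 ⟨fun p => m p - ∑ i ∈ s, m' i p, hm.sub (Hol.sum hm'),
        fun p hp hp0 => ?_⟩
      beta_reduce
      rw [hmv p hp hp0, Finset.sum_insert hk, Finset.sum_congr rfl fun i hi => h2 i hi p hp hp0,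
        add_sub_cancel_right]
    · exact key i hi

end IntegrableStructure.TrivialMonodromy

end Exponents
end

noncomputable section

/-! ### Frames adapted to the grading by the exponents -/

section Adapted

open Set Module HolBundle Metric

variable {Y : Type v} [TopologicalSpace Y] [ChartedSpace ℂ Y] [IsManifold 𝓘(ℂ, ℂ) ω Y]
  {T : SmoothTriple.{u} Y} {S : IntegrableStructure T}

theorem exists_box {N : Set (Y × ℂ)} (hN : IsOpen N) {y₀ : Y} {z₀ : ℂ} (h : (y₀, z₀) ∈ N) :
    ∃ (U : Set Y) (ρ : ℝ), IsOpen U ∧ y₀ ∈ U ∧ 0 < ρ ∧ U ×ˢ ball z₀ ρ ⊆ N := by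
  obtain ⟨U, V, hU, hV, hyU, hzV, hUV⟩ := isOpen_prod_iff.1 hN y₀ z₀ h
  obtain ⟨ρ, hρ, hρV⟩ := Metric.isOpen_iff.1 hV z₀ hzV
  exact ⟨U, ρ, hU, hyU, hρ, (prod_mono Subset.rfl hρV).trans hUV⟩

namespace IntegrableStructure

/-- A local frame together with a bound for the matrix of `ħ∂_ħ`. -/
theorem IsLogarithmic.exists_frame (hlog : S.IsLogarithmic) {y₀ : Y} {U₁ : Set Y}
    (hU₁ : IsOpen U₁) (hy₀ : y₀ ∈ U₁) :
    ∃ (U : Set Y) (ρ : ℝ) (e : Fin T.rank → ∀ p, T.E.fib p) (B : Fin T.rank → Fin T.rank →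
      Y × ℂ → ℂ) (K : ℕ), IsOpen U ∧ y₀ ∈ U ∧ U ⊆ U₁ ∧ 0 < ρ ∧ T.E.IsFrame (U ×ˢ ball 0 ρ) e ∧
      (∀ i, ∀ p ∈ U ×ˢ ball (0 : ℂ) ρ, S.δ (e i) p = p.2 • ∑ k, B i k p • e k p) ∧
      (∀ i, ∀ p ∈ U ×ˢ ball (0 : ℂ) ρ, ∑ k, ‖B i k p‖ ≤ K) ∧
      (∀ k, ∀ p ∈ U ×ˢ ball (0 : ℂ) ρ, ∑ i, ‖B i k p‖ ≤ K) := by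
  obtain ⟨N, e, hN, hpN, he⟩ := T.E.exists_isFrame (y₀, (0 : ℂ))
  choose n hn hen using fun i => hlog N hN (e i) (he.contMDiffOn i)
  let B : Fin T.rank → Fin T.rank → Y × ℂ → ℂ := fun i k p => he.coeff k p (n i p)
  have hB : ∀ i k, ContinuousOn (B i k) N := fun i k =>
    (HolBundle.IsFrame.contMDiffOn_coeff hN Subset.rfl he (hn i) k).continuousOn
  -- The sum of all entries bounds row sums and column sums at once. Rows control the system
  -- expressing `e` in parallel sections, columns the transposed system for the inverse change of
  -- frame.
  let b : Y × ℂ → ℝ := fun p => ∑ i, ∑ k, ‖B i k p‖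
  have hb : ContinuousOn b N :=
    continuousOn_finsetSum _ fun i _ => continuousOn_finsetSum _ fun k _ => (hB i k).norm
  obtain ⟨K, hK⟩ := exists_nat_gt (b (y₀, 0))
  have ho : IsOpen ((N ∩ b ⁻¹' Iio (K : ℝ)) ∩ Prod.fst ⁻¹' U₁) :=
    (hb.isOpen_inter_preimage hN isOpen_Iio).inter (hU₁.preimage continuous_fst)
  obtain ⟨U, ρ, hU, hyU, hρ, hsub⟩ := exists_box ho (y₀ := y₀) (z₀ := 0) ⟨⟨hpN, hK⟩, hy₀⟩
  refine ⟨U, ρ, e, B, K, hU, hyU, fun y hy => (hsub (mk_mem_prod hy (mem_ball_self hρ))).2, hρ,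
    he.mono fun p hp => (hsub hp).1.1, fun i p hp => ?_, fun i p hp => ?_, fun k p hp => ?_⟩
  · rw [hen i p (hsub hp).1.1]
    congr 1
    exact HolBundle.IsFrame.sum_coeff he (hsub hp).1.1 _
  · exact (Finset.single_le_sum (f := fun i => ∑ k, ‖B i k p‖)
      (fun i _ => Finset.sum_nonneg fun k _ => norm_nonneg _) (Finset.mem_univ i)).trans
      (hsub hp).1.2.le
  · refine le_trans ?_ (hsub hp).1.2.le
    exact Finset.sum_le_sum fun i _ => Finset.single_le_sum (f := fun k => ‖B i k p‖)
      (fun k _ => norm_nonneg _) (Finset.mem_univ k)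

namespace TrivialMonodromy

variable (hS : S.TrivialMonodromy)

theorem linearIndependent_transport {ι : Type*} {p : Y × ℂ} (hp : p.2 ≠ 0) (d : ι → ℤ)
    (x : ι → (T.E.slice 1).fib p.1) :
    LinearIndependent ℂ (fun i => hS.transport p hp (p.2 ^ d i • x i)) ↔
      LinearIndependent ℂ x := by
  have h1 := LinearMap.linearIndependent_iff (hS.transport p hp).toLinearMap
    (v := fun i => p.2 ^ d i • x i) (LinearEquiv.ker _)
  have h2 := LinearIndependent.units_smul_iff x fun i =>
    Units.mk0 (p.2 ^ d i) (zpow_ne_zero (d i) hp)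
  exact h1.trans h2

theorem isFrame_ext {U : Set Y} (hU : IsOpen U) {w : Fin T.rank → ∀ y, (T.E.slice 1).fib y}
    (hw : (T.E.slice 1).IsFrame U w) : T.E.IsFrame (U ×ˢ {0}ᶜ) fun j => hS.ext (w j) := by
  refine isFrame_of_linearIndependent (fun j => hS.hol_ext hU (hw.contMDiffOn j)) fun p hp => ?_
  have := (hS.linearIndependent_transport (p := p) hp.2 (fun _ => 0) fun j => w j p.1).2
    (hw.linearIndependent hp.1)
  simp only [zpow_zero, one_smul] at this
  exact this

/-- Expansion of a frame in parallel sections. -/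
theorem exists_expansion_frame {U : Set Y} (hU : IsOpen U) {ρ : ℝ} (hρ : 0 < ρ) {e : Fin T.rank → ∀ p, T.E.fib p}
    (he : T.E.IsFrame (U ×ˢ ball 0 ρ) e) {w : Fin T.rank → ∀ y, (T.E.slice 1).fib y}
    (hw : (T.E.slice 1).IsFrame U w) {B : Fin T.rank → Fin T.rank → Y × ℂ → ℂ} {K : ℕ}
    (hB : ∀ i, ∀ p ∈ U ×ˢ ball (0 : ℂ) ρ, S.δ (e i) p = p.2 • ∑ k, B i k p • e k p)
    (hK : ∀ i, ∀ p ∈ U ×ˢ ball (0 : ℂ) ρ, ∑ k, ‖B i k p‖ ≤ K) :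
    ∃ G : Fin T.rank → Fin T.rank → Y × ℂ → ℂ,
      (∀ i j, ContMDiffOn modelYΩ 𝓘(ℂ, ℂ) ω (G i j) (U ×ˢ ball 0 ρ)) ∧
      ∀ i, ∀ p ∈ U ×ˢ ball (0 : ℂ) ρ, p.2 ≠ 0 →
        p.2 ^ K • e i p = ∑ j, G i j p • hS.ext (w j) p := by
  have hv := hS.isFrame_ext hU hw
  have ho : IsOpen (U ×ˢ (ball (0 : ℂ) ρ \ {0})) :=
    hU.prod (isOpen_ball.sdiff isClosed_singleton)
  have hs1 : U ×ˢ (ball (0 : ℂ) ρ \ {0}) ⊆ U ×ˢ {0}ᶜ := prod_mono Subset.rfl fun z hz => hz.2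
  have hs2 : U ×ˢ (ball (0 : ℂ) ρ \ {0}) ⊆ U ×ˢ ball 0 ρ := prod_mono Subset.rfl fun z hz => hz.1
  have hei : ∀ i, T.E.Hol (U ×ˢ (ball (0 : ℂ) ρ \ {0})) (e i) := fun i =>
    (he.contMDiffOn i).mono hs2
  let f : Fin T.rank → Fin T.rank → Y × ℂ → ℂ := fun i j p => hv.coeff j p (e i p)
  have hf : ∀ i j, ContMDiffOn modelYΩ 𝓘(ℂ, ℂ) ω (f i j) (U ×ˢ (ball (0 : ℂ) ρ \ {0})) :=
    fun i j => HolBundle.IsFrame.contMDiffOn_coeff ho hs1 hv (hei i) j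
  have hef : ∀ i, ∀ p ∈ U ×ˢ (ball (0 : ℂ) ρ \ {0}), e i p = ∑ j, f i j p • hS.ext (w j) p :=
    fun i p hp => HolBundle.IsFrame.sum_coeff hv (hs1 hp) _
  have hh : ∀ j, S.IsHorizontal (U ×ˢ (ball (0 : ℂ) ρ \ {0})) (hS.ext (w j)) := fun j =>
    (hS.isHorizontal_ext hU (hw.contMDiffOn j)).mono hs1
  -- Comparing two expressions of δ(e_i) shows that the coefficients satisfy ħ∂_ħ f = B f, so they
  -- have at most a pole of order K.
  have heq : ∀ i j, ∀ p ∈ U ×ˢ (ball (0 : ℂ) ρ \ {0}),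
      p.2 * dħ (f i j) p = ∑ k, B i k p * f k j p := by
    intro i j p hp
    have hp0 : p.2 ≠ 0 := hp.2.2
    have h1 : S.δ (e i) p = ∑ j, (p.2 ^ 2 * dħ (f i j) p) • hS.ext (w j) p := by
      rw [S.δ_local _ ho _ (fun p => ∑ j, f i j p • hS.ext (w j) p) (hei i)
        (Hol.sum fun j _ => Hol.smul (hf i j) (hh j).hol) (hef i) p hp,
        S.δ_sum_smul ho (hf i) (fun j => (hh j).hol) hp]
      refine Finset.sum_congr rfl fun j _ => ?_
      rw [(hh j).δ_eq_zero p hp, smul_zero, zero_add]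
    have h2 : S.δ (e i) p = ∑ j, (p.2 * ∑ k, B i k p * f k j p) • hS.ext (w j) p := by
      rw [hB i p (hs2 hp)]
      simp only [hef _ p hp, Finset.smul_sum, Finset.mul_sum, Finset.sum_smul, smul_smul]
      exact Finset.sum_comm
    have h3 := (HolBundle.IsFrame.coeff_eq_of_sum hv (hs1 hp) h1 j).symm.trans
      (HolBundle.IsFrame.coeff_eq_of_sum hv (hs1 hp) h2 j)
    rw [pow_two, mul_assoc] at h3
    exact mul_left_cancel₀ hp0 h3
  choose G hG hGf using fun i j => exists_extension_of_regularSingular hU hρ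
    (f := fun i => f i j) (B := B) (fun i => hf i j) (fun i p hp => hK i p (hs2 hp))
    (fun i => heq i j) i
  refine ⟨G, hG, fun i p hp hp0 => ?_⟩
  rw [hef i p ⟨hp.1, hp.2, hp0⟩, Finset.smul_sum]
  refine Finset.sum_congr rfl fun j _ => ?_
  rw [hGf i j p hp0, smul_smul]

/-- Large multiples of parallel sections extend. -/
theorem extends_of_frame {U : Set Y} (hU : IsOpen U) {ρ : ℝ} (hρ : 0 < ρ) {e : Fin T.rank → ∀ p, T.E.fib p}
    (he : T.E.IsFrame (U ×ˢ ball 0 ρ) e) {w : Fin T.rank → ∀ y, (T.E.slice 1).fib y}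
    (hw : (T.E.slice 1).IsFrame U w) {B : Fin T.rank → Fin T.rank → Y × ℂ → ℂ} {K : ℕ}
    (hB : ∀ i, ∀ p ∈ U ×ˢ ball (0 : ℂ) ρ, S.δ (e i) p = p.2 • ∑ k, B i k p • e k p)
    (hK : ∀ k, ∀ p ∈ U ×ˢ ball (0 : ℂ) ρ, ∑ i, ‖B i k p‖ ≤ K)
    (j : Fin T.rank) : hS.Extends K (U ×ˢ ball 0 ρ) (w j) := by
  have ho : IsOpen (U ×ˢ (ball (0 : ℂ) ρ \ {0})) :=
    hU.prod (isOpen_ball.sdiff isClosed_singleton)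
  have hs1 : U ×ˢ (ball (0 : ℂ) ρ \ {0}) ⊆ U ×ˢ {0}ᶜ := prod_mono Subset.rfl fun z hz => hz.2
  have hs2 : U ×ˢ (ball (0 : ℂ) ρ \ {0}) ⊆ U ×ˢ ball 0 ρ := prod_mono Subset.rfl fun z hz => hz.1
  have hei : ∀ i, T.E.Hol (U ×ˢ (ball (0 : ℂ) ρ \ {0})) (e i) := fun i =>
    (he.contMDiffOn i).mono hs2
  have hh : S.IsHorizontal (U ×ˢ (ball (0 : ℂ) ρ \ {0})) (hS.ext (w j)) :=
    (hS.isHorizontal_ext hU (hw.contMDiffOn j)).mono hs1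
  let g : Fin T.rank → Y × ℂ → ℂ := fun i p => he.coeff i p (hS.ext (w j) p)
  have hg : ∀ i, ContMDiffOn modelYΩ 𝓘(ℂ, ℂ) ω (g i) (U ×ˢ (ball (0 : ℂ) ρ \ {0})) :=
    fun i => HolBundle.IsFrame.contMDiffOn_coeff ho hs2 he hh.hol i
  have hwg : ∀ p ∈ U ×ˢ (ball (0 : ℂ) ρ \ {0}), hS.ext (w j) p = ∑ i, g i p • e i p :=
    fun p hp => HolBundle.IsFrame.sum_coeff he (hs2 hp) _
  -- Horizontality of the extension of `w j` gives the system with matrix the transpose of -B for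
  -- its coordinates in `e`.
  have heq : ∀ k, ∀ p ∈ U ×ˢ (ball (0 : ℂ) ρ \ {0}),
      p.2 * dħ (g k) p = ∑ i, -B i k p * g i p := by
    intro k p hp
    have hp0 : p.2 ≠ 0 := hp.2.2
    have h1 : (0 : T.E.fib p) =
        ∑ k, (p.2 * ((∑ i, B i k p * g i p) + p.2 * dħ (g k) p)) • e k p := by
      rw [← hh.δ_eq_zero p hp, S.δ_local _ ho _ (fun p => ∑ i, g i p • e i p) hh.hol
        (Hol.sum fun i _ => Hol.smul (hg i) (hei i)) hwg p hp, S.δ_sum_smul ho hg hei hp,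
        Finset.sum_add_distrib]
      simp only [hB _ p (hs2 hp), mul_add, add_smul, Finset.sum_add_distrib, Finset.smul_sum,
        Finset.mul_sum, Finset.sum_smul, smul_smul]
      refine congrArg₂ _ (Finset.sum_comm.trans ?_) ?_
      · refine Finset.sum_congr rfl fun k _ => Finset.sum_congr rfl fun i _ => ?_
        congr 1
        ring
      · refine Finset.sum_congr rfl fun k _ => ?_
        congr 1
        ring
    have h2 := HolBundle.IsFrame.coeff_eq_of_sum he (hs2 hp) h1 k
    rw [map_zero] at h2
    have h3 := (mul_eq_zero.1 h2.symm).resolve_left hp0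
    simp only [neg_mul, Finset.sum_neg_distrib]
    linear_combination h3
  choose H hH hHg using fun i => exists_extension_of_regularSingular hU hρ
    (f := g) (B := fun k i p => -B i k p) hg
    (fun k p hp => by simpa only [norm_neg] using hK k p (hs2 hp)) heq i
  refine extends_iff_ext.2 ⟨fun p => ∑ i, H i p • e i p,
    Hol.sum fun i _ => Hol.smul (hH i) (he.contMDiffOn i), fun p hp hp0 => ?_⟩
  rw [hwg p ⟨hp.1, hp.2, hp0⟩, Finset.smul_sum, zpow_natCast]
  refine Finset.sum_congr rfl fun i _ => ?_
  rw [hHg i p hp0, smul_smul]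

end TrivialMonodromy

end IntegrableStructure

end Adapted
end

/-! ### Generators and local frames of the form ħ^d u. -/

noncomputable section

section AdaptedFrame

open Set Module HolBundle Metric

variable {Y : Type v} [TopologicalSpace Y] [ChartedSpace ℂ Y] [IsManifold 𝓘(ℂ, ℂ) ω Y]
  {T : SmoothTriple.{u} Y} {S : IntegrableStructure T}

theorem exists_linearIndependent_fin {ι V : Type*} [Finite ι] [AddCommGroup V] [Module ℂ V] {r : ℕ}
    (hr : finrank ℂ V = r) {x : ι → V} (hx : ⊤ ≤ Submodule.span ℂ (range x)) :
    ∃ j : Fin r → ι, LinearIndependent ℂ fun l => x (j l) := by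
  obtain ⟨κ, a, ha, hspan, hli⟩ := exists_linearIndependent' ℂ x
  have := Finite.of_injective a ha
  have := Fintype.ofFinite κ
  have hcard : Fintype.card κ = r := by
    rw [← hr, finrank_eq_card_basis (Basis.mk hli (hspan ▸ hx))]
  exact ⟨a ∘ (Fintype.equivFinOfCardEq hcard).symm,
    hli.comp _ (Fintype.equivFinOfCardEq hcard).symm.injective⟩

namespace IntegrableStructure.TrivialMonodromy

variable (hS : S.TrivialMonodromy)

/-- A system of generators of `H'` near a point of `ħ = 0` made of extensions of sections
`ħ^d u`. -/
theorem exists_generators (hlog : S.IsLogarithmic) (y₀ : Y) :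
    ∃ (U : Set Y) (ρ : ℝ) (ι : Type) (_ : Fintype ι) (d : ι → ℤ)
      (u : ι → ∀ y, (T.E.slice 1).fib y) (f : ι → ∀ p, T.E.fib p), IsOpen U ∧ y₀ ∈ U ∧ 0 < ρ ∧
      (∀ i, (T.E.slice 1).Hol U (u i)) ∧ (∀ i, T.E.Hol (U ×ˢ ball 0 ρ) (f i)) ∧
      (∀ i, ∀ p ∈ U ×ˢ ball (0 : ℂ) ρ, p.2 ≠ 0 → f i p = p.2 ^ d i • hS.ext (u i) p) ∧
      ⊤ ≤ Submodule.span ℂ (range fun i => f i (y₀, 0)) := by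
  obtain ⟨U₁, w, hU₁, hy₁, hw₁⟩ := (T.E.slice 1).exists_isFrame y₀
  obtain ⟨U, ρ, e, B, K, hU, hyU, hUU₁, hρ, he, hB, hK, hK'⟩ := hlog.exists_frame hU₁ hy₁
  have hw : (T.E.slice 1).IsFrame U w := hw₁.mono hUU₁
  have hW : IsOpen (U ×ˢ ball (0 : ℂ) ρ) := hU.prod isOpen_ball
  obtain ⟨G, hG, heG⟩ := hS.exists_expansion_frame hU hρ he hw hB hK
  choose b hb hbw using fun j => extends_iff_ext.1 (hS.extends_of_frame hU hρ he hw hB hK' j)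
  -- The order 2K is chosen for the remainder. As ħ^K e_i has coefficients G_ij, the remainder
  -- contributes to e_i the term ħ^K R_ij w_j = R_ij b_j, already holomorphic; the rest is a Laurent
  -- sum with exponents n - K, to which `extends_of_sum` applies.
  choose a R ha hR hGa using fun i j => exists_taylor hU hρ (hG i j) (2 * K)
  let x : Fin T.rank → ℕ → ∀ y, (T.E.slice 1).fib y := fun i n y => ∑ j, a i j n y • w j y
  have hx : ∀ i n, (T.E.slice 1).Hol U (x i n) := fun i n =>
    Hol.sum fun j _ => Hol.smul (ha i j n) (hw.contMDiffOn j)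
  have hRb : ∀ i, T.E.Hol (U ×ˢ ball 0 ρ) fun p => ∑ j, R i j p • b j p := fun i =>
    Hol.sum fun j _ => Hol.smul (hR i j) (hb j)
  have hsum : ∀ i, ∀ p ∈ U ×ˢ ball (0 : ℂ) ρ, p.2 ≠ 0 → e i p - ∑ j, R i j p • b j p =
      ∑ n ∈ Finset.range (2 * K), p.2 ^ ((n : ℤ) - K) • hS.ext (x i n) p := by
    intro i p hp hp0
    have hpK : p.2 ^ K ≠ 0 := pow_ne_zero K hp0
    have h1 : ∀ n, hS.ext (x i n) p = ∑ j, a i j n p.1 • hS.ext (w j) p := fun n => by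
      rw [ext_of_ne _ _ _ hp0, map_sum]
      refine Finset.sum_congr rfl fun j _ => ?_
      rw [map_smul, ext_of_ne _ _ _ hp0]
    refine smul_right_injective _ hpK ?_
    change p.2 ^ K • (_ - _) = p.2 ^ K • _
    rw [smul_sub, heG i p hp hp0, Finset.smul_sum, Finset.smul_sum, ← Finset.sum_sub_distrib]
    have h2 : ∀ n ∈ Finset.range (2 * K), p.2 ^ K • p.2 ^ ((n : ℤ) - K) • hS.ext (x i n) p =
        ∑ j, (p.2 ^ n * a i j n p.1) • hS.ext (w j) p := fun n _ => by
      rw [h1, smul_smul, ← zpow_natCast, ← zpow_add₀ hp0, add_sub_cancel, zpow_natCast,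
        Finset.smul_sum]
      simp only [smul_smul]
    rw [Finset.sum_congr rfl h2, Finset.sum_comm]
    refine Finset.sum_congr rfl fun j _ => ?_
    rw [hbw j p hp hp0, hGa i j p, ← Finset.sum_smul, smul_smul, smul_smul, ← sub_smul,
      zpow_natCast]
    congr 1
    ring
  have hc : ∀ i, ∀ n : Fin (2 * K), ∃ m, T.E.Hol (U ×ˢ ball 0 ρ) m ∧
      ∀ p ∈ U ×ˢ ball (0 : ℂ) ρ, p.2 ≠ 0 → m p = p.2 ^ ((n : ℤ) - K) • hS.ext (x i n) p :=
    fun i n => extends_iff_ext.1 (extends_of_sum hlog hW hU (fun p hp => hp.1)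
      (d := fun n : ℕ => (n : ℤ) - K) (fun n n' h => by simpa using h) (Finset.range (2 * K))
      (v := x i) (fun n _ => hx i n) (Hol.sub (he.contMDiffOn i) (hRb i)) (hsum i) n
      (Finset.mem_range.2 n.2))
  choose c hc hcx using hc
  refine ⟨U, ρ, (Fin T.rank × Fin (2 * K)) ⊕ Fin T.rank, inferInstance,
    Sum.elim (fun q => (q.2 : ℤ) - K) (fun _ => K), Sum.elim (fun q => x q.1 q.2) w,
    Sum.elim (fun q => c q.1 q.2) b, hU, hyU, hρ, ?_, ?_, ?_, ?_⟩
  · rintro (q | j)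
    exacts [hx _ _, hw.contMDiffOn j]
  · rintro (q | j)
    exacts [hc _ _, hb j]
  · rintro (q | j)
    exacts [hcx _ _, hbw j]
  · have hp₀ : (y₀, (0 : ℂ)) ∈ U ×ˢ ball (0 : ℂ) ρ := mk_mem_prod hyU (mem_ball_self hρ)
    refine (he.generating hp₀).trans (Submodule.span_le.2 ?_)
    rintro _ ⟨i, rfl⟩
    have h1 : e i (y₀, 0) = ∑ n, c i n (y₀, 0) + ∑ j, R i j (y₀, 0) • b j (y₀, 0) := by
      refine Hol.eq_of_eq_off_zero hW (he.contMDiffOn i)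
        (n := fun p => ∑ n, c i n p + ∑ j, R i j p • b j p)
        ((Hol.sum fun n _ => hc i n).add (hRb i)) (fun p hp hp0 => ?_) _ hp₀
      rw [← sub_eq_iff_eq_add, hsum i p hp hp0, Finset.sum_range]
      exact Finset.sum_congr rfl fun n _ => (hcx i n p hp hp0).symm
    change e i (y₀, 0) ∈ _
    rw [h1]
    refine Submodule.add_mem _ (Submodule.sum_mem _ fun n _ => ?_)
      (Submodule.sum_mem _ fun j _ => Submodule.smul_mem _ _ ?_)
    exacts [Submodule.subset_span ⟨Sum.inl (i, n), rfl⟩, Submodule.subset_span ⟨Sum.inr j, rfl⟩]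

/-- A frame of `V` near `y₀` and a frame of `H'` given by the sections `ħ^d u`. -/
structure AdaptedFrame (U : Set Y) where
  d : Fin T.rank → ℤ
  u : Fin T.rank → ∀ y, (T.E.slice 1).fib y
  f : Fin T.rank → ∀ p, T.E.fib p
  isOpen : IsOpen U
  isFrame_u : (T.E.slice 1).IsFrame U u
  isFrame_f : T.E.IsFrame (Prod.fst ⁻¹' U) f
  f_eq : ∀ j p, p.1 ∈ U → ∀ hp : p.2 ≠ 0, f j p = hS.transport p hp (p.2 ^ d j • u j p.1)

/-- Generators independent at (y₀, 0) remain a frame of `H'` nearby. As each has the form ħ^d u,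
comparison at one small non-zero ħ shows that the u form a frame of V, and this makes the sections
ħ^d u a frame for all ħ. -/
theorem exists_adaptedFrame (hlog : S.IsLogarithmic) (y₀ : Y) :
    ∃ U, y₀ ∈ U ∧ Nonempty (hS.AdaptedFrame U) := by
  obtain ⟨U₁, ρ, ι, _, d, u, f, hU₁, hy₁, hρ, hu, hf, hfu, hspan⟩ := hS.exists_generators hlog y₀
  have hp₀ : (y₀, (0 : ℂ)) ∈ U₁ ×ˢ ball (0 : ℂ) ρ := mk_mem_prod hy₁ (mem_ball_self hρ)
  obtain ⟨j, hj⟩ := exists_linearIndependent_fin (HolBundle.finrank_fib _) hspan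
  obtain ⟨N, hNW, hN, hpN, hfr⟩ := exists_isFrame_of_linearIndependent_at
    (hU₁.prod isOpen_ball) hp₀ (e := fun l => f (j l)) (fun l => hf (j l)) hj
  obtain ⟨U, ε, hU, hyU, hε, hsub⟩ := exists_box hN hpN
  have hUU₁ : U ⊆ U₁ := fun y hy => (hNW (hsub (mk_mem_prod hy (mem_ball_self hε)))).1
  -- Any non-zero ħ in the disc would do; ε/2 is one.
  have hli : ∀ y ∈ U, LinearIndependent ℂ fun l => u (j l) y := by
    intro y hy
    have hz : ((ε / 2 : ℝ) : ℂ) ∈ ball (0 : ℂ) ε := by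
      rw [mem_ball_zero_iff, norm_real, Real.norm_of_nonneg (by positivity)]
      exact half_lt_self hε
    have hz0 : ((ε / 2 : ℝ) : ℂ) ≠ 0 := ofReal_ne_zero.2 (by positivity)
    have hp := hsub (mk_mem_prod hy hz)
    have h1 := hfr.linearIndependent hp
    rw [← hS.linearIndependent_transport (p := (y, ((ε / 2 : ℝ) : ℂ))) hz0 fun l => d (j l)]
    have h2 : (fun l => f (j l) (y, ((ε / 2 : ℝ) : ℂ))) = fun l =>
        hS.transport (y, ((ε / 2 : ℝ) : ℂ)) hz0 (((ε / 2 : ℝ) : ℂ) ^ d (j l) • u (j l) y) :=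
      funext fun l => by
        rw [hfu _ _ (hNW hp) hz0, map_smul]
        rfl
    rw [h2] at h1
    exact h1
  have hu' : ∀ l, (T.E.slice 1).Hol U (u (j l)) := fun l => (hu (j l)).mono hUU₁
  -- Near ħ = 0 the generator itself is used; elsewhere the expression ħ^d u is already holomorphic.
  -- This extends the frame from a small disc to all of ℂ.
  have hext : ∀ l, ∃ m, T.E.Hol (Prod.fst ⁻¹' U) m ∧
      ∀ p : Y × ℂ, p.2 ≠ 0 → m p = p.2 ^ d (j l) • hS.ext (u (j l)) p := by
    intro l
    refine exists_hol_of_locally (hU.preimage continuous_fst) fun p hp => ?_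
    by_cases hp0 : p.2 = 0
    · refine ⟨U ×ˢ ball 0 ε, f (j l), hU.prod isOpen_ball,
        ⟨hp, by rw [hp0]; exact mem_ball_self hε⟩, (hf (j l)).mono (hsub.trans hNW),
        fun q hq => hfu _ q (hNW (hsub hq))⟩
    · refine ⟨U ×ˢ {0}ᶜ, _, isOpen_prod_compl hU, ⟨hp, hp0⟩, ?_, fun q hq hq0 => rfl⟩
      exact Hol.smul (contMDiffOn_zpow_snd (fun q hq => hq.2) _) (hS.hol_ext hU (hu' l))
  choose m hm hmu using hext
  refine ⟨U, hyU, ⟨⟨fun l => d (j l), fun l => u (j l), m, hU,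
    isFrame_of_linearIndependent hu' hli, isFrame_of_linearIndependent hm fun p hp => ?_,
    fun l p hp hp0 => ?_⟩⟩⟩
  · by_cases hp0 : p.2 = 0
    · have hpε : p ∈ U ×ˢ ball (0 : ℂ) ε := ⟨hp, by rw [hp0]; exact mem_ball_self hε⟩
      have h1 : ∀ l, m l p = f (j l) p := fun l =>
        Hol.eq_of_eq_off_zero (hU.prod isOpen_ball) ((hm l).mono fun q hq => hq.1)
          ((hf (j l)).mono (hsub.trans hNW))
          (fun q hq hq0 => (hmu l q hq0).trans (hfu _ q (hNW (hsub hq)) hq0).symm) p hpε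
      simp only [h1]
      exact hfr.linearIndependent (hsub hpε)
    · have h1 := (hS.linearIndependent_transport hp0 (fun l => d (j l))
        fun l => u (j l) p.1).2 (hli _ hp)
      have h2 : (fun l => m l p) = fun l =>
          hS.transport p hp0 (p.2 ^ d (j l) • u (j l) p.1) := funext fun l => by
        rw [hmu l p hp0, map_smul]
        rfl
      rw [h2]
      exact h1
  · rw [hmu l p hp0, map_smul]
    rfl

end IntegrableStructure.TrivialMonodromy

end AdaptedFrame
end

noncomputable section

/-! ### The filtration by the order of the pole along `ħ = 0` -/

section Filtration

open Set Module HolBundle Metric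

variable {Y : Type v} [TopologicalSpace Y] [ChartedSpace ℂ Y] [IsManifold 𝓘(ℂ, ℂ) ω Y]
  {T : SmoothTriple.{u} Y} {S : IntegrableStructure T}

namespace IntegrableStructure.TrivialMonodromy

variable (hS : S.TrivialMonodromy)

/-- The subspace of the vectors `v` such that `ħ^d v` extends across `ħ = 0`. -/
def filt (d : ℤ) (y : Y) : Submodule ℂ ((T.E.slice 1).fib y) where
  carrier := {v | ∃ W n, IsOpen W ∧ (y, (0 : ℂ)) ∈ W ∧ T.E.Hol W n ∧
    ∀ z : ℂ, ∀ hz : z ≠ 0, (y, z) ∈ W → n (y, z) = hS.transport (y, z) hz (z ^ d • v)}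
  add_mem' := by
    rintro v v' ⟨W, n, hW, hy, hn, h⟩ ⟨W', n', hW', hy', hn', h'⟩
    refine ⟨_, fun p => n p + n' p, hW.inter hW', ⟨hy, hy'⟩,
      (hn.mono inter_subset_left).add (hn'.mono inter_subset_right), fun z hz hp => ?_⟩
    beta_reduce
    rw [h z hz hp.1, h' z hz hp.2, smul_add, map_add]
  zero_mem' := ⟨univ, fun _ => 0, isOpen_univ, mem_univ _, hol_zero _, fun z hz _ => by
    rw [smul_zero, map_zero]⟩
  smul_mem' := by
    rintro a v ⟨W, n, hW, hy, hn, h⟩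
    refine ⟨W, fun p => a • n p, hW, hy, hn.const_smul a, fun z hz hp => ?_⟩
    beta_reduce
    rw [h z hz hp, smul_comm (z ^ d), ← map_smul]

variable {hS}

theorem Extends.mem_filt {d : ℤ} {W : Set (Y × ℂ)} (hW : IsOpen W)
    {v : ∀ y, (T.E.slice 1).fib y} (h : hS.Extends d W v) {y : Y} (hy : (y, (0 : ℂ)) ∈ W) :
    v y ∈ hS.filt d y := by
  obtain ⟨m, hm, hmv⟩ := h
  exact ⟨W, m, hW, hy, hm, fun z hz hp => hmv (y, z) hp hz⟩

namespace AdaptedFrame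

variable {U : Set Y} (A : hS.AdaptedFrame U)

/-- The section ħ^d v has coordinates c_j ħ^{d - d_j} in the frame f, and the vanishing hypothesis
removes all poles. Truncation by `toNat` happens only where c_j = 0. -/
theorem extends_of_coeff_eq_zero {U' : Set Y} (hU' : IsOpen U') (hUU' : U' ⊆ U) {d : ℤ}
    {v : ∀ y, (T.E.slice 1).fib y} (hv : (T.E.slice 1).Hol U' v)
    (h : ∀ y ∈ U', ∀ j, d < A.d j → A.isFrame_u.coeff j y (v y) = 0) :
    hS.Extends d (Prod.fst ⁻¹' U') v := by
  have hc : ∀ j, ContMDiffOn 𝓘(ℂ, ℂ) 𝓘(ℂ, ℂ) ω (fun y => A.isFrame_u.coeff j y (v y)) U' :=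
    fun j => HolBundle.IsFrame.contMDiffOn_coeff hU' hUU' A.isFrame_u hv j
  refine ⟨fun p => ∑ j, (A.isFrame_u.coeff j p.1 (v p.1) * p.2 ^ (d - A.d j).toNat) • A.f j p,
    Hol.sum fun j _ => Hol.smul (((hc j).comp contMDiffOn_fst fun p hp => hp).mul
      (contMDiffOn_snd.pow _)) (Hol.mono (A.isFrame_f.contMDiffOn j) fun p hp => hUU' hp),
    fun p hp hp0 => ?_⟩
  have h1 := HolBundle.IsFrame.sum_coeff A.isFrame_u (hUU' hp) (v p.1)
  conv_rhs => rw [h1]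
  rw [Finset.smul_sum, map_sum]
  refine Finset.sum_congr rfl fun j _ => ?_
  rw [A.f_eq j p (hUU' hp) hp0, ← map_smul]
  congr 1
  rcases lt_or_ge d (A.d j) with hj | hj
  · rw [h p.1 hp j hj, zero_mul, zero_smul, zero_smul, smul_zero]
  · rw [smul_smul, smul_smul, mul_comm (p.2 ^ d), mul_assoc, ← zpow_natCast,
      Int.toNat_of_nonneg (sub_nonneg.2 hj), ← zpow_add₀ hp0, sub_add_cancel]

/-- If ħ^d v extends, its coordinates c_j ħ^{d - d_j} are continuous at ħ = 0. When d < d_j,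
multiplying by ħ^{d_j - d} gives the constant c_j on one side and the limit 0 on the other. -/
theorem mem_filt_iff {y : Y} (hy : y ∈ U) {d : ℤ} {v : (T.E.slice 1).fib y} :
    v ∈ hS.filt d y ↔ ∀ j, d < A.d j → A.isFrame_u.coeff j y v = 0 := by
  constructor
  · rintro ⟨W, n, hW, hyW, hn, hnv⟩ j hj
    have ho : IsOpen (W ∩ Prod.fst ⁻¹' U) := hW.inter (A.isOpen.preimage continuous_fst)
    have h1 : ContinuousAt (fun p => A.isFrame_f.coeff j p (n p)) (y, (0 : ℂ)) :=
      ((HolBundle.IsFrame.contMDiffOn_coeff ho inter_subset_right A.isFrame_f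
        (hn.mono inter_subset_left) j).continuousOn).continuousAt (ho.mem_nhds ⟨hyW, hy⟩)
    have h2 : Filter.Tendsto (fun z : ℂ => (y, z)) (𝓝[≠] 0) (𝓝 (y, (0 : ℂ))) :=
      ((Continuous.prodMk_right y).tendsto 0).mono_left nhdsWithin_le_nhds
    have hk : (A.d j - d).toNat ≠ 0 := by omega
    have h3 : Filter.Tendsto (fun z : ℂ => z ^ (A.d j - d).toNat) (𝓝[≠] 0) (𝓝 0) := by
      have := ((continuous_pow (A.d j - d).toNat).tendsto (0 : ℂ)).mono_left
        (nhdsWithin_le_nhds (s := {0}ᶜ))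
      simpa [hk] using this
    have h4 := h3.mul (Filter.Tendsto.comp h1 h2)
    rw [zero_mul] at h4
    refine tendsto_nhds_unique_of_eventuallyEq tendsto_const_nhds h4 ?_
    have h5 : ∀ᶠ z : ℂ in 𝓝[≠] 0, (y, z) ∈ W := h2.eventually (hW.mem_nhds hyW)
    filter_upwards [h5, self_mem_nhdsWithin] with z hz hz0
    have hz0' : z ≠ 0 := hz0
    have h6 : n (y, z) = ∑ j, (A.isFrame_u.coeff j y v * z ^ (d - A.d j)) • A.f j (y, z) := by
      rw [hnv z hz0 hz]
      conv_lhs => rw [HolBundle.IsFrame.sum_coeff A.isFrame_u hy v]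
      rw [Finset.smul_sum, map_sum]
      refine Finset.sum_congr rfl fun j _ => ?_
      rw [A.f_eq j (y, z) hy hz0, ← map_smul]
      congr 1
      rw [smul_smul, smul_smul, mul_comm (z ^ d), mul_assoc]
      congr 2
      rw [← zpow_add₀ hz0', sub_add_cancel]
    have h7 := HolBundle.IsFrame.coeff_eq_of_sum A.isFrame_f (p := (y, z)) hy h6 j
    simp only [Function.comp, h7]
    rw [mul_left_comm, ← zpow_natCast, Int.toNat_of_nonneg (by omega), ← zpow_add₀ hz0']
    simp
  · intro h
    have hv : (T.E.slice 1).Hol U fun y' => ∑ j, A.isFrame_u.coeff j y v • A.u j y' :=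
      Hol.sum fun j _ => Hol.const_smul _ (A.isFrame_u.contMDiffOn j)
    have h1 := A.extends_of_coeff_eq_zero A.isOpen Subset.rfl (d := d) hv fun y' hy' j hj => by
      rw [HolBundle.IsFrame.coeff_eq_of_sum A.isFrame_u hy' rfl j, h j hj]
    have h2 := h1.mem_filt (A.isOpen.preimage continuous_fst) (y := y) hy
    rwa [← HolBundle.IsFrame.sum_coeff A.isFrame_u hy v] at h2

theorem coeff_u {y : Y} (hy : y ∈ U) (i j : Fin T.rank) :
    A.isFrame_u.coeff j y (A.u i y) = if j = i then 1 else 0 := by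
  refine HolBundle.IsFrame.coeff_eq_of_sum A.isFrame_u hy (c := fun j => if j = i then 1 else 0)
    ?_ j
  simp

theorem u_mem_filt_iff {y : Y} (hy : y ∈ U) {d : ℤ} {j : Fin T.rank} :
    A.u j y ∈ hS.filt d y ↔ A.d j ≤ d := by
  rw [A.mem_filt_iff hy]
  constructor
  · intro h
    by_contra! hj
    have := h j hj
    rw [A.coeff_u hy, if_pos rfl] at this
    exact one_ne_zero this
  · intro h i hi
    rw [A.coeff_u hy, if_neg]
    rintro rfl
    omega

theorem filt_eq_span {y : Y} (hy : y ∈ U) (d : ℤ) :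
    hS.filt d y = Submodule.span ℂ ((fun j => A.u j y) '' {j | A.d j ≤ d}) := by
  refine le_antisymm (fun v hv => ?_) (Submodule.span_le.2 ?_)
  · rw [HolBundle.IsFrame.sum_coeff A.isFrame_u hy v]
    refine Submodule.sum_mem _ fun j _ => ?_
    by_cases hj : A.d j ≤ d
    · exact Submodule.smul_mem _ _ (Submodule.subset_span ⟨j, hj, rfl⟩)
    · rw [(A.mem_filt_iff hy).1 hv j (not_le.1 hj), zero_smul]
      exact Submodule.zero_mem _
  · rintro _ ⟨j, hj, rfl⟩
    exact (A.u_mem_filt_iff hy).2 hj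

theorem filt_eq_bot_iff {y : Y} (hy : y ∈ U) {d : ℤ} : hS.filt d y = ⊥ ↔ ∀ j, d < A.d j := by
  constructor
  · intro h j
    by_contra! hj
    have h1 := (A.u_mem_filt_iff hy).2 hj
    rw [h, Submodule.mem_bot] at h1
    exact (A.isFrame_u.linearIndependent hy).ne_zero j h1
  · intro h
    refine (Submodule.eq_bot_iff _).2 fun v hv => ?_
    rw [HolBundle.IsFrame.sum_coeff A.isFrame_u hy v]
    refine Finset.sum_eq_zero fun j _ => ?_
    rw [(A.mem_filt_iff hy).1 hv j (h j), zero_smul]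

theorem filt_eq_top_iff {y : Y} (hy : y ∈ U) {d : ℤ} : hS.filt d y = ⊤ ↔ ∀ j, A.d j ≤ d := by
  constructor
  · intro h j
    exact (A.u_mem_filt_iff hy).1 (h ▸ Submodule.mem_top)
  · intro h
    refine (Submodule.eq_top_iff'.2 fun v => (A.mem_filt_iff hy).2 fun j hj => ?_)
    exact absurd (h j) (not_le.2 hj)

end AdaptedFrame

variable (hS)

/-- Whether F_d is zero or everything depends only on the exponents of an adapted frame, hence is
locally constant in y. Bounds at one point are valid everywhere by connectedness. -/
theorem filt_finite [ConnectedSpace Y] (hlog : S.IsLogarithmic) :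
    ∃ a b, ∀ y, hS.filt a y = ⊥ ∧ hS.filt b y = ⊤ := by
  obtain ⟨y₀⟩ := (inferInstance : Nonempty Y)
  obtain ⟨U₀, hy₀, ⟨A₀⟩⟩ := hS.exists_adaptedFrame hlog y₀
  obtain ⟨a, ha⟩ := (Set.finite_range A₀.d).bddBelow
  obtain ⟨b, hb⟩ := (Set.finite_range A₀.d).bddAbove
  have h1 : ∀ d, IsLocallyConstant fun y => hS.filt d y = ⊥ := fun d => by
    rw [IsLocallyConstant.iff_eventually_eq]
    intro y
    obtain ⟨U, hy, ⟨A⟩⟩ := hS.exists_adaptedFrame hlog y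
    filter_upwards [A.isOpen.mem_nhds hy] with y' hy'
    rw [A.filt_eq_bot_iff hy, A.filt_eq_bot_iff hy']
  have h2 : ∀ d, IsLocallyConstant fun y => hS.filt d y = ⊤ := fun d => by
    rw [IsLocallyConstant.iff_eventually_eq]
    intro y
    obtain ⟨U, hy, ⟨A⟩⟩ := hS.exists_adaptedFrame hlog y
    filter_upwards [A.isOpen.mem_nhds hy] with y' hy'
    rw [A.filt_eq_top_iff hy, A.filt_eq_top_iff hy']
  -- F_d vanishes when d is strictly below all exponents, hence a - 1; it is everything as soon as d
  -- is at least all of them.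
  refine ⟨a - 1, b, fun y => ⟨?_, ?_⟩⟩
  · refine ((h1 (a - 1)).apply_eq_of_preconnectedSpace y₀ y).mp ((A₀.filt_eq_bot_iff hy₀).2 ?_)
    intro j
    have := ha (mem_range_self j)
    omega
  · exact ((h2 b).apply_eq_of_preconnectedSpace y₀ y).mp
      ((A₀.filt_eq_top_iff hy₀).2 fun j => hb (mem_range_self j))

/-- Membership in `filt` only provides an extension for each y separately. The adapted frames make
these vary holomorphically with y, and the local results are glued. -/
theorem extends_of_mem_filt (hlog : S.IsLogarithmic) {d : ℤ} {U : Set Y} (hU : IsOpen U)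
    {v : ∀ y, (T.E.slice 1).fib y} (hv : (T.E.slice 1).Hol U v)
    (hvd : ∀ y ∈ U, v y ∈ hS.filt d y) : hS.Extends d (Prod.fst ⁻¹' U) v := by
  obtain ⟨m, hm, hmv⟩ := exists_hol_of_locally (hU.preimage continuous_fst)
    (s := fun p => p.2 ^ d • hS.ext v p) fun p hp => by
      obtain ⟨U', hy, ⟨A⟩⟩ := hS.exists_adaptedFrame hlog p.1
      have ho := hU.inter A.isOpen
      obtain ⟨m, hm, hmv⟩ := extends_iff_ext.1 (A.extends_of_coeff_eq_zero ho inter_subset_right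
        (hv.mono inter_subset_left) fun y hy => (A.mem_filt_iff hy.2).1 (hvd y hy.1))
      exact ⟨_, m, ho.preimage continuous_fst, ⟨hp, hy⟩, hm, hmv⟩
  exact extends_iff_ext.2 ⟨m, hm, fun p _ => hmv p⟩

/-- The operator ħξ preserves `H'` and sends ħ^d v to ħ^{d+1} ∇_ξ v, so the latter extends. -/
theorem filt_griffiths (hlog : S.IsLogarithmic) {d : ℤ} {U : Set Y} (hU : IsOpen U)
    {v : ∀ y, (T.E.slice 1).fib y} (hv : (T.E.slice 1).Hol U v)
    (hvd : ∀ y ∈ U, v y ∈ hS.filt d y) {y : Y} (hy : y ∈ U) (ξ : TangentSpace 𝓘(ℂ, ℂ) y) :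
    hS.conn v y ξ ∈ hS.filt (d + 1) y := by
  obtain ⟨m, hm, hmv⟩ := hS.extends_of_mem_filt hlog hU hv hvd
  obtain ⟨U', Ξ, hU', hyU', hΞ, rfl⟩ := exists_holField_through y ξ
  have ho := (hU.inter hU').preimage (continuous_fst (X := Y) (Y := ℂ))
  have hm' : T.E.Hol (Prod.fst ⁻¹' (U ∩ U')) m := hm.mono fun p hp => hp.1
  refine ⟨_, fun p => T.D m p (Ξ p.1), ho, ⟨hy, hyU'⟩, T.D_hol _ _ ho (hU.inter hU')
    (fun p hp => hp) m Ξ hm' (hΞ.mono inter_subset_right), fun z hz hp => ?_⟩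
  refine (hS.D_of_eq (hU.preimage continuous_fst) hU (fun p hp => hp) hv hm hmv
    (p := (y, z)) hy hz (Ξ y)).trans ?_
  rw [smul_smul, zpow_add_one₀ hz, mul_comm]

theorem conn_local {U : Set Y} (hU : IsOpen U) {v w : ∀ y, (T.E.slice 1).fib y}
    (hv : (T.E.slice 1).Hol U v) (hw : (T.E.slice 1).Hol U w) (h : ∀ y ∈ U, v y = w y) {y : Y}
    (hy : y ∈ U) : hS.conn v y = hS.conn w y :=
  T.D_local _ (isOpen_prod_compl hU) _ _ (hS.hol_ext hU hv) (hS.hol_ext hU hw)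
    (fun p hp => by rw [ext, ext, h p.1 hp.1]) _ ⟨hy, one_ne_zero⟩

theorem conn_add {U : Set Y} (hU : IsOpen U) {v w : ∀ y, (T.E.slice 1).fib y}
    (hv : (T.E.slice 1).Hol U v) (hw : (T.E.slice 1).Hol U w) {y : Y} (hy : y ∈ U) :
    hS.conn (fun x => v x + w x) y = hS.conn v y + hS.conn w y := by
  have ho := isOpen_prod_compl hU
  have h1 := T.D_add _ ho _ _ (hS.hol_ext hU hv) (hS.hol_ext hU hw) (y, 1) ⟨hy, one_ne_zero⟩
  refine Eq.trans ?_ h1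
  refine T.D_local _ ho _ _ (hS.hol_ext hU (hv.add hw))
    ((hS.hol_ext hU hv).add (hS.hol_ext hU hw)) (fun p hp => ?_) _ ⟨hy, one_ne_zero⟩
  rw [ext_of_ne _ _ _ hp.2, map_add]
  rfl

theorem conn_leibniz {U : Set Y} (hU : IsOpen U) {f : Y → ℂ} {v : ∀ y, (T.E.slice 1).fib y}
    (hf : ContMDiffOn 𝓘(ℂ, ℂ) 𝓘(ℂ, ℂ) ω f U) (hv : (T.E.slice 1).Hol U v) {y : Y} (hy : y ∈ U)
    (ξ : TangentSpace 𝓘(ℂ, ℂ) y) :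
    hS.conn (fun x => f x • v x) y ξ = f y • hS.conn v y ξ + dY f y ξ • v y := by
  have ho := isOpen_prod_compl hU
  have hf' : ContMDiffOn modelYΩ 𝓘(ℂ, ℂ) ω (fun p : Y × ℂ => f p.1) (U ×ˢ {0}ᶜ) :=
    hf.comp contMDiffOn_fst fun p hp => hp.1
  have h1 := T.D_leibniz _ ho _ _ hf' (hS.hol_ext hU hv) (y, 1) ⟨hy, one_ne_zero⟩ ξ
  rw [one_mul, ext_one] at h1
  refine (LinearMap.congr_fun (?_ : hS.conn (fun x => f x • v x) y =
    T.D (fun q => f q.1 • hS.ext v q) (y, 1)) ξ).trans h1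
  refine T.D_local _ ho _ _ (hS.hol_ext hU (Hol.smul hf hv)) (Hol.smul hf' (hS.hol_ext hU hv))
    (fun p hp => ?_) _ ⟨hy, one_ne_zero⟩
  rw [ext_of_ne _ _ _ hp.2, map_smul]
  rfl

theorem conn_hol {U : Set Y} (hU : IsOpen U) {v : ∀ y, (T.E.slice 1).fib y}
    {ξ : ∀ y : Y, TangentSpace 𝓘(ℂ, ℂ) y} (hv : (T.E.slice 1).Hol U v) (hξ : HolField Y U ξ) :
    (T.E.slice 1).Hol U fun y => hS.conn v y (ξ y) := by
  have ho := isOpen_prod_compl hU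
  exact (Hol.slice (c := 1) ho (T.D_hol _ U ho hU (fun p hp => hp.1) _ ξ (hS.hol_ext hU hv)
    hξ)).mono fun y hy => ⟨hy, one_ne_zero⟩

theorem pairing_smul_smul (y : Y) (a b : ℂ) (v w : (T.E.slice 1).fib y) :
    hS.pairing y (a • v) (b • w) = a * conj b * hS.pairing y v w := by
  rw [LinearMap.map_smulₛₗ, LinearMap.map_smulₛₗ, LinearMap.smul_apply, smul_eq_mul, smul_eq_mul,
    RingHom.id_apply]
  ring

/-- The filtered flat bundle over `ħ = 1`. -/
def filteredFlatBundle [ConnectedSpace Y] (hlog : S.IsLogarithmic) :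
    FilteredFlatBundle.{u} Y where
  rank := T.rank
  V := T.E.slice 1
  conn := hS.conn
  conn_local _ hU _ _ hv hw h _ hy := hS.conn_local hU hv hw h hy
  conn_add _ hU _ _ hv hw _ hy := hS.conn_add hU hv hw hy
  conn_leibniz _ hU _ _ hf hv _ hy ξ := hS.conn_leibniz hU hf hv hy ξ
  conn_hol _ hU _ _ hv hξ := hS.conn_hol hU hv hξ
  F := hS.filt
  F_mono i j hij y v hv := by
    obtain ⟨U, hy, ⟨A⟩⟩ := hS.exists_adaptedFrame hlog y
    exact (A.mem_filt_iff hy).2 fun l hl => (A.mem_filt_iff hy).1 hv l (hij.trans_lt hl)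
  F_finite := hS.filt_finite hlog
  F_subbundle i y₀ := by
    obtain ⟨U, hy, ⟨A⟩⟩ := hS.exists_adaptedFrame hlog y₀
    exact ⟨U, A.u, {j | A.d j ≤ i}, A.isOpen, hy, A.isFrame_u.contMDiffOn, fun y hy =>
      ⟨A.isFrame_u.linearIndependent hy, top_le_iff.1 (A.isFrame_u.generating hy),
        A.filt_eq_span hy i⟩⟩
  griffiths _ _ hU _ hv hvd _ hy ξ := hS.filt_griffiths hlog hU hv hvd hy ξ
  k := hS.pairing
  k_smooth _ hU _ _ hv hw := hS.pairing_smooth hU hv hw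
  k_flat_left _ hU _ _ hv hw _ hy ξ := hS.pairing_flat_left hU hv hw hy ξ
  k_flat_right _ hU _ _ hv hw _ hy ξ := hS.pairing_flat_right hU hv hw hy ξ

/-- Local generators ħ^d v of the Rees module extend by `extends_of_mem_filt`. In the other
direction the coordinates of m in an adapted frame are the coefficients sought, as u_i lies in
F_{d_i}. -/
theorem isReesSection_iff [ConnectedSpace Y] (hlog : S.IsLogarithmic) {W : Set (Y × ℂ)}
    (hW : IsOpen W) (s : ∀ p : Y × ℂ, (T.E.slice 1).fib p.1) :
    (hS.filteredFlatBundle hlog).IsReesSection W s ↔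
      ∃ m, T.E.Hol W m ∧ ∀ p ∈ W, ∀ hp : p.2 ≠ 0, m p = hS.transport p hp (s p) := by
  constructor
  · intro h
    obtain ⟨m, hm, hms⟩ := exists_hol_of_locally hW (s := fun p => hS.flow p.1 (s p) p.2)
      fun p hp => by
        obtain ⟨N, n, f, d, v, hN, hpN, hNW, hf, hv, hvd, hs⟩ := h p hp
        choose m hm hmv using fun i => hS.extends_of_mem_filt hlog (isOpenMap_fst _ hN) (hv i)
          (hvd i)
        have hsub : N ⊆ Prod.fst ⁻¹' (Prod.fst '' N) := subset_preimage_image _ _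
        refine ⟨N, fun q => ∑ i, f i q • m i q, hN, hpN,
          Hol.sum fun i _ => Hol.smul (hf i) ((hm i).mono hsub), fun q hq hq0 => ?_⟩
        have h1 : hS.transport q hq0 (s q) =
            hS.transport q hq0 (∑ i, (f i q * q.2 ^ d i) • v i q.1) :=
          congrArg _ (hs q hq hq0)
        refine Eq.trans ?_ h1.symm
        refine Eq.trans ?_ (map_sum (hS.transport q hq0) _ _).symm
        refine Finset.sum_congr rfl fun i _ => ?_
        rw [hmv i q (hsub hq) hq0, ← map_smul]
        exact congrArg _ (smul_smul _ _ _)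
    exact ⟨m, hm, fun p _ hp0 => hms p hp0⟩
  · rintro ⟨m, hm, hms⟩ p hp
    obtain ⟨U, hy, ⟨A⟩⟩ := hS.exists_adaptedFrame hlog p.1
    have ho : IsOpen (W ∩ Prod.fst ⁻¹' U) := hW.inter (A.isOpen.preimage continuous_fst)
    have hU : Prod.fst '' (W ∩ Prod.fst ⁻¹' U) ⊆ U := by
      rintro _ ⟨q, hq, rfl⟩
      exact hq.2
    refine ⟨W ∩ Prod.fst ⁻¹' U, T.rank, fun i q => A.isFrame_f.coeff i q (m q), A.d, A.u, ho,
      ⟨hp, hy⟩, inter_subset_left, fun i => HolBundle.IsFrame.contMDiffOn_coeff ho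
        inter_subset_right A.isFrame_f (hm.mono inter_subset_left) i,
      fun i => Hol.mono (A.isFrame_u.contMDiffOn i) hU,
      fun i y hy' => (A.u_mem_filt_iff (hU hy')).2 le_rfl, fun q hq hq0 => ?_⟩
    refine (hS.transport q hq0).injective ?_
    refine (hms q hq.1 hq0).symm.trans ?_
    refine (HolBundle.IsFrame.sum_coeff A.isFrame_f (p := q) hq.2 (m q)).trans ?_
    refine Eq.trans ?_ (map_sum (hS.transport q hq0) _ _).symm
    refine Finset.sum_congr rfl fun i _ => ?_
    rw [A.f_eq i q hq.2 hq0, ← map_smul, smul_smul]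
    rfl

/-- The isomorphism with the analytization of the Rees triple given by parallel transport. -/
def analytizationIso [ConnectedSpace Y] (hlog : S.IsLogarithmic) :
    AnalytizationIso (hS.filteredFlatBundle hlog) T where
  Φ := hS.transport
  sections _ hW s := hS.isReesSection_iff hlog hW s
  map_D _ _ hU _ hv _ _ hm hmv _ hp hp0 ξ :=
    hS.D_of_eq (hU.preimage continuous_fst) hU (fun _ hp => hp) hv hm hmv hp hp0 ξ
  map_C y z i j v _ w _ := by
    refine (hS.C_transport y z _ _).trans ((hS.pairing_smul_smul y _ _ _ _).trans ?_)
    rw [map_zpow₀]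
    rfl

theorem isCompatible_analytizationIso [ConnectedSpace Y] (hlog : S.IsLogarithmic) :
    (hS.analytizationIso hlog).IsCompatible S :=
  fun _ _ hU _ hv _ _ hm hmv _ hp hp0 =>
    hS.δ_of_eq (hU.preimage continuous_fst) hU (fun _ hp => hp) hv hm hmv hp hp0

end IntegrableStructure.TrivialMonodromy

end Filtration
end

/-! ### The equivalence, assembled from the natural structure and the pole-order filtration. -/

theorem mainTheorem8 {Y : Type v} [TopologicalSpace Y] [T2Space Y] [ConnectedSpace Y]
    [ChartedSpace ℂ Y] [IsManifold 𝓘(ℂ, ℂ) ω Y] (T : SmoothTriple.{u} Y) :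
    ((∃ 𝒱 : FilteredFlatBundle.{u} Y, Nonempty (AnalytizationIso 𝒱 T)) ↔
      ∃ S : IntegrableStructure T, S.IsLogarithmic ∧ S.TrivialMonodromy) ∧
    ∀ S : IntegrableStructure T,
      (∃ (𝒱 : FilteredFlatBundle.{u} Y) (φ : AnalytizationIso 𝒱 T), φ.IsCompatible S) ↔
        S.IsLogarithmic ∧ S.TrivialMonodromy := by 
  refine ⟨⟨?_, ?_⟩, fun S => ⟨?_, ?_⟩⟩
  · rintro ⟨𝒱, ⟨φ⟩⟩
    exact ⟨φ.natStructure,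
      AnalytizationIso.isLogarithmic_of_isCompatible φ.isCompatible_natStructure,
      AnalytizationIso.trivialMonodromy_of_isCompatible φ.isCompatible_natStructure⟩
  · rintro ⟨S, hlog, hS⟩
    exact ⟨hS.filteredFlatBundle hlog, ⟨hS.analytizationIso hlog⟩⟩
  · rintro ⟨𝒱, φ, hφ⟩
    exact ⟨AnalytizationIso.isLogarithmic_of_isCompatible hφ,
      AnalytizationIso.trivialMonodromy_of_isCompatible hφ⟩
  · rintro ⟨hlog, hS⟩
    exact ⟨hS.filteredFlatBundle hlog, hS.analytizationIso hlog,
      hS.isCompatible_analytizationIso hlog⟩
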